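/- Let $p>5$, $\gamma<0$ and $\omega>\gamma^2/4$. For $x\in\mathbb R$ put $$Q(x)=\Big[\tfrac{(p+1)\omega}{2}\,\mathrm{sech}^2\Big(\tfrac{(p-1)\sqrt\omega}{2}|x|+\tanh^{-1}\tfrac{\gamma}{2\sqrt\omega}\Big)\Big]^{\frac1{p-1}} .$$ Let $-\Delta_\gamma f=-f''$ (off the origin) with domain $\mathcal D=\{f\in H^1(\mathbb R;\mathbb C)\cap H^2(\mathbb R\setminus\{0\};\mathbb C): f'(0+)-f'(0-)=-\gamma f(0)\}$, and let $$L^+=-\Delta_\gamma+\omega-pQ^{p-1},\qquad L^-=-\Delta_\gamma+\omega-Q^{p-1},\qquad \mathcal L f=-iL^+f_1+L^-f_2\quad(f=f_1+if_2\in\mathcal D,\ f_1,f_2\ \text{real}).$$ Write $\langle f,g\rangle=\mathrm{Re}\int_{\mathbb R} f\bar g\,dx$ and, for $f=f_1+if_2\in H^1(\mathbb R;\mathbb C)$, $$B_{\omega,\gamma}(f,f)=\int_{\mathbb R}|f'|^2dx+\omega\int_{\mathbb R}|f|^2dx-\gamma|f(0)|^2-\int_{\mathbb R}\big(pQ^{p-1}f_1^2+Q^{p-1}f_2^2\big)dx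 .$$ There are real numbers $\mathfrak y,\mathfrak z>0$, even functions $Y^\pm\in\mathcal D\setminus\{0\}$ with $\mathcal L Y^\pm=\pm\mathfrak y\,Y^\pm$, and odd functions $Z^\pm\in\mathcal D\setminus\{0\}$ with $\mathcal L Z^\pm=\pm\mathfrak z\,Z^\pm$. For every such choice of $\mathfrak y,\mathfrak z,Y^\pm,Z^\pm$ the following hold. 1. Let $G=\mathrm{span}_{\mathbb R}\{iQ,\ i\,\mathrm{Re}\,Y^+,\ \mathrm{Im}\,Y^+,\ i\,\mathrm{Re}\,Z^+,\ \mathrm{Im}\,Z^+\}$. There is $c>0$ such that $B_{\omega,\gamma}(f,f)\ge c\|f\|_{H^1}^2$ for all $f\in H^1(\mathbb R;\mathbb C)$ with $\langle f,g\rangle=0$ for all $g\in G$. 2. There is $c>0$ such that for all $f\in H^1(\mathbb R;\mathbb C)$ $$c\|f\|_{H^1}^2\le B_{\omega,\gamma}(f,f)+c^{-1}\Big(\langle f,iQ\rangle^2+\langle f,iY^+\rangle^2+\langle f,iY^-\rangle^2+\langle f,iZ^+\rangle^2+\langle f,iZ^-\rangle^2\Big).$$ -/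

import Mathlib

open MeasureTheory Filter Topology ComplexConjugate

noncomputable section

namespace DeltaNLS

/-- Membership in the Sobolev space `H¹(ℝ; ℂ)`, for the continuous representative: `f` is locally
absolutely continuous (it is the integral of its a.e. derivative), and `f` and `f'` belong
to `L²(ℝ)`. The a.e. derivative `deriv f` is then the weak derivative of `f`. -/
structure MemH1 (f : ℝ → ℂ) : Prop where
  memLp : MemLp f 2 volume
  memLp_deriv : MemLp (deriv f) 2 volume
  eq_integral : ∀ x : ℝ, f x = f 0 + ∫ t in (0 : ℝ)..x, deriv f t

/-- The `H¹(ℝ)` norm `(‖f‖²_{L²} + ‖f'‖²_{L²})^{1/2}`. -/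
def h1Norm (f : ℝ → ℂ) : ℝ :=
  Real.sqrt ((∫ x, ‖f x‖ ^ 2) + ∫ x, ‖deriv f x‖ ^ 2)

/-- The real `L²` pairing `⟨f, g⟩ = Re ∫ f ḡ dx`. -/
def pairing (f g : ℝ → ℂ) : ℝ :=
  (∫ x, f x * conj (g x)).re

/-- The domain of `-Δ_γ`: functions in `H¹(ℝ) ∩ H²(ℝ ∖ {0})` with
`f'(0+) - f'(0-) = -γ f(0)`. For `f ∈ H¹(ℝ)`, belonging to `H²(ℝ ∖ {0})` means that `f` is
differentiable off the origin, that `f'` is locally absolutely continuous on each of the two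
half-lines (`0 < a * b` says that `a` and `b` lie in the same open half-line), and that `f''`
is in `L²`. -/
structure MemDomain (γ : ℝ) (f : ℝ → ℂ) : Prop where
  memH1 : MemH1 f
  differentiableAt : ∀ x : ℝ, x ≠ 0 → DifferentiableAt ℝ f x
  deriv_sub_deriv : ∀ a b : ℝ, 0 < a * b →
    deriv f b - deriv f a = ∫ t in a..b, deriv (deriv f) t
  memLp_deriv_deriv : MemLp (deriv (deriv f)) 2 volume
  jump : ∃ dr dl : ℂ, Tendsto (deriv f) (𝓝[>] 0) (𝓝 dr) ∧ Tendsto (deriv f) (𝓝[<] 0) (𝓝 dl) ∧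
    dr - dl = -(γ : ℂ) * f 0

/-- The ground state `Q_{ω,γ}` (with `sech = 1 / cosh`). -/
def Q (p ω γ : ℝ) (x : ℝ) : ℝ :=
  ((p + 1) * ω / 2 *
    (1 / Real.cosh ((p - 1) * Real.sqrt ω / 2 * |x| +
      Real.artanh (γ / (2 * Real.sqrt ω)))) ^ 2) ^ (1 / (p - 1))

/-- `L⁺_{ω,γ} f = -f'' + ω f - p Q^{p-1} f` off the origin, for a real function `f`. The
interaction at the origin is encoded in the domain `MemDomain`. -/
def Lplus (p ω γ : ℝ) (f : ℝ → ℝ) (x : ℝ) : ℝ :=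
  -deriv (deriv f) x + ω * f x - p * Q p ω γ x ^ (p - 1) * f x

/-- `L⁻_{ω,γ} f = -f'' + ω f - Q^{p-1} f` off the origin, for a real function `f`. -/
def Lminus (p ω γ : ℝ) (f : ℝ → ℝ) (x : ℝ) : ℝ :=
  -deriv (deriv f) x + ω * f x - Q p ω γ x ^ (p - 1) * f x

/-- The linearized operator `ℒ_{ω,γ} f = -i L⁺ f₁ + L⁻ f₂` for `f = f₁ + i f₂`. -/
def linOp (p ω γ : ℝ) (f : ℝ → ℂ) (x : ℝ) : ℂ :=
  -Complex.I * (Lplus p ω γ (fun y => (f y).re) x : ℂ) +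
    (Lminus p ω γ (fun y => (f y).im) x : ℂ)

/-- `f` is an eigenfunction of `ℒ_{ω,γ}` for the real eigenvalue `μ`: a nonzero element of the
domain with `ℒ_{ω,γ} f = μ f` in `L²`. -/
structure IsEigenfunction (p ω γ μ : ℝ) (f : ℝ → ℂ) : Prop where
  memDomain : MemDomain γ f
  ne_zero : f ≠ 0
  eigen : ∀ᵐ x : ℝ, linOp p ω γ f x = (μ : ℂ) * f x

/-- `Y^±` are even eigenfunctions of `ℒ_{ω,γ}` for `±y` with `y > 0`, and `Z^±` are odd
eigenfunctions for `±z` with `z > 0`. -/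
structure IsUnstableModes (p ω γ y z : ℝ) (Yp Ym Zp Zm : ℝ → ℂ) : Prop where
  y_pos : 0 < y
  z_pos : 0 < z
  eigen_Yp : IsEigenfunction p ω γ y Yp
  eigen_Ym : IsEigenfunction p ω γ (-y) Ym
  eigen_Zp : IsEigenfunction p ω γ z Zp
  eigen_Zm : IsEigenfunction p ω γ (-z) Zm
  even_Yp : ∀ x, Yp (-x) = Yp x
  even_Ym : ∀ x, Ym (-x) = Ym x
  odd_Zp : ∀ x, Zp (-x) = -Zp x
  odd_Zm : ∀ x, Zm (-x) = -Zm x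

/-- The form `B⁺_{ω,γ}(f, g)` on real functions. -/
def Bplus (p ω γ : ℝ) (f g : ℝ → ℝ) : ℝ :=
  (∫ x, deriv f x * deriv g x) + ω * (∫ x, f x * g x) - γ * f 0 * g 0 -
    ∫ x, p * Q p ω γ x ^ (p - 1) * f x * g x

/-- The form `B⁻_{ω,γ}(f, g)` on real functions. -/
def Bminus (p ω γ : ℝ) (f g : ℝ → ℝ) : ℝ :=
  (∫ x, deriv f x * deriv g x) + ω * (∫ x, f x * g x) - γ * f 0 * g 0 -
    ∫ x, Q p ω γ x ^ (p - 1) * f x * g x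

/-- `B_{ω,γ}(u, w) = B⁺(Re u, Re w) + B⁻(Im u, Im w)`. -/
def B (p ω γ : ℝ) (u w : ℝ → ℂ) : ℝ :=
  Bplus p ω γ (fun x => (u x).re) (fun x => (w x).re) +
    Bminus p ω γ (fun x => (u x).im) (fun x => (w x).im)

/-- `i Q_{ω,γ}` as a complex function. -/
def iQ (p ω γ : ℝ) (x : ℝ) : ℂ := Complex.I * (Q p ω γ x : ℂ)

/-- The real span `G` of `iQ, i Re Y⁺, Im Y⁺, i Re Z⁺, Im Z⁺`. -/
def G (p ω γ : ℝ) (Yp Zp : ℝ → ℂ) : Submodule ℝ (ℝ → ℂ) :=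
  Submodule.span ℝ
    {iQ p ω γ,
      fun x => Complex.I * ((Yp x).re : ℂ), fun x => ((Yp x).im : ℂ),
      fun x => Complex.I * ((Zp x).re : ℂ), fun x => ((Zp x).im : ℂ)}

/-- The orthogonal complement in `H¹(ℝ)` of a real space of functions, for the real `L²`
pairing. -/
def orth (V : Submodule ℝ (ℝ → ℂ)) : Set (ℝ → ℂ) :=
  {f | MemH1 f ∧ ∀ g ∈ V, pairing f g = 0}

end DeltaNLS

end

open MeasureTheory Filter Topology ComplexConjugate
noncomputable section
namespace DeltaNLS
open Set

/-! ### Absolutely continuous functions on half-lines -/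

/-! Since B(f,f) = B⁺(f₁,f₁) + B⁻(f₂,f₂), the two real forms are treated separately, each as a sum
over two half-lines on which Q is a smooth profile with potential V = Q^(p-1). The tool is Jacobi's
identity: if w'' = qw and w has no zero, then f'² + qf² equals (f' - (w'/w)f)² plus the derivative
of (w'/w)f².

For L⁻ the choice w = Q has no zero and matches the boundary condition exactly, so B⁻ ≥ 0 with
kernel spanned by Q (`halfForm_one_nonneg`). For L⁺ the choice w = Q' on the half-line vanishes only
at the maximum x₀ > 0 of the profile, so B⁺ ≥ 0 on functions vanishing at ±x₀ (`halfForm_p_nonneg`).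
Within one parity class this is a single linear condition; hence B⁺ has at most one negative
direction there, and it is strictly positive on the B⁺-orthogonal complement of such a direction
(`bil_p_pos`).

A mode u + iv for the eigenvalue y means L⁻v = yu and L⁺u = -yv. Then B⁺(u,u) = -B⁻(v,v) < 0, so u
is the negative direction of its parity class, and B⁺-orthogonality to u is L²-orthogonality to v.
Therefore B⁺ > 0 on functions orthogonal to Im Y⁺ and Im Z⁺, while B⁻ > 0 on functions orthogonal to
Q. Because V is a weakly continuous perturbation of a coercive form, strict positivity upgrades to
coercivity with a penalty (`coercive_of_pos`). The same sign argument shows that the mode of given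
parity and eigenvalue is unique up to a factor (`WeakPair.exists_eq_smul`), so Y⁻ is a multiple of
the conjugate of Y⁺, and the pairings with iY⁺ and iY⁻ control the pairing with Im Y⁺; likewise for
Z.

Existence of the modes is variational (`exists_eigenpair`, `exists_weakPair`): in a parity class and
orthogonally to Q, the least m making B⁺ + m(L⁻)⁻¹ nonnegative is the square of the eigenvalue. It
is positive once B⁺ is negative somewhere in that class. For even functions a combination of Q and
∂_ωQ works, because p > 5 and γ < 0 give ⟨∂_ωQ, Q⟩ < 0; for odd functions a perturbation of Q' cut
off at the maximum works. -/

theorem abs_le_integral_of_ac {g : ℝ → ℝ} {x : ℝ}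
    (hg : AbsolutelyContinuousOnInterval g x (x + 1)) :
    |g x| ≤ ∫ y in x..x + 1, (|g y| + |deriv g y|) := by
  have hx : x ≤ x + 1 := by linarith
  have hint : IntervalIntegrable (fun y => |g y|) volume x (x + 1) :=
    hg.continuousOn.abs.intervalIntegrable
  have hint' : IntervalIntegrable (fun y => |deriv g y|) volume x (x + 1) :=
    hg.intervalIntegrable_deriv.abs
  have key : ∀ y ∈ Icc x (x + 1), |g x| ≤ |g y| + ∫ t in x..x + 1, |deriv g t| := by
    intro y hy
    have hsub : AbsolutelyContinuousOnInterval g x y := hg.mono (by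
      rw [uIcc_of_le hx, uIcc_of_le hy.1]
      exact Icc_subset_Icc_right hy.2)
    have h1 := hsub.integral_deriv_eq_sub
    have h2 : |∫ t in x..y, deriv g t| ≤ ∫ t in x..y, |deriv g t| :=
      intervalIntegral.abs_integral_le_integral_abs hy.1
    have h3 : ∫ t in x..y, |deriv g t| ≤ ∫ t in x..x + 1, |deriv g t| := by
      apply intervalIntegral.integral_mono_interval le_rfl hy.1 hy.2 _ hint'
      exact Eventually.of_forall fun _ => abs_nonneg _
    rw [h1] at h2
    have : |g x| ≤ |g y| + |g y - g x| := by
      have := abs_sub_abs_le_abs_sub (g x) (g y)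
      rw [abs_sub_comm] at this
      linarith
    linarith
  have := intervalIntegral.integral_mono_on (a := x) (b := x + 1) (μ := volume) hx
    (f := fun _ => |g x|) (g := fun y => |g y| + ∫ t in x..x + 1, |deriv g t|)
    intervalIntegrable_const (hint.add intervalIntegrable_const) key
  rw [intervalIntegral.integral_add hint intervalIntegrable_const] at this
  rw [intervalIntegral.integral_add hint hint']
  simpa using this

/-- The bound over a unit window majorises |g x| by the difference of a convergent integral at x + 1
and at x. -/
theorem tendsto_zero_of_ac {g : ℝ → ℝ} {a : ℝ}
    (hg : ∀ b, a ≤ b → AbsolutelyContinuousOnInterval g a b)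
    (hi : IntegrableOn g (Ioi a)) (hi' : IntegrableOn (deriv g) (Ioi a)) :
    Tendsto g atTop (𝓝 0) := by
  have hG : IntegrableOn (fun y => |g y| + |deriv g y|) (Ioi a) := hi.abs.add hi'.abs
  have h1 := intervalIntegral_tendsto_integral_Ioi a hG tendsto_id
  have h2 := intervalIntegral_tendsto_integral_Ioi a hG
    (tendsto_atTop_add_const_right atTop (1 : ℝ) tendsto_id)
  have h3 := h2.sub h1
  rw [sub_self] at h3
  refine squeeze_zero_norm' ?_ h3
  filter_upwards [eventually_ge_atTop a] with x hx
  have hac : AbsolutelyContinuousOnInterval g x (x + 1) := (hg (x + 1) (by linarith)).mono (by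
    rw [uIcc_of_le (by linarith), uIcc_of_le (by linarith)]
    exact Icc_subset_Icc_left hx)
  have hI : ∀ b, a ≤ b → IntervalIntegrable (fun y => |g y| + |deriv g y|) volume a b :=
    fun b hb => by
      rw [intervalIntegrable_iff_integrableOn_Ioc_of_le hb]
      exact hG.mono_set Ioc_subset_Ioi_self
  simp only [id]
  rw [intervalIntegral.integral_interval_sub_left (hI _ (by linarith)) (hI _ hx)]
  exact abs_le_integral_of_ac hac

theorem integral_Ioi_deriv_of_ac {g : ℝ → ℝ} {a : ℝ}
    (hg : ∀ b, a ≤ b → AbsolutelyContinuousOnInterval g a b)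
    (hi : IntegrableOn g (Ioi a)) (hi' : IntegrableOn (deriv g) (Ioi a)) :
    ∫ x in Ioi a, deriv g x = - g a := by
  have h1 := intervalIntegral_tendsto_integral_Ioi a hi' tendsto_id
  have h2 := (tendsto_zero_of_ac hg hi hi').sub_const (g a)
  rw [zero_sub] at h2
  refine tendsto_nhds_unique h1 (h2.congr' ?_)
  filter_upwards [eventually_ge_atTop a] with x hx
  exact ((hg x hx).integral_deriv_eq_sub).symm

theorem ae_differentiableAt_Ioi {f : ℝ → ℝ} {a : ℝ}
    (hf : ∀ b, a ≤ b → AbsolutelyContinuousOnInterval f a b) :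
    ∀ᵐ x ∂volume.restrict (Ioi a), DifferentiableAt ℝ f x := by
  rw [ae_restrict_iff' measurableSet_Ioi]
  have h : ∀ n : ℕ, ∀ᵐ x, x ∈ uIcc a (a + n) → DifferentiableAt ℝ f x :=
    fun n => (hf (a + n) (by simp)).ae_differentiableAt
  filter_upwards [ae_all_iff.2 h] with x hx hxa
  obtain ⟨n, hn⟩ := exists_nat_ge (x - a)
  refine hx n ?_
  rw [uIcc_of_le (by simp)]
  exact ⟨le_of_lt hxa, by linarith⟩

/-- The Sobolev space `H¹(a, ∞)` of real functions. -/
structure HL (a : ℝ) (f : ℝ → ℝ) : Prop where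
  memLp : MemLp f 2 (volume.restrict (Ioi a))
  memLp_deriv : MemLp (deriv f) 2 (volume.restrict (Ioi a))
  ac : ∀ b, a ≤ b → AbsolutelyContinuousOnInterval f a b

namespace HL

variable {a : ℝ} {f g : ℝ → ℝ}

theorem mul_integrable (hf : HL a f) (hg : HL a g) :
    IntegrableOn (fun x => f x * g x) (Ioi a) := hf.memLp.integrable_mul hg.memLp

theorem deriv_mul_integrable (hf : HL a f) (hg : HL a g) :
    IntegrableOn (fun x => deriv f x * g x) (Ioi a) := hf.memLp_deriv.integrable_mul hg.memLp

theorem mul_deriv_integrable (hf : HL a f) (hg : HL a g) :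
    IntegrableOn (fun x => f x * deriv g x) (Ioi a) := hf.memLp.integrable_mul hg.memLp_deriv

theorem deriv_mul_ae (hf : HL a f) (hg : HL a g) :
    deriv (fun x => f x * g x) =ᵐ[volume.restrict (Ioi a)]
      fun x => deriv f x * g x + f x * deriv g x := by
  filter_upwards [ae_differentiableAt_Ioi hf.ac, ae_differentiableAt_Ioi hg.ac] with x hx hx'
  exact deriv_fun_mul hx hx'

theorem deriv_mul_integrable' (hf : HL a f) (hg : HL a g) :
    IntegrableOn (deriv fun x => f x * g x) (Ioi a) :=
  ((hf.deriv_mul_integrable hg).add (hf.mul_deriv_integrable hg)).congr (hf.deriv_mul_ae hg).symm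

theorem mul_ac (hf : HL a f) (hg : HL a g) :
    ∀ b, a ≤ b → AbsolutelyContinuousOnInterval (fun x => f x * g x) a b :=
  fun b hb => (hf.ac b hb).fun_mul (hg.ac b hb)

theorem integral_by_parts (hf : HL a f) (hg : HL a g) :
    ∫ x in Ioi a, deriv f x * g x = - (f a * g a) - ∫ x in Ioi a, f x * deriv g x := by
  have h := integral_Ioi_deriv_of_ac (hf.mul_ac hg) (hf.mul_integrable hg)
    (hf.deriv_mul_integrable' hg)
  rw [integral_congr_ae (hf.deriv_mul_ae hg),
    integral_add (hf.deriv_mul_integrable hg) (hf.mul_deriv_integrable hg)] at h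
  linarith

theorem tendsto_mul (hf : HL a f) (hg : HL a g) : Tendsto (fun x => f x * g x) atTop (𝓝 0) :=
  tendsto_zero_of_ac (hf.mul_ac hg) (hf.mul_integrable hg) (hf.deriv_mul_integrable' hg)

theorem mono {b : ℝ} (hf : HL a f) (hab : a ≤ b) : HL b f where
  memLp := hf.memLp.mono_measure (Measure.restrict_mono (Ioi_subset_Ioi hab) le_rfl)
  memLp_deriv := hf.memLp_deriv.mono_measure (Measure.restrict_mono (Ioi_subset_Ioi hab) le_rfl)
  ac c hc := (hf.ac c (hab.trans hc)).mono (by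
    rw [uIcc_of_le hc, uIcc_of_le (hab.trans hc)]
    exact Icc_subset_Icc_left hab)

theorem sq_integrable (hf : HL a f) : IntegrableOn (fun x => f x ^ 2) (Ioi a) := hf.memLp.integrable_sq

theorem deriv_sq_integrable (hf : HL a f) : IntegrableOn (fun x => deriv f x ^ 2) (Ioi a) :=
  hf.memLp_deriv.integrable_sq

theorem sq_le (hf : HL a f) {x : ℝ} (hx : a ≤ x) :
    f x ^ 2 ≤ (∫ y in Ioi a, f y ^ 2) + ∫ y in Ioi a, deriv f y ^ 2 := by
  have hf' := hf.mono hx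
  have h := hf'.integral_by_parts hf'
  -- There is no boundary term at infinity; the pointwise inequality -2ff' ≤ f² + f'² then yields
  -- the Sobolev bound.
  have h2 : f x ^ 2 = ∫ y in Ioi x, -2 * (deriv f y * f y) := by
    rw [integral_const_mul]
    have : ∫ y in Ioi x, f y * deriv f y = ∫ y in Ioi x, deriv f y * f y := by simp_rw [mul_comm]
    rw [this] at h
    nlinarith
  have h3 : f x ^ 2 ≤ ∫ y in Ioi x, (f y ^ 2 + deriv f y ^ 2) := by
    rw [h2]
    refine integral_mono ((hf'.deriv_mul_integrable hf').const_mul _)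
      (hf'.sq_integrable.add hf'.deriv_sq_integrable) fun y => ?_
    simp only
    nlinarith [sq_nonneg (f y + deriv f y)]
  rw [← integral_add hf.sq_integrable hf.deriv_sq_integrable]
  refine h3.trans (setIntegral_mono_set (hf.sq_integrable.add hf.deriv_sq_integrable) ?_ ?_)
  · exact Eventually.of_forall fun y => by simp only [Pi.zero_apply]; positivity
  · exact (Ioi_subset_Ioi hx).eventuallyLE

end HL

/-! ### Real `H¹` functions on the line -/

/-- The Sobolev space `H¹(ℝ)` of real functions (continuous representatives). -/
structure RH1 (f : ℝ → ℝ) : Prop where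
  memLp : MemLp f 2 volume
  memLp_deriv : MemLp (deriv f) 2 volume
  ac : ∀ a b, AbsolutelyContinuousOnInterval f a b

theorem memLp_of_Ioi_neg {f : ℝ → ℝ} (h1 : MemLp f 2 (volume.restrict (Ioi 0)))
    (h2 : MemLp (fun x => f (-x)) 2 (volume.restrict (Ioi 0))) : MemLp f 2 volume := by
  have h3 : MemLp f 2 (volume.restrict (Iio 0)) := by
    have := (MeasurePreserving.restrict_preimage_emb (Measure.measurePreserving_neg
      (volume : Measure ℝ)) (measurableEmbedding_neg ) (Ioi 0))
    have h := h2.comp_measurePreserving this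
    simpa [Function.comp_def] using h
  have h4 : (volume : Measure ℝ) = volume.restrict (Iio 0 ∪ Ioi 0) := by
    rw [Iio_union_Ioi, Measure.restrict_eq_self_of_ae_mem]
    simp [ae_iff, measure_singleton]
  rw [h4]
  refine (memLp_two_iff_integrable_sq ?_).2 ?_
  · rw [aestronglyMeasurable_union_iff]; exact ⟨h3.1, h1.1⟩
  · exact IntegrableOn.union h3.integrable_sq h1.integrable_sq

namespace RH1

variable {f g : ℝ → ℝ}

theorem continuous (hf : RH1 f) : Continuous f := by
  rw [continuous_iff_continuousAt]
  intro x
  refine (hf.ac (x - 1) (x + 1)).continuousOn.continuousAt ?_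
  rw [uIcc_of_le (by linarith)]
  exact Icc_mem_nhds (by linarith) (by linarith)

theorem ae_differentiableAt (hf : RH1 f) : ∀ᵐ x, DifferentiableAt ℝ f x := by
  have h : ∀ n : ℕ, ∀ᵐ x, x ∈ uIcc (-(n : ℝ)) n → DifferentiableAt ℝ f x :=
    fun n => (hf.ac _ _).ae_differentiableAt
  filter_upwards [ae_all_iff.2 h] with x hx
  obtain ⟨n, hn⟩ := exists_nat_ge |x|
  refine hx n ?_
  rw [uIcc_of_le (by linarith [abs_nonneg x])]
  exact abs_le.1 hn

theorem integral_deriv (hf : RH1 f) (a b : ℝ) : ∫ x in a..b, deriv f x = f b - f a :=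
  (hf.ac a b).integral_deriv_eq_sub

theorem hl (hf : RH1 f) (a : ℝ) : HL a f :=
  ⟨hf.memLp.restrict _, hf.memLp_deriv.restrict _, fun b _ => hf.ac a b⟩

/-- Lebesgue differentiation identifies the density `g` with the a.e. derivative. This is how test
functions and limits built as primitives enter H¹. -/
theorem of_integral {f g : ℝ → ℝ} (hf : MemLp f 2 volume) (hg : MemLp g 2 volume)
    (h : ∀ x, f x = f 0 + ∫ t in (0 : ℝ)..x, g t) : RH1 f ∧ deriv f =ᵐ[volume] g := by
  have hl : LocallyIntegrable g volume := hg.locallyIntegrable (by norm_num)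
  have hi : ∀ a b, IntervalIntegrable g volume a b := fun a b =>
    intervalIntegrable_iff.mpr ((hl.integrableOn_isCompact isCompact_uIcc).mono_set uIoc_subset_uIcc)
  have hd : deriv f =ᵐ[volume] g := by
    filter_upwards [_root_.LocallyIntegrable.ae_hasDerivAt_integral hl] with x hx
    have : HasDerivAt f (g x) x := by
      rw [funext h]
      exact (hx 0).const_add _
    exact this.deriv
  refine ⟨⟨hf, (memLp_congr_ae hd).2 hg, fun a b => ?_⟩, hd⟩
  have h1 : AbsolutelyContinuousOnInterval (fun x => ∫ t in a..x, g t) a b :=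
    (hi a b).absolutelyContinuousOnInterval_intervalIntegral (by simp)
  have h2 : f = fun x => f a + ∫ t in a..x, g t := by
    funext x
    rw [h x, h a, add_assoc, intervalIntegral.integral_add_adjacent_intervals (hi _ _) (hi _ _)]
  have h3 : AbsolutelyContinuousOnInterval (fun _ : ℝ => f a) a b :=
    (contDiff_const (n := 1)).contDiffOn.absolutelyContinuousOnInterval
  rw [h2]
  exact h3.fun_add h1

theorem deriv_add_ae (hf : RH1 f) (hg : RH1 g) :
    deriv (f + g) =ᵐ[volume] fun x => deriv f x + deriv g x := by
  filter_upwards [hf.ae_differentiableAt, hg.ae_differentiableAt] with x h1 h2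
  exact deriv_add h1 h2

theorem deriv_smul (c : ℝ) (f : ℝ → ℝ) : deriv (c • f) = fun x => c * deriv f x := by
  funext x
  exact deriv_const_mul_field (v := f) c

theorem add (hf : RH1 f) (hg : RH1 g) : RH1 (f + g) :=
  ⟨hf.memLp.add hg.memLp,
    (memLp_congr_ae (hf.deriv_add_ae hg)).2 (hf.memLp_deriv.add hg.memLp_deriv),
    fun a b => (hf.ac a b).add (hg.ac a b)⟩

theorem const_smul (c : ℝ) (hf : RH1 f) : RH1 (c • f) :=
  ⟨hf.memLp.const_smul c, by
    rw [deriv_smul]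
    exact hf.memLp_deriv.const_mul c,
    fun a b => (hf.ac a b).const_smul c⟩

theorem zero : RH1 (0 : ℝ → ℝ) where
  memLp := MemLp.zero
  memLp_deriv := by
    have : deriv (0 : ℝ → ℝ) = 0 := by funext x; exact deriv_const x 0
    rw [this]; exact MemLp.zero
  ac a b := (contDiff_const (n := 1)).contDiffOn.absolutelyContinuousOnInterval

theorem deriv_neg_arg (f : ℝ → ℝ) : deriv (fun x => f (-x)) = fun x => - deriv f (-x) := by
  funext x
  exact deriv_comp_neg f x

theorem comp_neg (hf : RH1 f) : RH1 fun x => f (-x) := by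
  have hm : MeasurePreserving (fun x : ℝ => -x) volume volume :=
    Measure.measurePreserving_neg volume
  refine (of_integral (g := fun x => - deriv f (-x))
    (hf.memLp.comp_measurePreserving hm) (hf.memLp_deriv.comp_measurePreserving hm).neg ?_).1
  intro x
  have : ∫ t in (0 : ℝ)..x, - deriv f (-t) = ∫ t in (0:ℝ)..(-x), deriv f t := by
    rw [intervalIntegral.integral_neg, intervalIntegral.integral_comp_neg,
      ← intervalIntegral.integral_symm, neg_zero]
  rw [this, hf.integral_deriv]
  simp

theorem sq_integrable (hf : RH1 f) : Integrable (fun x => f x ^ 2) := hf.memLp.integrable_sq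

theorem deriv_sq_integrable (hf : RH1 f) : Integrable (fun x => deriv f x ^ 2) :=
  hf.memLp_deriv.integrable_sq

theorem sq_le (hf : RH1 f) (x : ℝ) :
    f x ^ 2 ≤ (∫ y, f y ^ 2) + ∫ y, deriv f y ^ 2 := by
  have h := (hf.hl x).sq_le le_rfl
  have h1 : ∫ y in Ioi x, f y ^ 2 ≤ ∫ y, f y ^ 2 :=
    setIntegral_le_integral hf.sq_integrable (Eventually.of_forall fun _ => sq_nonneg _)
  have h2 : ∫ y in Ioi x, deriv f y ^ 2 ≤ ∫ y, deriv f y ^ 2 :=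
    setIntegral_le_integral hf.deriv_sq_integrable (Eventually.of_forall fun _ => sq_nonneg _)
  linarith

end RH1

end DeltaNLS
end

open MeasureTheory Filter Topology ComplexConjugate
noncomputable section
namespace DeltaNLS
open Set

/-! ### The soliton profile -/

/-- The admissible range of the parameters. -/
structure Params (p ω γ : ℝ) : Prop where
  hp : 5 < p
  hγ : γ < 0
  hω : γ ^ 2 / 4 < ω

/-- The argument of the hyperbolic functions in the profile. -/
def phase (p ω γ x : ℝ) : ℝ :=
  (p - 1) * Real.sqrt ω / 2 * x + Real.artanh (γ / (2 * Real.sqrt ω))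

/-- The potential `Q^{p-1}` continued smoothly from the right half-line. -/
def pot (p ω γ x : ℝ) : ℝ := (p + 1) * ω / 2 * (1 / Real.cosh (phase p ω γ x)) ^ 2

/-- The profile `Q` continued smoothly from the right half-line. -/
def sol (p ω γ x : ℝ) : ℝ := pot p ω γ x ^ (1 / (p - 1))

/-- The derivative of `sol`. -/
def sol' (p ω γ x : ℝ) : ℝ := -(Real.sqrt ω * Real.tanh (phase p ω γ x)) * sol p ω γ x

/-- The second derivative of `sol`. -/
def sol'' (p ω γ x : ℝ) : ℝ := (ω - pot p ω γ x) * sol p ω γ x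

/-- The position of the maximum of the profile. -/
def peak (p ω γ : ℝ) : ℝ :=
  -Real.artanh (γ / (2 * Real.sqrt ω)) / ((p - 1) * Real.sqrt ω / 2)

/-- All calculus is done on the smooth profile `sol`, defined on the whole line; the modulus, and
with it the kink at the origin, enters only here. -/
theorem Q_eq_sol (p ω γ x : ℝ) : Q p ω γ x = sol p ω γ |x| := rfl

theorem memLp_of_exp_bound {g : ℝ → ℝ} (hg : Continuous g) {C δ a : ℝ} (hδ : 0 < δ) (ha : 0 ≤ a)
    (h : ∀ x, 0 ≤ x → |g x| ≤ C * Real.exp (-δ * x)) :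
    MemLp g 2 (volume.restrict (Ioi a)) := by
  rw [memLp_two_iff_integrable_sq hg.aestronglyMeasurable]
  have h1 : IntegrableOn (fun x => C ^ 2 * Real.exp (-(2 * δ) * x)) (Ioi a) :=
    (integrableOn_exp_mul_Ioi (by linarith) a).const_mul _
  refine Integrable.mono' h1 (hg.pow 2).aestronglyMeasurable ?_
  filter_upwards [ae_restrict_mem measurableSet_Ioi] with x hx
  have hx0 : 0 ≤ x := ha.trans (le_of_lt hx)
  have := h x hx0
  rw [Real.norm_eq_abs, abs_pow]
  calc |g x| ^ 2 ≤ (C * Real.exp (-δ * x)) ^ 2 := by gcongr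
    _ = C ^ 2 * Real.exp (-(2 * δ) * x) := by
      rw [mul_pow, ← Real.exp_nat_mul]; congr 2; push_cast; ring

namespace Params

variable {p ω γ : ℝ} (h : Params p ω γ)
include h

theorem ω_pos : 0 < ω := by have := h.hω; nlinarith [sq_nonneg γ]

theorem sqrt_pos : 0 < Real.sqrt ω := Real.sqrt_pos.2 h.ω_pos

theorem sq_sqrt : Real.sqrt ω ^ 2 = ω := Real.sq_sqrt h.ω_pos.le

theorem κ_pos : 0 < (p - 1) * Real.sqrt ω / 2 := by
  have := h.hp; have := h.sqrt_pos
  apply div_pos _ two_pos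
  apply mul_pos <;> linarith

theorem ratio_mem : γ / (2 * Real.sqrt ω) ∈ Ioo (-1 : ℝ) 0 := by
  have h1 := h.sqrt_pos
  have h2 := h.sq_sqrt
  have h3 := h.hω
  have h4 := h.hγ
  constructor
  · rw [lt_div_iff₀ (by positivity)]
    nlinarith
  · exact div_neg_of_neg_of_pos h4 (by positivity)

theorem ratio_mem' : γ / (2 * Real.sqrt ω) ∈ Ioo (-1 : ℝ) 1 :=
  ⟨h.ratio_mem.1, h.ratio_mem.2.trans one_pos⟩

theorem pot_pos (x : ℝ) : 0 < pot p ω γ x := by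
  have := h.hp; have := h.ω_pos; have := Real.cosh_pos (phase p ω γ x)
  unfold pot
  have : 0 < p + 1 := by linarith
  positivity

theorem pot_le (x : ℝ) : pot p ω γ x ≤ (p + 1) * ω / 2 := by
  have := h.hp; have := h.ω_pos
  have h1 := Real.one_le_cosh (phase p ω γ x)
  have h2 : (1 / Real.cosh (phase p ω γ x)) ^ 2 ≤ 1 := by
    rw [div_pow, one_pow, div_le_one (by positivity)]
    nlinarith
  unfold pot
  have : 0 ≤ (p + 1) * ω / 2 := by have : 0 < p + 1 := by linarith
                                   positivity
  nlinarith

theorem sol_pos (x : ℝ) : 0 < sol p ω γ x := Real.rpow_pos_of_pos (h.pot_pos x) _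

theorem sol_rpow (x : ℝ) : sol p ω γ x ^ (p - 1) = pot p ω γ x := by
  have := h.hp
  rw [sol, ← Real.rpow_mul (h.pot_pos x).le, one_div_mul_cancel (by linarith), Real.rpow_one]

theorem Q_rpow (x : ℝ) : Q p ω γ x ^ (p - 1) = pot p ω γ |x| := by
  rw [Q_eq_sol, h.sol_rpow]

omit h in
theorem hasDerivAt_phase (x : ℝ) :
    HasDerivAt (phase p ω γ) ((p - 1) * Real.sqrt ω / 2) x := by
  have := ((hasDerivAt_id x).const_mul ((p - 1) * Real.sqrt ω / 2)).add_const
    (Real.artanh (γ / (2 * Real.sqrt ω)))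
  rw [mul_one] at this
  exact this

omit h in
theorem hasDerivAt_pot (x : ℝ) : HasDerivAt (pot p ω γ)
    (-((p - 1) * Real.sqrt ω * Real.tanh (phase p ω γ x)) * pot p ω γ x) x := by
  have hc := Real.cosh_pos (phase p ω γ x)
  have h1 := (((hasDerivAt_phase (p := p) (ω := ω) (γ := γ) x).cosh.fun_inv hc.ne').fun_pow 2).const_mul
    ((p + 1) * ω / 2)
  have h2 : pot p ω γ = fun x => (p + 1) * ω / 2 * (Real.cosh (phase p ω γ x))⁻¹ ^ 2 := by
    funext y; simp [pot]
  rw [h2]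
  refine h1.congr_deriv ?_
  rw [Real.tanh_eq_sinh_div_cosh, Nat.add_one_sub_one, pow_one]
  push_cast
  field_simp

theorem hasDerivAt_sol (x : ℝ) : HasDerivAt (sol p ω γ) (sol' p ω γ x) x := by
  have h0 := h.hp
  have hV := h.pot_pos x
  have h1 := (hasDerivAt_pot (p := p) (ω := ω) (γ := γ) x).rpow_const (p := 1 / (p - 1)) (Or.inl hV.ne')
  refine h1.congr_deriv ?_
  rw [Real.rpow_sub_one hV.ne', sol', sol]
  have : p - 1 ≠ 0 := by linarith
  field_simp

omit h in
theorem hasDerivAt_tanh_phase (x : ℝ) : HasDerivAt (fun x => Real.tanh (phase p ω γ x))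
    ((1 / Real.cosh (phase p ω γ x)) ^ 2 * ((p - 1) * Real.sqrt ω / 2)) x := by
  have hc := Real.cosh_pos (phase p ω γ x)
  have h1 := (hasDerivAt_phase (p := p) (ω := ω) (γ := γ) x).sinh.fun_div (hasDerivAt_phase x).cosh hc.ne'
  have h2 : (fun x => Real.tanh (phase p ω γ x)) =
      fun x => Real.sinh (phase p ω γ x) / Real.cosh (phase p ω γ x) := by
    funext y; rw [Real.tanh_eq_sinh_div_cosh]
  rw [h2]
  refine h1.congr_deriv ?_
  have := Real.cosh_sq (phase p ω γ x)
  field_simp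
  linear_combination ((p - 1) * Real.sqrt ω) * this

omit h in
theorem tanh_sq (x : ℝ) : Real.tanh (phase p ω γ x) ^ 2 = 1 - (1 / Real.cosh (phase p ω γ x)) ^ 2 := by
  have hc := Real.cosh_pos (phase p ω γ x)
  rw [Real.tanh_eq_sinh_div_cosh]
  have := Real.cosh_sq (phase p ω γ x)
  field_simp
  linear_combination (-1 : ℝ) * this

theorem hasDerivAt_sol' (x : ℝ) : HasDerivAt (sol' p ω γ) (sol'' p ω γ x) x := by
  have h1 := (((hasDerivAt_tanh_phase (p := p) (ω := ω) (γ := γ) x).const_mul (Real.sqrt ω)).neg).mul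
    (h.hasDerivAt_sol x)
  refine h1.congr_deriv ?_
  simp only [sol'', sol', pot, Pi.neg_apply]
  have h2 := tanh_sq (p := p) (ω := ω) (γ := γ) x
  have h3 := h.sq_sqrt
  generalize Real.tanh (phase p ω γ x) = t at *
  generalize 1 / Real.cosh (phase p ω γ x) = c at *
  generalize Real.sqrt ω = r at *
  subst h3
  linear_combination (r ^ 2 * sol p (r ^ 2) γ x) * h2

/-- Differentiating the profile equation, with V'Q = (p-1)VQ', shows that `sol'` solves the
homogeneous equation of L⁺. It is the comparison solution for B⁺. -/
theorem hasDerivAt_sol'' (x : ℝ) :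
    HasDerivAt (sol'' p ω γ) ((ω - p * pot p ω γ x) * sol' p ω γ x) x := by
  have h1 := ((hasDerivAt_pot (p := p) (ω := ω) (γ := γ) x).const_sub ω).mul (h.hasDerivAt_sol x)
  refine h1.congr_deriv ?_
  simp only [sol']
  ring

omit h in
theorem continuous_pot : Continuous (pot p ω γ) :=
  continuous_iff_continuousAt.2 fun x => (hasDerivAt_pot (p := p) (ω := ω) (γ := γ) x).continuousAt

theorem continuous_sol : Continuous (sol p ω γ) :=
  continuous_iff_continuousAt.2 fun x => (h.hasDerivAt_sol x).continuousAt

theorem continuous_sol' : Continuous (sol' p ω γ) :=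
  continuous_iff_continuousAt.2 fun x => (h.hasDerivAt_sol' x).continuousAt

theorem continuous_sol'' : Continuous (sol'' p ω γ) :=
  continuous_iff_continuousAt.2 fun x => (h.hasDerivAt_sol'' x).continuousAt

theorem abs_sol'_le (x : ℝ) : |sol' p ω γ x| ≤ Real.sqrt ω * sol p ω γ x := by
  have h1 : |Real.tanh (phase p ω γ x)| ≤ 1 := by
    rw [← sq_le_one_iff_abs_le_one, tanh_sq]
    have := sq_nonneg (1 / Real.cosh (phase p ω γ x))
    linarith
  rw [sol', abs_mul, abs_neg, abs_mul, abs_of_pos (h.sol_pos x), abs_of_pos h.sqrt_pos]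
  have := h.sol_pos x
  have := h.sqrt_pos
  have : Real.sqrt ω * |Real.tanh (phase p ω γ x)| ≤ Real.sqrt ω := by nlinarith
  gcongr

theorem abs_sol''_le (x : ℝ) : |sol'' p ω γ x| ≤ (p * ω) * sol p ω γ x := by
  have h1 := h.pot_pos x
  have h2 := h.pot_le x
  have h3 := h.sol_pos x
  have := h.hp
  have := h.ω_pos
  rw [sol'', abs_mul, abs_of_pos h3]
  gcongr
  rw [abs_le]
  constructor <;> nlinarith

/-- From 1/cosh t ≤ 2e^(-t), the potential decays at rate (p-1)√ω, and the power 1/(p-1) turns this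
into the rate √ω. -/
theorem exists_sol_le : ∃ C, 0 < C ∧ ∀ x, sol p ω γ x ≤ C * Real.exp (-Real.sqrt ω * x) := by
  have hp := h.hp
  have hω := h.ω_pos
  have hp1 : 0 < p + 1 := by linarith
  set β := Real.artanh (γ / (2 * Real.sqrt ω)) with hβ
  have hK : 0 < (p + 1) * ω / 2 * 4 * Real.exp (-2 * β) := by positivity
  refine ⟨((p + 1) * ω / 2 * 4 * Real.exp (-2 * β)) ^ (1 / (p - 1)), by positivity, fun x => ?_⟩
  have h1 : 1 / Real.cosh (phase p ω γ x) ≤ 2 * Real.exp (-phase p ω γ x) := by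
    rw [div_le_iff₀ (Real.cosh_pos _), Real.cosh_eq]
    have := Real.exp_pos (-phase p ω γ x)
    have h2 : Real.exp (-phase p ω γ x) * Real.exp (phase p ω γ x) = 1 := by
      rw [← Real.exp_add]; simp
    nlinarith
  have h2 : pot p ω γ x ≤ (p + 1) * ω / 2 * 4 * Real.exp (-2 * β) *
      Real.exp (-((p - 1) * Real.sqrt ω * x)) := by
    have h3 : (1 / Real.cosh (phase p ω γ x)) ^ 2 ≤ (2 * Real.exp (-phase p ω γ x)) ^ 2 := by
      have := Real.cosh_pos (phase p ω γ x)
      gcongr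
    have h4 : (2 * Real.exp (-phase p ω γ x)) ^ 2 =
        4 * (Real.exp (-2 * β) * Real.exp (-((p - 1) * Real.sqrt ω * x))) := by
      rw [mul_pow, ← Real.exp_nat_mul, ← Real.exp_add, phase]
      congr 2
      · norm_num
      · push_cast; ring
    rw [h4] at h3
    calc pot p ω γ x ≤ (p + 1) * ω / 2 * (4 * (Real.exp (-2 * β) *
          Real.exp (-((p - 1) * Real.sqrt ω * x)))) := by unfold pot; gcongr
      _ = _ := by ring
  have h5 : 0 < 1 / (p - 1) := by apply div_pos one_pos; linarith
  calc sol p ω γ x ≤ ((p + 1) * ω / 2 * 4 * Real.exp (-2 * β) *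
        Real.exp (-((p - 1) * Real.sqrt ω * x))) ^ (1 / (p - 1)) :=
        Real.rpow_le_rpow (h.pot_pos x).le h2 h5.le
    _ = _ := by
      rw [Real.mul_rpow hK.le (Real.exp_pos _).le, ← Real.exp_mul]
      congr 2
      have : p - 1 ≠ 0 := by linarith
      field_simp

/-- The repulsive sign γ < 0 makes the phase negative at the origin, so the maximum of the profile
lies inside the right half-line. -/
theorem peak_pos : 0 < peak p ω γ := by
  have h1 := Real.artanh_neg h.ratio_mem
  exact div_pos (by linarith) h.κ_pos

theorem phase_eq (x : ℝ) : phase p ω γ x = (p - 1) * Real.sqrt ω / 2 * (x - peak p ω γ) := by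
  have := h.κ_pos.ne'
  have hs := h.sqrt_pos.ne'
  have hp : p - 1 ≠ 0 := by have := h.hp; linarith
  rw [phase, peak]
  field_simp
  ring

theorem phase_peak : phase p ω γ (peak p ω γ) = 0 := by rw [h.phase_eq]; simp

theorem sol'_peak : sol' p ω γ (peak p ω γ) = 0 := by simp [sol', h.phase_peak]

theorem sol''_peak_neg : sol'' p ω γ (peak p ω γ) < 0 := by
  have := h.hp
  have := h.ω_pos
  have := h.sol_pos (peak p ω γ)
  have h1 : pot p ω γ (peak p ω γ) = (p + 1) * ω / 2 := by simp [pot, h.phase_peak]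
  rw [sol'', h1]
  apply mul_neg_of_neg_of_pos _ this
  nlinarith

theorem sol'_ne_zero {x : ℝ} (hx : x ≠ peak p ω γ) : sol' p ω γ x ≠ 0 := by
  have h1 : phase p ω γ x ≠ 0 := by
    rw [h.phase_eq]
    exact mul_ne_zero h.κ_pos.ne' (sub_ne_zero.2 hx)
  have h2 : Real.tanh (phase p ω γ x) ≠ 0 := by
    rw [Real.tanh_eq_sinh_div_cosh]
    exact div_ne_zero (Real.sinh_ne_zero.2 h1) (Real.cosh_pos _).ne'
  exact mul_ne_zero (neg_ne_zero.2 (mul_ne_zero h.sqrt_pos.ne' h2)) (h.sol_pos x).ne'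

omit h in
theorem phase_zero : phase p ω γ 0 = Real.artanh (γ / (2 * Real.sqrt ω)) := by simp [phase]

/-- For an even function the jump condition becomes this Robin condition on one half-line; it is the
reason for the inverse hyperbolic tangent in the phase. -/
theorem sol'_zero : sol' p ω γ 0 = -(γ / 2) * sol p ω γ 0 := by
  rw [sol', phase_zero, Real.tanh_artanh h.ratio_mem']
  have := h.sqrt_pos.ne'
  field_simp

theorem pot_zero : pot p ω γ 0 = (p + 1) / 2 * (ω - γ ^ 2 / 4) := by
  have h1 := tanh_sq (p := p) (ω := ω) (γ := γ) 0
  rw [phase_zero, Real.tanh_artanh h.ratio_mem'] at h1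
  have h2 : (1 / Real.cosh (Real.artanh (γ / (2 * Real.sqrt ω)))) ^ 2 = 1 - γ ^ 2 / (4 * ω) := by
    have : (γ / (2 * Real.sqrt ω)) ^ 2 = γ ^ 2 / (4 * ω) := by
      rw [div_pow, mul_pow, h.sq_sqrt]; norm_num
    linarith
  rw [pot, phase_zero, h2]
  have := h.ω_pos.ne'
  field_simp

/-- The factor 1 + x is allowed because ∂_ωQ contains xQ'; it is absorbed by half of the exponential
rate. -/
theorem memLp_of_abs_le_sol {g : ℝ → ℝ} (hg : Continuous g) {C a : ℝ} (ha : 0 ≤ a)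
    (hb : ∀ x, 0 ≤ x → |g x| ≤ C * (1 + x) * sol p ω γ x) :
    MemLp g 2 (volume.restrict (Ioi a)) := by
  obtain ⟨K, hK, hsol⟩ := h.exists_sol_le
  have hr := h.sqrt_pos
  have hC : 0 ≤ C := by
    have h0 := hb 0 le_rfl
    have h1 := h.sol_pos 0
    have h2 := abs_nonneg (g 0)
    by_contra hcon
    push Not at hcon
    nlinarith
  refine memLp_of_exp_bound (C := C * (1 + 2 / Real.sqrt ω) * K) (δ := Real.sqrt ω / 2) hg
    (by positivity) ha fun x hx => ?_
  have h1 : 1 + x ≤ (1 + 2 / Real.sqrt ω) * Real.exp (Real.sqrt ω / 2 * x) := by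
    have h2 := Real.add_one_le_exp (Real.sqrt ω / 2 * x)
    have h3 : x ≤ 2 / Real.sqrt ω * Real.exp (Real.sqrt ω / 2 * x) := by
      rw [div_mul_eq_mul_div, le_div_iff₀ hr]
      nlinarith
    have h4 : 0 ≤ Real.sqrt ω / 2 * x := by positivity
    nlinarith
  calc |g x| ≤ C * (1 + x) * sol p ω γ x := hb x hx
    _ ≤ C * ((1 + 2 / Real.sqrt ω) * Real.exp (Real.sqrt ω / 2 * x)) *
        (K * Real.exp (-Real.sqrt ω * x)) := by
      have := hsol x
      have := (h.sol_pos x).le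
      gcongr
    _ = C * (1 + 2 / Real.sqrt ω) * K *
        (Real.exp (Real.sqrt ω / 2 * x) * Real.exp (-Real.sqrt ω * x)) := by ring
    _ = _ := by rw [← Real.exp_add]; congr 2; ring

end Params

/-! ### Building `H¹` functions from smooth profiles -/

theorem ac_comp_lipschitz {w w' φ : ℝ → ℝ} (hw : ∀ x, HasDerivAt w (w' x) x) (hw' : Continuous w')
    (hφ : LipschitzWith 1 φ) (a b : ℝ) :
    AbsolutelyContinuousOnInterval (fun x => w (φ x)) a b := by
  have hcomp : IsCompact (φ '' uIcc a b) := isCompact_uIcc.image hφ.continuous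
  obtain ⟨c, d, hcd⟩ : ∃ c d, φ '' uIcc a b ⊆ Icc c d := by
    obtain ⟨r, hr⟩ := hcomp.isBounded.subset_closedBall 0
    exact ⟨0 - r, 0 + r, by rwa [← Real.closedBall_eq_Icc]⟩
  obtain ⟨M, hM⟩ := (isCompact_Icc (a := c) (b := d)).exists_bound_of_continuousOn hw'.continuousOn
  have hL : LipschitzOnWith (Real.toNNReal M) w (Icc c d) := by
    refine (convex_Icc c d).lipschitzOnWith_of_nnnorm_hasDerivWithin_le
      (fun x _ => (hw x).hasDerivWithinAt) fun x hx => ?_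
    rw [← NNReal.coe_le_coe, coe_nnnorm, Real.coe_toNNReal']
    exact (hM x hx).trans (le_max_left _ _)
  refine LipschitzOnWith.absolutelyContinuousOnInterval (K := Real.toNNReal M * 1) ?_
  exact hL.comp hφ.lipschitzOnWith fun x hx => hcd ⟨x, hx, rfl⟩

theorem memLp_ite_abs {w : ℝ → ℝ} (h1 : MemLp w 2 (volume.restrict (Ioi 0))) :
    MemLp (fun x => w |x|) 2 volume := by
  apply memLp_of_Ioi_neg
  · refine (memLp_congr_ae ?_).2 h1
    filter_upwards [ae_restrict_mem measurableSet_Ioi] with x hx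
    rw [abs_of_pos hx]
  · refine (memLp_congr_ae ?_).2 h1
    filter_upwards [ae_restrict_mem measurableSet_Ioi] with x hx
    rw [abs_neg, abs_of_pos hx]

theorem deriv_comp_abs {w w' : ℝ → ℝ} (hw : ∀ x, HasDerivAt w (w' x) x) {x : ℝ} (hx : 0 < x) :
    deriv (fun x => w |x|) x = w' x := by
  have : (fun x => w |x|) =ᶠ[𝓝 x] w := by
    filter_upwards [lt_mem_nhds hx] with y hy
    rw [abs_of_pos hy]
  rw [this.deriv_eq, (hw x).deriv]

theorem deriv_comp_abs_neg {w w' : ℝ → ℝ} (hw : ∀ x, HasDerivAt w (w' x) x) {x : ℝ} (hx : 0 < x) :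
    deriv (fun x => w |x|) (-x) = -w' x := by
  have h1 : (fun x => w |x|) = fun x => (fun y => w |y|) (-x) := by
    funext y; simp
  have h2 := congrFun (RH1.deriv_neg_arg fun y => w |y|) x
  have h3 := deriv_comp_abs hw hx
  rw [h1] at h3
  rw [h2] at h3
  linarith

theorem rh1_comp_abs {w w' : ℝ → ℝ} (hw : ∀ x, HasDerivAt w (w' x) x) (hw' : Continuous w')
    (h1 : MemLp w 2 (volume.restrict (Ioi 0))) (h2 : MemLp w' 2 (volume.restrict (Ioi 0))) :
    RH1 fun x => w |x| where
  memLp := memLp_ite_abs h1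
  memLp_deriv := by
    apply memLp_of_Ioi_neg
    · refine (memLp_congr_ae ?_).2 h2
      filter_upwards [ae_restrict_mem measurableSet_Ioi] with x hx
      exact deriv_comp_abs hw hx
    · refine (memLp_congr_ae ?_).2 h2.neg
      filter_upwards [ae_restrict_mem measurableSet_Ioi] with x hx
      exact deriv_comp_abs_neg hw hx
  ac := ac_comp_lipschitz hw hw' (φ := fun x : ℝ => |x|) (by
    refine LipschitzWith.of_dist_le_mul fun x y => ?_
    simpa [Real.dist_eq] using abs_abs_sub_abs_le x y)

theorem deriv_comp_max {w w' : ℝ → ℝ} {a : ℝ} (hw : ∀ x, HasDerivAt w (w' x) x) {x : ℝ}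
    (hx : a < x) : deriv (fun x => w (max x a)) x = w' x := by
  have : (fun x => w (max x a)) =ᶠ[𝓝 x] w := by
    filter_upwards [lt_mem_nhds hx] with y hy
    rw [max_eq_left (le_of_lt hy)]
  rw [this.deriv_eq, (hw x).deriv]

theorem deriv_comp_max_of_lt {w : ℝ → ℝ} {a x : ℝ} (hx : x < a) :
    deriv (fun x => w (max x a)) x = 0 := by
  have : (fun x => w (max x a)) =ᶠ[𝓝 x] fun _ => w a := by
    filter_upwards [gt_mem_nhds hx] with y hy
    rw [max_eq_right (le_of_lt hy)]
  rw [this.deriv_eq, deriv_const]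

theorem memLp_of_Ioi_of_zero {f g : ℝ → ℝ} {a : ℝ} (hg : MemLp g 2 (volume.restrict (Ioi a)))
    (h1 : ∀ x, a < x → f x = g x) (h2 : ∀ x, x < a → f x = 0) : MemLp f 2 volume := by
  refine (memLp_congr_ae ?_).2 ((memLp_indicator_iff_restrict measurableSet_Ioi).2 hg)
  have : ∀ᵐ x : ℝ, x ≠ a := by simp [ae_iff, measure_singleton]
  filter_upwards [this] with x hx
  rcases lt_or_gt_of_ne hx with h | h
  · rw [h2 x h, indicator_of_notMem (by simpa using h.le)]
  · rw [h1 x h, indicator_of_mem (by simpa using h)]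

/-- Cutting at a zero of `w` produces a kink but no jump, so H¹ is preserved. -/
theorem rh1_comp_max {w w' : ℝ → ℝ} {a : ℝ} (hw : ∀ x, HasDerivAt w (w' x) x) (hw' : Continuous w')
    (h0 : w a = 0)
    (h1 : MemLp w 2 (volume.restrict (Ioi a))) (h2 : MemLp w' 2 (volume.restrict (Ioi a))) :
    RH1 fun x => w (max x a) where
  memLp := memLp_of_Ioi_of_zero h1 (fun x hx => by rw [max_eq_left (le_of_lt hx)])
    fun x hx => by rw [max_eq_right (le_of_lt hx), h0]
  memLp_deriv := memLp_of_Ioi_of_zero h2 (fun x hx => deriv_comp_max hw hx)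
    fun x hx => deriv_comp_max_of_lt hx
  ac := ac_comp_lipschitz hw hw' (LipschitzWith.id.max_const a)

end DeltaNLS
end

open MeasureTheory Filter Topology ComplexConjugate
noncomputable section
namespace DeltaNLS
open Set

/-! ### Jacobi's identity -/

theorem ac_of_hasDerivAt {r r' : ℝ → ℝ} {a b : ℝ} (hr : ∀ x ∈ uIcc a b, HasDerivAt r (r' x) x)
    (hr' : ContinuousOn r' (uIcc a b)) : AbsolutelyContinuousOnInterval r a b := by
  obtain ⟨M, hM⟩ := isCompact_uIcc.exists_bound_of_continuousOn hr'
  refine LipschitzOnWith.absolutelyContinuousOnInterval (K := Real.toNNReal M) ?_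
  refine (convex_uIcc a b).lipschitzOnWith_of_nnnorm_hasDerivWithin_le
    (fun x hx => (hr x hx).hasDerivWithinAt) fun x hx => ?_
  rw [← NNReal.coe_le_coe, coe_nnnorm, Real.coe_toNNReal']
  exact (hM x hx).trans (le_max_left _ _)

namespace RH1

variable {f g : ℝ → ℝ}

theorem intervalIntegrable_deriv_sq (hf : RH1 f) (a b : ℝ) :
    IntervalIntegrable (fun x => deriv f x ^ 2) volume a b :=
  hf.deriv_sq_integrable.intervalIntegrable

theorem intervalIntegrable_deriv (hf : RH1 f) (a b : ℝ) :
    IntervalIntegrable (deriv f) volume a b := (hf.ac a b).intervalIntegrable_deriv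

theorem sq_sub_le (hf : RH1 f) {u v : ℝ} (huv : u < v) :
    (f v - f u) ^ 2 / (v - u) ≤ ∫ x in u..v, deriv f x ^ 2 := by
  have h0 : v - u ≠ 0 := by linarith
  have hpos : 0 < v - u := by linarith
  -- Cauchy–Schwarz, obtained by expanding the square of the deviation of f' from its mean `m`.
  set m := (f v - f u) / (v - u) with hm
  have h1 : 0 ≤ ∫ x in u..v, (deriv f x - m) ^ 2 :=
    intervalIntegral.integral_nonneg huv.le fun x _ => sq_nonneg _
  have h2 : ∫ x in u..v, (deriv f x - m) ^ 2 =
      (∫ x in u..v, deriv f x ^ 2) - 2 * m * (f v - f u) + m ^ 2 * (v - u) := by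
    have : ∀ x, (deriv f x - m) ^ 2 = deriv f x ^ 2 - 2 * m * deriv f x + m ^ 2 := fun x => by ring
    simp_rw [this]
    rw [intervalIntegral.integral_add, intervalIntegral.integral_sub,
      intervalIntegral.integral_const_mul, hf.integral_deriv]
    · simp [mul_comm]
    · exact hf.intervalIntegrable_deriv_sq u v
    · exact (hf.intervalIntegrable_deriv u v).const_mul _
    · exact (hf.intervalIntegrable_deriv_sq u v).sub ((hf.intervalIntegrable_deriv u v).const_mul _)
    · exact intervalIntegrable_const
  have h3 : (f v - f u) ^ 2 / (v - u) = 2 * m * (f v - f u) - m ^ 2 * (v - u) := by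
    rw [hm]; field_simp; ring
  linarith

end RH1

/-- The Riccati equation of the logarithmic derivative. -/
theorem quotient_hasDerivAt {w w' q : ℝ → ℝ} {x : ℝ} (hw : HasDerivAt w (w' x) x)
    (hw' : HasDerivAt w' (q x * w x) x) (hx : w x ≠ 0) :
    HasDerivAt (fun x => w' x / w x) (q x - (w' x / w x) ^ 2) x := by
  refine (hw'.fun_div hw hx).congr_deriv ?_
  field_simp

/-- A linear second order equation `w'' = q w`. -/
structure IsSol (q w w' : ℝ → ℝ) : Prop where
  cont : Continuous q
  hd : ∀ x, HasDerivAt w (w' x) x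
  hd' : ∀ x, HasDerivAt w' (q x * w x) x

namespace IsSol

variable {q w w' f : ℝ → ℝ} (hs : IsSol q w w')
include hs

theorem continuous : Continuous w := continuous_iff_continuousAt.2 fun x => (hs.hd x).continuousAt

theorem continuous' : Continuous w' :=
  continuous_iff_continuousAt.2 fun x => (hs.hd' x).continuousAt

theorem quotient_ac {a b : ℝ} (hw : ∀ x ∈ uIcc a b, w x ≠ 0) :
    AbsolutelyContinuousOnInterval (fun x => w' x / w x) a b := by
  refine ac_of_hasDerivAt (fun x hx => quotient_hasDerivAt (hs.hd x) (hs.hd' x) (hw x hx)) ?_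
  exact hs.cont.continuousOn.sub ((hs.continuous'.continuousOn.div hs.continuous.continuousOn hw).pow 2)

theorem intervalIntegrable_energy (hf : RH1 f) (a b : ℝ) :
    IntervalIntegrable (fun x => deriv f x ^ 2 + q x * f x ^ 2) volume a b :=
  (hf.intervalIntegrable_deriv_sq a b).add
    ((hs.cont.mul (hf.continuous.pow 2)).intervalIntegrable a b)

theorem intervalIntegrable_square (hf : RH1 f) {a b : ℝ} (hw : ∀ x ∈ uIcc a b, w x ≠ 0) :
    IntervalIntegrable (fun x => (deriv f x - w' x / w x * f x) ^ 2) volume a b := by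
  have hc : ContinuousOn (fun x => w' x / w x * f x) (uIcc a b) :=
    (hs.continuous'.continuousOn.div hs.continuous.continuousOn hw).mul hf.continuous.continuousOn
  have h1 : ∀ x, (deriv f x - w' x / w x * f x) ^ 2 = deriv f x ^ 2 -
      2 * (deriv f x * (w' x / w x * f x)) + (w' x / w x * f x) ^ 2 := fun x => by ring
  simp_rw [h1]
  exact ((hf.intervalIntegrable_deriv_sq a b).sub
    (((hf.intervalIntegrable_deriv a b).mul_continuousOn hc).const_mul 2)).add
    (hc.pow 2).intervalIntegrable

/-- With r = w'/w, the Riccati equation gives (rf²)' = f'² + qf² - (f' - rf)² almost everywhere,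
which is then integrated. -/
theorem jacobi (hf : RH1 f) {a b : ℝ} (hw : ∀ x ∈ uIcc a b, w x ≠ 0) :
    ∫ x in a..b, (deriv f x ^ 2 + q x * f x ^ 2) =
      (∫ x in a..b, (deriv f x - w' x / w x * f x) ^ 2) +
        w' b / w b * f b ^ 2 - w' a / w a * f a ^ 2 := by
  have hac : AbsolutelyContinuousOnInterval (fun x => w' x / w x * (f x * f x)) a b :=
    (hs.quotient_ac hw).fun_mul ((hf.ac a b).fun_mul (hf.ac a b))
  have h1 := hac.integral_deriv_eq_sub
  have h2 : ∫ x in a..b, deriv (fun x => w' x / w x * (f x * f x)) x =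
      ∫ x in a..b, ((deriv f x ^ 2 + q x * f x ^ 2) - (deriv f x - w' x / w x * f x) ^ 2) := by
    apply intervalIntegral.integral_congr_ae
    filter_upwards [hf.ae_differentiableAt] with x hx hxab
    have h3 := (quotient_hasDerivAt (hs.hd x) (hs.hd' x) (hw x (uIoc_subset_uIcc hxab))).fun_mul
      (hx.hasDerivAt.fun_mul hx.hasDerivAt)
    rw [h3.deriv]
    ring
  rw [h2, intervalIntegral.integral_sub (hs.intervalIntegrable_energy hf a b)
    (hs.intervalIntegrable_square hf hw)] at h1
  simp only [← pow_two] at h1 ⊢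
  linarith

/-- A vanishing square means that f/w has zero derivative almost everywhere; f/w is absolutely
continuous, hence constant. -/
theorem eq_mul_of_square_eq_zero (hf : RH1 f) {a b : ℝ} (hab : a ≤ b)
    (hw : ∀ x ∈ uIcc a b, w x ≠ 0)
    (h0 : ∫ x in a..b, (deriv f x - w' x / w x * f x) ^ 2 = 0) :
    ∀ x ∈ Icc a b, f x = f a / w a * w x := by
  have h1 : ∀ᵐ x, x ∈ uIoc a b → deriv f x - w' x / w x * f x = 0 := by
    have := (intervalIntegral.integral_eq_zero_iff_of_le_of_nonneg_ae hab
      (Eventually.of_forall fun x => sq_nonneg _) (hs.intervalIntegrable_square hf hw)).1 h0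
    rw [EventuallyEq, ae_restrict_iff' measurableSet_Ioc] at this
    filter_upwards [this] with x hx hxab
    rw [uIoc_of_le hab] at hxab
    exact pow_eq_zero_iff (two_ne_zero) |>.1 (hx hxab)
  have hinv : AbsolutelyContinuousOnInterval (fun x => (w x)⁻¹) a b := by
    refine ac_of_hasDerivAt (fun x hx => (hs.hd x).fun_inv (hw x hx)) ?_
    exact (hs.continuous'.neg.continuousOn).div (hs.continuous.continuousOn.pow 2)
      fun x hx => pow_ne_zero 2 (hw x hx)
  have hac : AbsolutelyContinuousOnInterval (fun x => f x * (w x)⁻¹) a b := (hf.ac a b).fun_mul hinv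
  intro x hx
  have hsub : uIcc a x ⊆ uIcc a b := by
    rw [uIcc_of_le hab, uIcc_of_le hx.1]; exact Icc_subset_Icc_right hx.2
  have h2 := (hac.mono hsub).integral_deriv_eq_sub
  have h3 : ∫ t in a..x, deriv (fun x => f x * (w x)⁻¹) t = ∫ t in a..x, (0 : ℝ) := by
    apply intervalIntegral.integral_congr_ae
    filter_upwards [h1, hf.ae_differentiableAt] with t ht hd hta
    have hta' : t ∈ uIoc a b := by
      rw [uIoc_of_le hx.1] at hta; rw [uIoc_of_le hab]; exact ⟨hta.1, hta.2.trans hx.2⟩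
    have hwt := hw t (uIoc_subset_uIcc hta')
    have h4 := hd.hasDerivAt.fun_mul ((hs.hd t).fun_inv hwt)
    rw [h4.deriv]
    have := ht hta'
    field_simp at this ⊢
    linarith
  rw [h3, intervalIntegral.integral_zero] at h2
  have hwx : w x ≠ 0 := hw x (by rw [uIcc_of_le hab]; exact hx)
  have hwa : w a ≠ 0 := hw a left_mem_uIcc
  field_simp at h2 ⊢
  linarith

/-- Jacobi's identity is applied on windows avoiding the zeros of `w`, whose ends may approach such
a zero or infinity. If the limit is zero, the nonnegative square has zero integral on every interval
eventually covered. -/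
theorem jacobi_limit (hf : RH1 f) {α β : ℕ → ℝ} {L : ℝ} (hαβ : ∀ n, α n ≤ β n)
    (hw : ∀ n, ∀ x ∈ Icc (α n) (β n), w x ≠ 0)
    (hL : Tendsto (fun n => (∫ x in (α n)..(β n), (deriv f x ^ 2 + q x * f x ^ 2)) -
      w' (β n) / w (β n) * f (β n) ^ 2 + w' (α n) / w (α n) * f (α n) ^ 2) atTop (𝓝 L)) :
    0 ≤ L ∧ (L = 0 → ∀ s t, s ≤ t → (∀ᶠ n in atTop, α n ≤ s ∧ t ≤ β n) →
      ∀ x ∈ Icc s t, f x = f s / w s * w x) := by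
  have hw' : ∀ n, ∀ x ∈ uIcc (α n) (β n), w x ≠ 0 := fun n => by
    rw [uIcc_of_le (hαβ n)]; exact hw n
  have key : ∀ n, (∫ x in (α n)..(β n), (deriv f x ^ 2 + q x * f x ^ 2)) -
      w' (β n) / w (β n) * f (β n) ^ 2 + w' (α n) / w (α n) * f (α n) ^ 2 =
      ∫ x in (α n)..(β n), (deriv f x - w' x / w x * f x) ^ 2 := fun n => by
    rw [hs.jacobi hf (hw' n)]; ring
  simp_rw [key] at hL
  refine ⟨ge_of_tendsto' hL fun n => intervalIntegral.integral_nonneg (hαβ n)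
    fun x _ => sq_nonneg _, fun h0 s t hst hev => ?_⟩
  subst h0
  obtain ⟨n0, hn0⟩ := hev.exists
  have hwst : ∀ x ∈ uIcc s t, w x ≠ 0 := fun x hx => by
    rw [uIcc_of_le hst] at hx
    exact hw n0 x ⟨hn0.1.trans hx.1, hx.2.trans hn0.2⟩
  refine hs.eq_mul_of_square_eq_zero hf hst hwst (le_antisymm ?_ ?_)
  · refine ge_of_tendsto hL ?_
    filter_upwards [hev] with n hn
    exact intervalIntegral.integral_mono_interval hn.1 hst hn.2
      (Eventually.of_forall fun x => sq_nonneg _) (hs.intervalIntegrable_square hf (hw' n))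
  · exact intervalIntegral.integral_nonneg hst fun x _ => sq_nonneg _

/-- The boundary term factors as w' · ((x-a)/w) · (f²/(x-a)). The zero of `w` is simple, so the
first two factors converge, and by Cauchy–Schwarz the last is at most the integral of f'² between a
and x, which tends to 0. -/
theorem tendsto_boundary (hf : RH1 f) {a : ℝ} (hwa : w a = 0) (hwa' : w' a ≠ 0) (hfa : f a = 0) :
    Tendsto (fun x => w' x / w x * f x ^ 2) (𝓝[≠] a) (𝓝 0) := by
  have h1 : Tendsto (fun x => f x ^ 2 / (x - a)) (𝓝[≠] a) (𝓝 0) := by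
    have hc : Tendsto (fun x => |∫ t in a..x, deriv f t ^ 2|) (𝓝[≠] a) (𝓝 0) := by
      have : Continuous fun x => |∫ t in a..x, deriv f t ^ 2| :=
        (intervalIntegral.continuous_primitive (fun a b => hf.intervalIntegrable_deriv_sq a b) a).abs
      have h := this.tendsto a
      simp only [intervalIntegral.integral_same, abs_zero] at h
      exact h.mono_left nhdsWithin_le_nhds
    refine squeeze_zero_norm' ?_ hc
    filter_upwards [self_mem_nhdsWithin] with x hx
    rw [Real.norm_eq_abs]
    rcases lt_or_gt_of_ne (show x ≠ a from hx) with hxa | hxa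
    · have h2 := hf.sq_sub_le hxa
      rw [hfa, zero_sub, neg_sq] at h2
      rw [intervalIntegral.integral_symm, abs_neg]
      rw [← neg_sub, div_neg, abs_neg, abs_of_nonneg (by
        have : 0 < a - x := by linarith
        positivity)]
      exact h2.trans (le_abs_self _)
    · have h2 := hf.sq_sub_le hxa
      rw [hfa, sub_zero] at h2
      rw [abs_of_nonneg (by
        have : 0 < x - a := by linarith
        positivity)]
      exact h2.trans (le_abs_self _)
  have h2 := (hasDerivAt_iff_tendsto_slope.1 (hs.hd a)).inv₀ hwa'
  have h3 : Tendsto w' (𝓝[≠] a) (𝓝 (w' a)) := hs.continuous'.continuousAt.mono_left nhdsWithin_le_nhds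
  have h4 := (h3.mul h2).mul h1
  rw [mul_zero] at h4
  refine h4.congr' ?_
  filter_upwards [self_mem_nhdsWithin] with x hx
  have : x - a ≠ 0 := sub_ne_zero.2 hx
  simp only [slope_def_field, hwa, sub_zero, inv_div]
  by_cases hwx : w x = 0
  · simp [hwx]
  · field_simp

theorem integrableOn_energy (hf : RH1 f) {a K : ℝ} (hK : ∀ x, |q x| ≤ K) :
    IntegrableOn (fun x => deriv f x ^ 2 + q x * f x ^ 2) (Ioi a) := by
  refine (hf.hl a).deriv_sq_integrable.add ?_
  refine Integrable.bdd_mul (c := K) (hf.hl a).sq_integrable hs.cont.aestronglyMeasurable ?_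
  exact Eventually.of_forall hK

omit hs in
theorem tendsto_boundary_atTop (hf : RH1 f) {M : ℝ} (hM : ∀ᶠ x in atTop, |w' x / w x| ≤ M) :
    Tendsto (fun x => w' x / w x * f x ^ 2) atTop (𝓝 0) := by
  have h1 := ((hf.hl 0).tendsto_mul (hf.hl 0)).const_mul M
  rw [mul_zero] at h1
  refine squeeze_zero_norm' ?_ h1
  filter_upwards [hM] with x hx
  rw [norm_mul, Real.norm_eq_abs, Real.norm_eq_abs, abs_sq, ← pow_two]
  gcongr

theorem ray_nonneg (hf : RH1 f) {a K M : ℝ} (hK : ∀ x, |q x| ≤ K)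
    (hM : ∀ᶠ x in atTop, |w' x / w x| ≤ M) (hwa : w a = 0) (hwa' : w' a ≠ 0)
    (hw : ∀ x, a < x → w x ≠ 0) (hfa : f a = 0) :
    0 ≤ ∫ x in Ioi a, (deriv f x ^ 2 + q x * f x ^ 2) ∧
    (∫ x in Ioi a, (deriv f x ^ 2 + q x * f x ^ 2) = 0 →
      ∀ x, a < x → f x = f (a + 1) / w (a + 1) * w x) := by
  have hα : Tendsto (fun n : ℕ => a + 1 / ((n : ℝ) + 1)) atTop (𝓝 a) := by
    simpa using (tendsto_one_div_add_atTop_nhds_zero_nat (𝕜 := ℝ)).const_add a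
  have hαp : ∀ n : ℕ, 0 < 1 / ((n : ℝ) + 1) := fun n => by positivity
  have hαp1 : ∀ n : ℕ, 1 / ((n : ℝ) + 1) ≤ 1 := fun n => by
    rw [div_le_one (by positivity)]; linarith [n.cast_nonneg (α := ℝ)]
  have hα' : Tendsto (fun n : ℕ => a + 1 / ((n : ℝ) + 1)) atTop (𝓝[≠] a) :=
    tendsto_nhdsWithin_iff.2 ⟨hα, Eventually.of_forall fun n => by
      have := hαp n; simp only [mem_compl_iff, mem_singleton_iff]; linarith⟩
  have hβ : Tendsto (fun n : ℕ => a + 1 + (n : ℝ)) atTop atTop :=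
    tendsto_atTop_add_const_left _ _ tendsto_natCast_atTop_atTop
  have hE := hs.integrableOn_energy hf (a := a) hK
  have hI : Tendsto (fun n : ℕ => ∫ x in (a + 1 / ((n : ℝ) + 1))..(a + 1 + (n : ℝ)),
      (deriv f x ^ 2 + q x * f x ^ 2)) atTop
      (𝓝 (∫ x in Ioi a, (deriv f x ^ 2 + q x * f x ^ 2))) := by
    have h1 := intervalIntegral_tendsto_integral_Ioi a hE hβ
    have h2 := ((intervalIntegral.continuous_primitive
      (fun u v => hs.intervalIntegrable_energy hf u v) a).tendsto a).comp hα
    simp only [intervalIntegral.integral_same] at h2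
    have h3 := h1.sub h2
    rw [sub_zero] at h3
    refine h3.congr fun n => ?_
    exact intervalIntegral.integral_interval_sub_left
      (hs.intervalIntegrable_energy hf _ _) (hs.intervalIntegrable_energy hf _ _)
  -- Neither end leaves a boundary term: at infinity w'/w is bounded and f² tends to 0, and at the
  -- zero `a` both `w` and `f` vanish.
  have hlim := (hI.sub ((tendsto_boundary_atTop hf hM).comp hβ)).add
    ((hs.tendsto_boundary hf hwa hwa' hfa).comp hα')
  rw [sub_zero, add_zero] at hlim
  have := hs.jacobi_limit hf (fun n => by have := hαp1 n; have := n.cast_nonneg (α := ℝ); linarith)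
    (fun n x hx => hw x (by have := hαp n; linarith [hx.1])) hlim
  refine ⟨this.1, fun h0 x hx => ?_⟩
  have hev : ∀ᶠ n : ℕ in atTop, a + 1 / ((n : ℝ) + 1) ≤ min x (a + 1) ∧ max x (a + 1) ≤ a + 1 + n := by
    have hmin : a < min x (a + 1) := lt_min hx (by linarith)
    filter_upwards [hα.eventually (gt_mem_nhds hmin), hβ.eventually_ge_atTop (max x (a + 1))]
      with n h1 h2 using ⟨h1.le, h2⟩
  have h3 := this.2 h0 _ _ (min_le_max) hev
  have hs' := hw (min x (a + 1)) (lt_min hx (by linarith))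
  have h4 := h3 x ⟨min_le_left _ _, le_max_left _ _⟩
  have h5 := h3 (a + 1) ⟨min_le_right _ _, le_max_right _ _⟩
  rw [h4, h5]
  have := hw (a + 1) (by linarith)
  field_simp

theorem segment_nonneg (hf : RH1 f) {b : ℝ} (hb : 0 < b) (hwb : w b = 0) (hwb' : w' b ≠ 0)
    (hw : ∀ x, 0 ≤ x → x < b → w x ≠ 0) (hfb : f b = 0) :
    0 ≤ (∫ x in (0 : ℝ)..b, (deriv f x ^ 2 + q x * f x ^ 2)) + w' 0 / w 0 * f 0 ^ 2 ∧
    ((∫ x in (0 : ℝ)..b, (deriv f x ^ 2 + q x * f x ^ 2)) + w' 0 / w 0 * f 0 ^ 2 = 0 →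
      ∀ x, 0 ≤ x → x < b → f x = f 0 / w 0 * w x) := by
  have hβ : Tendsto (fun n : ℕ => b - b * (1 / ((n : ℝ) + 1))) atTop (𝓝 b) := by
    simpa using ((tendsto_one_div_add_atTop_nhds_zero_nat (𝕜 := ℝ)).const_mul b).const_sub b
  have hβp : ∀ n : ℕ, 0 < b * (1 / ((n : ℝ) + 1)) := fun n => by positivity
  have hβ0 : ∀ n : ℕ, 0 ≤ b - b * (1 / ((n : ℝ) + 1)) := fun n => by
    have : 1 / ((n : ℝ) + 1) ≤ 1 := by
      rw [div_le_one (by positivity)]; linarith [n.cast_nonneg (α := ℝ)]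
    nlinarith
  have hβ' : Tendsto (fun n : ℕ => b - b * (1 / ((n : ℝ) + 1))) atTop (𝓝[≠] b) :=
    tendsto_nhdsWithin_iff.2 ⟨hβ, Eventually.of_forall fun n => by
      have := hβp n; simp only [mem_compl_iff, mem_singleton_iff]; linarith⟩
  have hI := ((intervalIntegral.continuous_primitive
      (fun u v => hs.intervalIntegrable_energy hf u v) 0).tendsto b).comp hβ
  have hlim := (hI.sub ((hs.tendsto_boundary hf hwb hwb' hfb).comp hβ')).add_const
    (w' 0 / w 0 * f 0 ^ 2)
  rw [sub_zero] at hlim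
  have := hs.jacobi_limit hf (α := fun _ => 0) hβ0
    (fun n x hx => hw x hx.1 (by have := hβp n; linarith [hx.2])) hlim
  refine ⟨this.1, fun h0 x hx hxb => ?_⟩
  have hev : ∀ᶠ n : ℕ in atTop, (0 : ℝ) ≤ 0 ∧ x ≤ b - b * (1 / ((n : ℝ) + 1)) := by
    filter_upwards [hβ.eventually (lt_mem_nhds hxb)] with n h1 using ⟨le_rfl, h1.le⟩
  exact this.2 h0 0 x hx hev x ⟨hx, le_rfl⟩

theorem ray_regular (hf : RH1 f) {K M : ℝ} (hK : ∀ x, |q x| ≤ K)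
    (hM : ∀ᶠ x in atTop, |w' x / w x| ≤ M) (hw : ∀ x, w x ≠ 0) :
    0 ≤ (∫ x in Ioi 0, (deriv f x ^ 2 + q x * f x ^ 2)) + w' 0 / w 0 * f 0 ^ 2 ∧
    ((∫ x in Ioi 0, (deriv f x ^ 2 + q x * f x ^ 2)) + w' 0 / w 0 * f 0 ^ 2 = 0 →
      ∀ x, 0 ≤ x → f x = f 0 / w 0 * w x) := by
  have hβ : Tendsto (fun n : ℕ => (n : ℝ)) atTop atTop := tendsto_natCast_atTop_atTop
  have hI := intervalIntegral_tendsto_integral_Ioi 0 (hs.integrableOn_energy hf (a := 0) hK) hβ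
  have hlim := (hI.sub ((tendsto_boundary_atTop hf hM).comp hβ)).add_const
    (w' 0 / w 0 * f 0 ^ 2)
  rw [sub_zero] at hlim
  have := hs.jacobi_limit hf (α := fun _ => 0) (fun n => n.cast_nonneg) (fun n x _ => hw x) hlim
  refine ⟨this.1, fun h0 x hx => ?_⟩
  have hev : ∀ᶠ n : ℕ in atTop, (0 : ℝ) ≤ 0 ∧ x ≤ (n : ℝ) := by
    filter_upwards [hβ.eventually_ge_atTop x] with n h1 using ⟨le_rfl, h1⟩
  exact this.2 h0 0 x hx hev x ⟨hx, le_rfl⟩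

end IsSol

end DeltaNLS
end

open MeasureTheory Filter Topology ComplexConjugate
noncomputable section
namespace DeltaNLS
open Set

/-! ### The quadratic forms -/

/-- The common form of `Bplus` (`c = p`) and `Bminus` (`c = 1`). -/
def bform (p ω γ c : ℝ) (f g : ℝ → ℝ) : ℝ :=
  (∫ x, deriv f x * deriv g x) + ω * (∫ x, f x * g x) - γ * f 0 * g 0 -
    ∫ x, c * Q p ω γ x ^ (p - 1) * f x * g x

theorem Bplus_eq (p ω γ : ℝ) (f g : ℝ → ℝ) : Bplus p ω γ f g = bform p ω γ p f g := rfl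

theorem Bminus_eq (p ω γ : ℝ) (f g : ℝ → ℝ) : Bminus p ω γ f g = bform p ω γ 1 f g := by
  simp [Bminus, bform]

/-- The contribution of the right half-line to `bform`. -/
def halfForm (p ω γ c : ℝ) (f g : ℝ → ℝ) : ℝ :=
  (∫ x in Ioi 0, (deriv f x * deriv g x + (ω - c * pot p ω γ x) * (f x * g x))) -
    γ / 2 * (f 0 * g 0)

theorem integral_eq_half_add_half {F : ℝ → ℝ} (hF : Integrable F) :
    ∫ x, F x = (∫ x in Ioi 0, F x) + ∫ x in Ioi 0, F (-x) := by
  rw [integral_comp_neg_Ioi, neg_zero, add_comm, ← setIntegral_union (Iic_disjoint_Ioi le_rfl) measurableSet_Ioi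
    hF.integrableOn hF.integrableOn, Iic_union_Ioi, setIntegral_univ]

namespace Params

variable {p ω γ : ℝ} (h : Params p ω γ)
include h

theorem integrable_pot_mul {F : ℝ → ℝ} (hF : Integrable F) :
    Integrable fun x => pot p ω γ |x| * F x := by
  refine hF.bdd_mul (c := (p + 1) * ω / 2) (continuous_pot.comp continuous_abs).aestronglyMeasurable ?_
  exact Eventually.of_forall fun x => by
    rw [Real.norm_eq_abs, abs_of_pos (h.pot_pos _)]; exact h.pot_le _

theorem bform_eq_integral (c : ℝ) {f g : ℝ → ℝ} (hf : RH1 f) (hg : RH1 g) :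
    bform p ω γ c f g =
      (∫ x, (deriv f x * deriv g x + (ω - c * pot p ω γ |x|) * (f x * g x))) - γ * f 0 * g 0 := by
  have hi : Integrable fun x => f x * g x := hf.memLp.integrable_mul hg.memLp
  have hi' : Integrable fun x => deriv f x * deriv g x :=
    hf.memLp_deriv.integrable_mul hg.memLp_deriv
  have h1 : ∫ x, (deriv f x * deriv g x + (ω - c * pot p ω γ |x|) * (f x * g x)) =
      ∫ x, (deriv f x * deriv g x + ω * (f x * g x) - c * (pot p ω γ |x| * (f x * g x))) := by
    congr 1; funext x; ring
  have h2 : ∫ x, c * Q p ω γ x ^ (p - 1) * f x * g x =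
      ∫ x, c * (pot p ω γ |x| * (f x * g x)) := by
    congr 1; funext x; rw [h.Q_rpow]; ring
  rw [h1, integral_sub, integral_add hi', integral_const_mul, bform, h2]
  · ring
  · exact hi.const_mul _
  · exact hi'.add (hi.const_mul _)
  · exact (h.integrable_pot_mul hi).const_mul _

theorem bform_eq_half (c : ℝ) {f g : ℝ → ℝ} (hf : RH1 f) (hg : RH1 g) :
    bform p ω γ c f g = halfForm p ω γ c f g +
      halfForm p ω γ c (fun x => f (-x)) (fun x => g (-x)) := by
  have hi : Integrable fun x => f x * g x := hf.memLp.integrable_mul hg.memLp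
  have hi' : Integrable fun x => deriv f x * deriv g x :=
    hf.memLp_deriv.integrable_mul hg.memLp_deriv
  have hI : Integrable fun x =>
      deriv f x * deriv g x + (ω - c * pot p ω γ |x|) * (f x * g x) := by
    have h1 : (fun x => deriv f x * deriv g x + (ω - c * pot p ω γ |x|) * (f x * g x)) =
        fun x => deriv f x * deriv g x + ω * (f x * g x) - c * (pot p ω γ |x| * (f x * g x)) := by
      funext x; ring
    rw [h1]
    exact (hi'.add (hi.const_mul _)).sub ((h.integrable_pot_mul hi).const_mul _)
  rw [h.bform_eq_integral c hf hg, integral_eq_half_add_half hI, halfForm, halfForm]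
  have e1 : ∫ x in Ioi 0, (deriv f x * deriv g x + (ω - c * pot p ω γ |x|) * (f x * g x)) =
      ∫ x in Ioi 0, (deriv f x * deriv g x + (ω - c * pot p ω γ x) * (f x * g x)) := by
    refine setIntegral_congr_fun measurableSet_Ioi fun x hx => ?_
    simp only [abs_of_pos (show (0:ℝ) < x from hx)]
  have e2 : ∫ x in Ioi 0, (deriv f (-x) * deriv g (-x) +
        (ω - c * pot p ω γ |(-x)|) * (f (-x) * g (-x))) =
      ∫ x in Ioi 0, (deriv (fun x => f (-x)) x * deriv (fun x => g (-x)) x +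
        (ω - c * pot p ω γ x) * (f (-x) * g (-x))) := by
    refine setIntegral_congr_fun measurableSet_Ioi fun x hx => ?_
    simp only [RH1.deriv_neg_arg, abs_neg, abs_of_pos (show (0:ℝ) < x from hx), neg_mul_neg]
  rw [e1, e2, neg_zero]
  ring

theorem abs_q_le (c x : ℝ) : |ω - c * pot p ω γ x| ≤ ω + |c| * ((p + 1) * ω / 2) := by
  refine (abs_sub _ _).trans ?_
  rw [abs_of_pos h.ω_pos, abs_mul, abs_of_pos (h.pot_pos x)]
  have := h.pot_le x
  gcongr

omit h in
theorem halfForm_self (c : ℝ) (f : ℝ → ℝ) : halfForm p ω γ c f f =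
    (∫ x in Ioi 0, (deriv f x ^ 2 + (ω - c * pot p ω γ x) * f x ^ 2)) - γ / 2 * f 0 ^ 2 := by
  simp [halfForm, pow_two]

/-! ### Positivity of the half-line forms -/

theorem isSol_sol : IsSol (fun x => ω - 1 * pot p ω γ x) (sol p ω γ) (sol' p ω γ) where
  cont := continuous_const.sub (continuous_const.mul continuous_pot)
  hd := h.hasDerivAt_sol
  hd' x := (h.hasDerivAt_sol' x).congr_deriv (by rw [sol'', one_mul])

theorem isSol_sol' : IsSol (fun x => ω - p * pot p ω γ x) (sol' p ω γ) (sol'' p ω γ) where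
  cont := continuous_const.sub (continuous_const.mul continuous_pot)
  hd := h.hasDerivAt_sol'
  hd' := h.hasDerivAt_sol''

/-- The comparison solution `sol` is positive, and its logarithmic derivative at 0 is -γ/2, so the
point interaction cancels the boundary term and only a square is left. -/
theorem halfForm_one_nonneg {f : ℝ → ℝ} (hf : RH1 f) : 0 ≤ halfForm p ω γ 1 f f ∧
    (halfForm p ω γ 1 f f = 0 → ∀ x, 0 ≤ x → f x = f 0 / sol p ω γ 0 * sol p ω γ x) := by
  have hM : ∀ x, |sol' p ω γ x / sol p ω γ x| ≤ Real.sqrt ω := fun x => by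
    rw [abs_div, abs_of_pos (h.sol_pos x), div_le_iff₀ (h.sol_pos x)]
    exact h.abs_sol'_le x
  have := h.isSol_sol.ray_regular hf (h.abs_q_le 1) (Eventually.of_forall hM)
    fun x => (h.sol_pos x).ne'
  rw [h.sol'_zero, mul_div_cancel_right₀ _ (h.sol_pos 0).ne'] at this
  rw [halfForm_self]
  have e : ∀ I : ℝ, I - γ / 2 * f 0 ^ 2 = I + -(γ / 2) * f 0 ^ 2 := fun I => by ring
  rw [e]
  exact this

/-- One unit past the peak the hyperbolic tangent is bounded below by a positive number, so there
|`sol'`| dominates a multiple of `sol`, while |`sol''`| is always dominated by one. -/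
theorem abs_quotient_le : ∃ M, ∀ᶠ x in atTop, |sol'' p ω γ x / sol' p ω γ x| ≤ M := by
  set x1 := peak p ω γ + 1
  have hr := h.sqrt_pos
  have h1 : 0 < phase p ω γ x1 := by
    rw [h.phase_eq]; have := h.κ_pos; simp only [x1, add_sub_cancel_left, mul_one]; exact this
  have ht : 0 < Real.tanh (phase p ω γ x1) := by
    rw [Real.tanh_eq_sinh_div_cosh]
    exact div_pos (Real.sinh_pos_iff.2 h1) (Real.cosh_pos _)
  refine ⟨p * ω / (Real.sqrt ω * Real.tanh (phase p ω γ x1)), ?_⟩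
  filter_upwards [eventually_ge_atTop x1] with x hx
  have hmono : Real.tanh (phase p ω γ x1) ≤ Real.tanh (phase p ω γ x) := by
    refine monotone_of_hasDerivAt_nonneg (fun x => hasDerivAt_tanh_phase x) (fun x => ?_) hx
    have := h.κ_pos
    positivity
  have hs := h.sol_pos x
  have hp := h.hp
  have hω := h.ω_pos
  have h2 : |sol' p ω γ x| = Real.sqrt ω * Real.tanh (phase p ω γ x) * sol p ω γ x := by
    rw [sol', abs_mul, abs_neg, abs_of_pos hs, abs_of_pos]
    exact mul_pos hr (ht.trans_le hmono)
  have h3 : 0 < Real.tanh (phase p ω γ x) := ht.trans_le hmono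
  rw [abs_div, h2, div_le_div_iff₀ (by positivity) (by positivity)]
  calc |sol'' p ω γ x| * (Real.sqrt ω * Real.tanh (phase p ω γ x1))
      ≤ (p * ω * sol p ω γ x) * (Real.sqrt ω * Real.tanh (phase p ω γ x)) := by
        have := h.abs_sol''_le x
        gcongr
    _ = _ := by ring

/-- Jacobi's identity with w = `sol'` is used on each side of its only zero. The boundary value at
the origin has a strict sign, so equality forces f(0) = 0 and then f = 0 up to the peak, while
beyond it f is a multiple of `sol'`. -/
theorem halfForm_p_nonneg {f : ℝ → ℝ} (hf : RH1 f) (hfx : f (peak p ω γ) = 0) :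
    0 ≤ halfForm p ω γ p f f ∧
    (halfForm p ω γ p f f = 0 → ∃ c, ∀ x, 0 ≤ x → f x = c * sol' p ω γ (max x (peak p ω γ))) := by
  obtain ⟨M, hM⟩ := h.abs_quotient_le
  have hpk := h.peak_pos
  have hs := h.isSol_sol'
  obtain ⟨r1, r2⟩ := hs.ray_nonneg hf (h.abs_q_le p) hM h.sol'_peak h.sol''_peak_neg.ne
    (fun x hx => h.sol'_ne_zero hx.ne') hfx
  obtain ⟨s1, s2⟩ := hs.segment_nonneg hf hpk h.sol'_peak h.sol''_peak_neg.ne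
    (fun x _ hx => h.sol'_ne_zero hx.ne) hfx
  -- After inserting the values at 0, this reads ω - (p+1)/2 · (ω - γ²/4) < γ²/4, which holds since
  -- p > 1 and ω > γ²/4.
  have hr0 : sol'' p ω γ 0 / sol' p ω γ 0 < -(γ / 2) := by
    have h1 := h.sol_pos 0
    have hγ := h.hγ
    have hp := h.hp
    have hω := h.hω
    rw [h.sol'_zero, sol'', mul_div_mul_right _ _ h1.ne', h.pot_zero, div_lt_iff₀ (by linarith)]
    nlinarith
  have hsplit : ∫ x in Ioi 0, (deriv f x ^ 2 + (ω - p * pot p ω γ x) * f x ^ 2) =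
      (∫ x in (0 : ℝ)..peak p ω γ, (deriv f x ^ 2 + (ω - p * pot p ω γ x) * f x ^ 2)) +
      ∫ x in Ioi (peak p ω γ), (deriv f x ^ 2 + (ω - p * pot p ω γ x) * f x ^ 2) := by
    have hi := hs.integrableOn_energy hf (a := 0) (h.abs_q_le p)
    rw [intervalIntegral.integral_of_le hpk.le, ← Ioc_union_Ioi_eq_Ioi hpk.le,
      setIntegral_union Ioc_disjoint_Ioi_same
        measurableSet_Ioi]
    · exact hi.mono_set Ioc_subset_Ioi_self
    · exact hi.mono_set (Ioi_subset_Ioi hpk.le)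
  rw [halfForm_self, hsplit]
  have h3 : 0 ≤ (-(γ / 2) - sol'' p ω γ 0 / sol' p ω γ 0) * f 0 ^ 2 :=
    mul_nonneg (by linarith) (sq_nonneg _)
  refine ⟨by linarith, fun h0 => ?_⟩
  have hf0 : f 0 = 0 := by
    have : (-(γ / 2) - sol'' p ω γ 0 / sol' p ω γ 0) * f 0 ^ 2 = 0 := by linarith
    rcases mul_eq_zero.1 this with h4 | h4
    · linarith
    · exact pow_eq_zero_iff two_ne_zero |>.1 h4
  refine ⟨f (peak p ω γ + 1) / sol' p ω γ (peak p ω γ + 1), fun x hx => ?_⟩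
  rcases le_or_gt x (peak p ω γ) with hxp | hxp
  · rw [max_eq_right hxp, h.sol'_peak, mul_zero]
    rcases hxp.lt_or_eq with hlt | heq
    · rw [s2 (by linarith) x hx hlt, hf0]; simp
    · rw [heq, hfx]
  · rw [max_eq_left hxp.le]
    exact r2 (by linarith) x hxp

/-- Integration by parts for the form on `(a, ∞)` against a smooth profile. -/
theorem integral_profile {w w1 w2 g : ℝ → ℝ} {a : ℝ} (c : ℝ) (hd1 : ∀ x, HasDerivAt w1 (w2 x) x) (hc2 : Continuous w2)
    (hw : MemLp w 2 (volume.restrict (Ioi a)))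
    (hw1 : MemLp w1 2 (volume.restrict (Ioi a))) (hw2 : MemLp w2 2 (volume.restrict (Ioi a)))
    (hg : RH1 g) :
    ∫ x in Ioi a, (w1 x * deriv g x + (ω - c * pot p ω γ x) * (w x * g x)) =
      (∫ x in Ioi a, (-w2 x + (ω - c * pot p ω γ x) * w x) * g x) - w1 a * g a := by
  have hder : deriv w1 = w2 := funext fun x => (hd1 x).deriv
  have hHL : HL a w1 := ⟨hw1, by rwa [hder], fun b _ =>
    ac_of_hasDerivAt (fun x _ => hd1 x) hc2.continuousOn⟩
  have hgl := hg.hl a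
  have h1 := hHL.integral_by_parts hgl
  rw [hder] at h1
  have hqw : IntegrableOn (fun x => (ω - c * pot p ω γ x) * (w x * g x)) (Ioi a) := by
    refine Integrable.bdd_mul (c := ω + |c| * ((p + 1) * ω / 2)) (hw.integrable_mul hgl.memLp)
      (continuous_const.sub (continuous_const.mul continuous_pot)).aestronglyMeasurable ?_
    exact Eventually.of_forall (h.abs_q_le c)
  have hw2g : IntegrableOn (fun x => w2 x * g x) (Ioi a) := hw2.integrable_mul hgl.memLp
  have hw1g : IntegrableOn (fun x => w1 x * deriv g x) (Ioi a) :=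
    hw1.integrable_mul hgl.memLp_deriv
  have h2 : ∫ x in Ioi a, (-w2 x + (ω - c * pot p ω γ x) * w x) * g x =
      ∫ x in Ioi a, (-(w2 x * g x) + (ω - c * pot p ω γ x) * (w x * g x)) := by
    congr 1; funext x; ring
  rw [integral_add hw1g hqw, h2, integral_add (f := fun x => -(w2 x * g x)) hw2g.neg hqw, integral_neg]
  linarith

theorem memLp_sol {a : ℝ} (ha : 0 ≤ a) : MemLp (sol p ω γ) 2 (volume.restrict (Ioi a)) :=
  h.memLp_of_abs_le_sol (C := 1) h.continuous_sol ha fun x hx => by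
    have := h.sol_pos x
    rw [abs_of_pos this]; nlinarith

theorem memLp_sol' {a : ℝ} (ha : 0 ≤ a) : MemLp (sol' p ω γ) 2 (volume.restrict (Ioi a)) :=
  h.memLp_of_abs_le_sol (C := Real.sqrt ω) h.continuous_sol' ha fun x hx => by
    have h1 := h.sol_pos x
    have h2 := h.abs_sol'_le x
    have h3 : 0 ≤ Real.sqrt ω * x * sol p ω γ x := by positivity
    nlinarith

theorem memLp_sol'' {a : ℝ} (ha : 0 ≤ a) : MemLp (sol'' p ω γ) 2 (volume.restrict (Ioi a)) :=
  h.memLp_of_abs_le_sol (C := p * ω) h.continuous_sol'' ha fun x hx => by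
    have h1 := h.sol_pos x
    have h2 := h.abs_sol''_le x
    have := h.hp
    have := h.ω_pos
    have h3 : 0 ≤ p * ω * x * sol p ω γ x := by positivity
    nlinarith

theorem halfForm_even {w w1 w2 g : ℝ → ℝ} (c : ℝ)
    (hd : ∀ x, HasDerivAt w (w1 x) x) (hd1 : ∀ x, HasDerivAt w1 (w2 x) x) (hc2 : Continuous w2)
    (hw : MemLp w 2 (volume.restrict (Ioi 0)))
    (hw1 : MemLp w1 2 (volume.restrict (Ioi 0))) (hw2 : MemLp w2 2 (volume.restrict (Ioi 0)))
    (hg : RH1 g) :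
    halfForm p ω γ c (fun x => w |x|) g =
      (∫ x in Ioi 0, (-w2 x + (ω - c * pot p ω γ x) * w x) * g x) -
        (w1 0 + γ / 2 * w 0) * g 0 := by
  rw [halfForm]
  have : ∫ x in Ioi 0, (deriv (fun x => w |x|) x * deriv g x +
      (ω - c * pot p ω γ x) * (w |x| * g x)) =
      ∫ x in Ioi 0, (w1 x * deriv g x + (ω - c * pot p ω γ x) * (w x * g x)) := by
    refine setIntegral_congr_fun measurableSet_Ioi fun x hx => ?_
    rw [deriv_comp_abs hd hx, abs_of_pos hx]
  rw [this, h.integral_profile c hd1 hc2 hw hw1 hw2 hg, abs_zero]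
  ring

/-- Beyond the peak `f` is a solution and before it `f` is zero, so integration by parts leaves only
the contribution of the kink. As this is nonzero for suitable `g`, such null functions of the form
are not in its kernel. -/
theorem halfForm_truncated {f g : ℝ → ℝ} {c : ℝ}
    (hfc : ∀ x, 0 ≤ x → f x = c * sol' p ω γ (max x (peak p ω γ))) (hf : RH1 f) (hg : RH1 g) :
    halfForm p ω γ p f g = -c * sol'' p ω γ (peak p ω γ) * g (peak p ω γ) := by
  have hpk := h.peak_pos
  have hf0 : f 0 = 0 := by rw [hfc 0 le_rfl, max_eq_right hpk.le, h.sol'_peak, mul_zero]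
  have hi : IntegrableOn (fun x => deriv f x * deriv g x + (ω - p * pot p ω γ x) * (f x * g x))
      (Ioi 0) := by
    refine ((hf.hl 0).memLp_deriv.integrable_mul (hg.hl 0).memLp_deriv).add ?_
    refine Integrable.bdd_mul (c := ω + |p| * ((p + 1) * ω / 2)) ((hf.hl 0).mul_integrable (hg.hl 0))
      (continuous_const.sub (continuous_const.mul continuous_pot)).aestronglyMeasurable ?_
    exact Eventually.of_forall (h.abs_q_le p)
  rw [halfForm, hf0, ← Ioc_union_Ioi_eq_Ioi hpk.le, setIntegral_union
    Ioc_disjoint_Ioi_same measurableSet_Ioi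
    (hi.mono_set Ioc_subset_Ioi_self) (hi.mono_set (Ioi_subset_Ioi hpk.le))]
  have e1 : ∫ x in Ioc 0 (peak p ω γ),
      (deriv f x * deriv g x + (ω - p * pot p ω γ x) * (f x * g x)) = 0 := by
    rw [integral_Ioc_eq_integral_Ioo, setIntegral_congr_fun (g := fun _ => (0 : ℝ)) measurableSet_Ioo]
    · simp
    · intro x hx
      have hfx : f x = 0 := by rw [hfc x hx.1.le, max_eq_right hx.2.le, h.sol'_peak, mul_zero]
      have hdf : deriv f x = 0 := by
        have : f =ᶠ[𝓝 x] fun _ => (0 : ℝ) := by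
          filter_upwards [Ioo_mem_nhds hx.1 hx.2] with y hy
          rw [hfc y hy.1.le, max_eq_right hy.2.le, h.sol'_peak, mul_zero]
        rw [this.deriv_eq, deriv_const]
      simp [hfx, hdf]
  have e2 : ∫ x in Ioi (peak p ω γ),
      (deriv f x * deriv g x + (ω - p * pot p ω γ x) * (f x * g x)) =
      ∫ x in Ioi (peak p ω γ), c * (sol'' p ω γ x * deriv g x +
        (ω - p * pot p ω γ x) * (sol' p ω γ x * g x)) := by
    refine setIntegral_congr_fun measurableSet_Ioi fun x hx => ?_
    have hx : peak p ω γ < x := hx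
    have hfx : f x = c * sol' p ω γ x := by rw [hfc x (hpk.le.trans hx.le), max_eq_left hx.le]
    have hdf : deriv f x = c * sol'' p ω γ x := by
      have : f =ᶠ[𝓝 x] fun y => c * sol' p ω γ y := by
        filter_upwards [lt_mem_nhds hx] with y hy
        rw [hfc y (hpk.le.trans (le_of_lt hy)), max_eq_left (le_of_lt hy)]
      rw [this.deriv_eq, ((h.hasDerivAt_sol' x).const_mul c).deriv]
    simp only [hfx, hdf]
    ring
  have h0 : ∫ x in Ioi (peak p ω γ), (-((ω - p * pot p ω γ x) * sol' p ω γ x) +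
      (ω - p * pot p ω γ x) * sol' p ω γ x) * g x = 0 := by simp
  have hlp : MemLp (fun x => (ω - p * pot p ω γ x) * sol' p ω γ x) 2
      (volume.restrict (Ioi (peak p ω γ))) := by
    refine (h.memLp_sol' hpk.le).of_le_mul (c := ω + |p| * ((p + 1) * ω / 2)) ?_ ?_
    · exact ((continuous_const.sub (continuous_const.mul continuous_pot)).mul
        h.continuous_sol').aestronglyMeasurable
    · exact Eventually.of_forall fun x => by
        rw [norm_mul]; exact mul_le_mul_of_nonneg_right (h.abs_q_le p x) (norm_nonneg _)
  rw [e1, e2, integral_const_mul, h.integral_profile p h.hasDerivAt_sol''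
    ((continuous_const.sub (continuous_const.mul continuous_pot)).mul h.continuous_sol')
    (h.memLp_sol' hpk.le) (h.memLp_sol'' hpk.le) hlp hg, h0]
  ring

end Params
end DeltaNLS
end

open MeasureTheory Filter Topology ComplexConjugate
noncomputable section
namespace DeltaNLS
open Set

/-! ### Quadratic forms on Hilbert spaces -/

section Hilbert

variable {X : Type*} [NormedAddCommGroup X] [InnerProductSpace ℝ X] [CompleteSpace X]

/-- Sequential Banach–Alaoglu in the dual of a separable space, transported to `X` by the Riesz
isomorphism. -/
theorem exists_weak_limit [TopologicalSpace.SeparableSpace X] (u : ℕ → X) {R : ℝ}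
    (hu : ∀ n, ‖u n‖ ≤ R) : ∃ x : X, ∃ φ : ℕ → ℕ, StrictMono φ ∧
      ∀ ψ : X →L[ℝ] ℝ, Tendsto (fun n => ψ (u (φ n))) atTop (𝓝 (ψ x)) := by
  have hc := WeakDual.isSeqCompact_closedBall ℝ X (0 : StrongDual ℝ X) R
  have hmem : ∀ n, StrongDual.toWeakDual (InnerProductSpace.toDual ℝ X (u n)) ∈
      WeakDual.toStrongDual ⁻¹' Metric.closedBall (0 : StrongDual ℝ X) R := fun n => by
    simpa using hu n
  obtain ⟨a, -, φ, hφ, hlim⟩ := hc hmem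
  refine ⟨(InnerProductSpace.toDual ℝ X).symm (WeakDual.toStrongDual a), φ, hφ, fun ψ => ?_⟩
  have h1 := (WeakDual.eval_continuous ((InnerProductSpace.toDual ℝ X).symm ψ)).tendsto a |>.comp hlim
  have h2 : ∀ y : X, ψ y = inner ℝ ((InnerProductSpace.toDual ℝ X).symm ψ) y := fun y => by simp
  have h3 : ψ ((InnerProductSpace.toDual ℝ X).symm (WeakDual.toStrongDual a)) =
      a ((InnerProductSpace.toDual ℝ X).symm ψ) := by
    rw [h2, real_inner_comm, InnerProductSpace.toDual_symm_apply]
    rfl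
  rw [h3]
  refine h1.congr fun n => ?_
  rw [h2, real_inner_comm]
  rfl

/-- Weak sequential continuity of a function along bounded sequences. -/
def WeakSeqCont (k : X → ℝ) : Prop :=
  ∀ (u : ℕ → X) (x : X) (R : ℝ), (∀ n, ‖u n‖ ≤ R) →
    (∀ ψ : X →L[ℝ] ℝ, Tendsto (fun n => ψ (u n)) atTop (𝓝 (ψ x))) →
    Tendsto (fun n => k (u n)) atTop (𝓝 (k x))

/-- Otherwise c = 1/(n+1) fails for every n, giving unit vectors with a weak limit x. The penalty
forces ψ_j(x) = 0, lower semicontinuity of `d` then gives d(x,x) ≤ k(x), so x = 0; but then `k`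
tends to 0 along the sequence, against d ≥ c₀ on unit vectors. -/
theorem coercive_of_pos [TopologicalSpace.SeparableSpace X] {ι : Type*} [Fintype ι]
    (d : X →L[ℝ] X →L[ℝ] ℝ) (hsymm : ∀ u v, d u v = d v u) {c₀ : ℝ} (hc₀ : 0 < c₀)
    (hd : ∀ u, c₀ * ‖u‖ ^ 2 ≤ d u u) (k : X → ℝ) (hk : WeakSeqCont k)
    (hk2 : ∀ (a : ℝ) u, k (a • u) = a ^ 2 * k u) (ψ : ι → X →L[ℝ] ℝ)
    (hpos : ∀ u, u ≠ 0 → (∀ j, ψ j u = 0) → k u < d u u) :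
    ∃ c : ℝ, 0 < c ∧ ∀ u, c * ‖u‖ ^ 2 ≤ d u u - k u + c⁻¹ * ∑ j, ψ j u ^ 2 := by
  by_contra hcon
  push Not at hcon
  have hcn : ∀ n : ℕ, ∃ v : X, ‖v‖ = 1 ∧
      d v v - k v + ((n : ℝ) + 1) * ∑ j, ψ j v ^ 2 < 1 / ((n : ℝ) + 1) := by
    intro n
    obtain ⟨u, hu⟩ := hcon (1 / ((n : ℝ) + 1)) (by positivity)
    have hu0 : u ≠ 0 := by
      rintro rfl
      have := hk2 0 (0 : X)
      simp at this hu
      simp [this] at hu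
    have hn : 0 < ‖u‖ := norm_pos_iff.2 hu0
    refine ⟨‖u‖⁻¹ • u, by rw [norm_smul, norm_inv, norm_norm, inv_mul_cancel₀ hn.ne'], ?_⟩
    have e : d (‖u‖⁻¹ • u) (‖u‖⁻¹ • u) - k (‖u‖⁻¹ • u) +
        ((n : ℝ) + 1) * ∑ j, ψ j (‖u‖⁻¹ • u) ^ 2 =
        ‖u‖⁻¹ ^ 2 * (d u u - k u + (1 / ((n : ℝ) + 1))⁻¹ * ∑ j, ψ j u ^ 2) := by
      rw [hk2]
      simp only [map_smul, smul_apply, smul_eq_mul, mul_pow, ← Finset.mul_sum,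
        one_div, inv_inv]
      ring
    rw [e]
    calc _ < ‖u‖⁻¹ ^ 2 * (1 / ((n : ℝ) + 1) * ‖u‖ ^ 2) := by gcongr
      _ = _ := by field_simp
  choose v hv1 hv using hcn
  obtain ⟨x, φ, hφ, hlim⟩ := exists_weak_limit v (R := 1) fun n => (hv1 n).le
  have hkl := hk (fun n => v (φ n)) x 1 (fun n => (hv1 _).le) hlim
  have hφt := hφ.tendsto_atTop
  have hinv : Tendsto (fun n => 1 / ((φ n : ℝ) + 1)) atTop (𝓝 0) :=
    tendsto_one_div_add_atTop_nhds_zero_nat.comp hφt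
  have hdn : ∀ u, 0 ≤ d u u := fun u => le_trans (by positivity) (hd u)
  -- Weak lower semicontinuity of `d`, read off from d(v-x, v-x) ≥ 0.
  have hlow : ∀ n, 2 * d x (v n) - d x x ≤ d (v n) (v n) := fun n => by
    have h1 := hdn (v n - x)
    simp only [map_sub, sub_apply] at h1
    rw [hsymm (v n) x] at h1
    linarith
  have hψx : ∑ j, ψ j x ^ 2 = 0 := by
    have h1 : Tendsto (fun n => ∑ j, ψ j (v (φ n)) ^ 2) atTop (𝓝 (∑ j, ψ j x ^ 2)) :=
      tendsto_finsetSum _ fun j _ => (hlim (ψ j)).pow 2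
    have h2 : Tendsto (fun n => 1 / ((φ n : ℝ) + 1) * (1 + k (v (φ n)))) atTop (𝓝 0) := by
      simpa using hinv.mul (hkl.const_add 1)
    refine le_antisymm (le_of_tendsto_of_tendsto' h1 h2 fun n => ?_)
      (Finset.sum_nonneg fun j _ => sq_nonneg _)
    have h3 := hv (φ n)
    have h4 := hdn (v (φ n))
    have h5 : (0 : ℝ) < (φ n : ℝ) + 1 := by positivity
    have h6 : 1 / ((φ n : ℝ) + 1) ≤ 1 := by
      rw [div_le_one h5]; linarith [(φ n).cast_nonneg (α := ℝ)]
    rw [div_mul_eq_mul_div, one_mul, le_div_iff₀ h5]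
    linarith
  have hψ0 : ∀ j, ψ j x = 0 := fun j => by
    have := (Finset.sum_eq_zero_iff_of_nonneg fun j _ => sq_nonneg (ψ j x)).1 hψx j
      (Finset.mem_univ j)
    exact pow_eq_zero_iff two_ne_zero |>.1 this
  have hsum : ∀ n : ℕ, 0 ≤ ((n : ℝ) + 1) * ∑ j, ψ j (v n) ^ 2 := fun n =>
    mul_nonneg (by positivity) (Finset.sum_nonneg fun j _ => sq_nonneg _)
  have hx0 : x = 0 := by
    by_contra hx
    have h1 := hpos x hx hψ0
    have h2 : Tendsto (fun n => 2 * d x (v (φ n)) - d x x - k (v (φ n))) atTop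
        (𝓝 (2 * d x x - d x x - k x)) := (((hlim (d x)).const_mul 2).sub_const _).sub hkl
    have h3 := le_of_tendsto_of_tendsto' h2 hinv fun n => by
      have := hlow (φ n); have := hv (φ n); have := hsum (φ n)
      linarith
    linarith
  have hk0 : k x = 0 := by
    have := hk2 0 x
    rw [hx0, smul_zero] at this
    rw [hx0, this]; ring
  rw [hk0] at hkl
  have h1 := le_of_tendsto_of_tendsto' (tendsto_const_nhds (x := c₀)) (hinv.add hkl) fun n => by
    have h2 := hd (v (φ n)); have h3 := hv (φ n); have h4 := hsum (φ n)
    rw [hv1, one_pow, mul_one] at h2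
    linarith
  linarith

theorem eq_zero_of_nonneg_of_null {X : Type*} [AddCommGroup X] [Module ℝ X]
    (F : X → X → ℝ) (hadd : ∀ u v (t : ℝ), F (u + t • v) (u + t • v) = F u u + 2 * t * F u v + t ^ 2 * F v v)
    (hF : ∀ u, 0 ≤ F u u) {u : X} (hu : F u u = 0) (v : X) : F u v = 0 := by
  by_contra hne
  set a := F u v with ha
  have hv := hF v
  have hpos : 0 < F v v + 1 := by linarith
  -- The usual minimiser is -a / F(v,v); adding 1 covers the case F(v,v) = 0 and keeps the value
  -- negative.
  have h1 := hF (u + (-a / (F v v + 1)) • v)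
  rw [hadd, hu, ← ha] at h1
  have h2 : 0 + 2 * (-a / (F v v + 1)) * a + (-a / (F v v + 1)) ^ 2 * F v v =
      -(a ^ 2 * (F v v + 2)) / (F v v + 1) ^ 2 := by
    field_simp; ring
  rw [h2] at h1
  have h3 : 0 < a ^ 2 * (F v v + 2) / (F v v + 1) ^ 2 := by positivity
  rw [neg_div] at h1
  linarith

/-- Existence of a real eigenvalue for a Hamiltonian pair of forms. -/
theorem exists_eigenpair [TopologicalSpace.SeparableSpace X]
    (bm l d : X →L[ℝ] X →L[ℝ] ℝ) (k : X →L[ℝ] X →L[ℝ] ℝ)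
    (hbm : ∀ u v, bm u v = bm v u) (hl : ∀ u v, l u v = l v u) (hds : ∀ u v, d u v = d v u)
    (hks : ∀ u v, k u v = k v u)
    {c₁ : ℝ} (hc₁ : 0 < c₁) (hbmc : ∀ u, c₁ * ‖u‖ ^ 2 ≤ bm u u)
    {c₀ : ℝ} (hc₀ : 0 < c₀) (hdc : ∀ u, c₀ * ‖u‖ ^ 2 ≤ d u u)
    (hk : WeakSeqCont fun u => k u u) {C : ℝ} (hC : 0 < C) (hkl : ∀ u, k u u ≤ C * l u u)
    {u₀ : X} (hu₀ : d u₀ u₀ < k u₀ u₀) :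
    ∃ (m : ℝ) (u s : X), 0 < m ∧ u ≠ 0 ∧ (∀ w, bm s w = l u w) ∧
      ∀ w, d u w - k u w = -m * l s w := by
  have hcoer : IsCoercive bm := ⟨c₁, hc₁, fun u => by
    have := hbmc u; rwa [mul_assoc, ← pow_two]⟩
  -- Lax–Milgram solution operator of `bm`. In the application `bm` is B⁻ and `l` the L² product, so
  -- `S` is the inverse of L⁻ and `e` below is its quadratic form.
  let S : X →L[ℝ] X := (hcoer.continuousLinearEquivOfBilin.symm : X →L[ℝ] X).comp
    (InnerProductSpace.continuousLinearMapOfBilin l)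
  have hS : ∀ u w, bm (S u) w = l u w := fun u w => by
    have h1 := hcoer.continuousLinearEquivOfBilin_apply (S u) w
    rw [← h1]
    simp [S]
  let e : X →L[ℝ] X →L[ℝ] ℝ := l.comp S
  have he : ∀ u w, e u w = l (S u) w := fun u w => rfl
  have he' : ∀ u w, e u w = bm (S u) (S w) := fun u w => by
    rw [he, hl, ← hS, hbm]
  have hes : ∀ u w, e u w = e w u := fun u w => by rw [he', he', hbm]
  have hbmn : ∀ u, 0 ≤ bm u u := fun u => le_trans (by positivity) (hbmc u)
  have hen : ∀ u, 0 ≤ e u u := fun u => by rw [he']; exact hbmn _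
  let F : ℝ → X → X → ℝ := fun m u w => d u w - k u w + m * e u w
  -- the form is nonnegative for large `m`
  have hlam : ∀ u (t : ℝ), 0 < t → l u u ≤ t * e u u + bm u u / t := fun u t ht => by
    -- Young's inequality for l(u,u) = bm(Su,u), with bm(Su,Su) = e(u,u).
    have h1 := hbmn (t • S u - u)
    simp only [map_sub, map_smul, sub_apply, smul_apply,
      smul_eq_mul] at h1
    rw [hbm u (S u), ← he' u u, hS u u] at h1
    have h2 : 2 * l u u ≤ t * e u u + bm u u / t := by
      rw [← sub_nonneg]
      have : t * e u u + bm u u / t - 2 * l u u =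
          (t * (t * e u u) - t * l u u - (t * l u u - bm u u)) / t := by field_simp; ring
      rw [this]
      apply div_nonneg _ ht.le
      linarith
    have h3 : 0 ≤ t * e u u + bm u u / t := by
      have := hen u; have := hbmn u; positivity
    linarith
  have hbound : ∀ (b : X →L[ℝ] X →L[ℝ] ℝ) u, b u u ≤ ‖b‖ * ‖u‖ ^ 2 := fun b u => by
    have := b.le_opNorm₂ u u
    rw [pow_two, ← mul_assoc]
    exact (le_abs_self _).trans this
  have hbig : ∃ m : ℝ, 0 ≤ m ∧ ∀ u, 0 ≤ F m u u := by
    -- With this value t in `hlam`, the term C·bm(u,u)/t is at most c₀‖u‖² and is paid for by the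
    -- coercivity of `d`; what remains is the multiple m = Ct of `e`.
    have htp : 0 < C * (‖bm‖ + 1) / c₀ := by positivity
    refine ⟨C * (C * (‖bm‖ + 1) / c₀), by positivity, fun u => ?_⟩
    have h1 := hlam u _ htp
    have h2 := hkl u
    have h3 := hdc u
    have h4 := hbound bm u
    have h5 : C * (bm u u / (C * (‖bm‖ + 1) / c₀)) ≤ c₀ * ‖u‖ ^ 2 := by
      have : C * (bm u u / (C * (‖bm‖ + 1) / c₀)) = c₀ * (bm u u / (‖bm‖ + 1)) := by field_simp
      rw [this]
      gcongr
      rw [div_le_iff₀ (by positivity)]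
      nlinarith [sq_nonneg ‖u‖]
    have h6 := mul_le_mul_of_nonneg_left h1 hC.le
    simp only [F]
    nlinarith
  let A : Set ℝ := {m | 0 ≤ m ∧ ∀ u, 0 ≤ F m u u}
  have hAne : A.Nonempty := hbig
  have hAbdd : BddBelow A := ⟨0, fun m hm => hm.1⟩
  have hAcl : IsClosed A := by
    have : A = Ici 0 ∩ ⋂ u, {m | 0 ≤ F m u u} := by
      ext m; simp [A]
    rw [this]
    refine isClosed_Ici.inter (isClosed_iInter fun u => isClosed_le continuous_const ?_)
    simp only [F]
    fun_prop
  set m := sInf A with hm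
  have hmA : m ∈ A := hAcl.csInf_mem hAne hAbdd
  have hm0 : 0 < m := by
    refine lt_of_le_of_ne hmA.1 fun h0 => ?_
    have h1 := hmA.2 u₀
    rw [← h0] at h1
    simp only [F, zero_mul, add_zero] at h1
    linarith
  have hnull : ∃ u, u ≠ 0 ∧ F m u u ≤ 0 := by
    by_contra hcon
    push Not at hcon
    -- A positive definite F(m) would be coercive, and lowering `m` by c/(‖e‖+1) would keep it
    -- nonnegative, contradicting the choice of `m` as infimum.
    obtain ⟨c, hc, hcc⟩ := coercive_of_pos (ι := Empty) (d + m • e)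
      (fun u v => by simp [hds u v, hes u v]) hc₀ (fun u => by
        have h1 := hdc u; have h2 := hen u
        simp only [add_apply, smul_apply, smul_eq_mul]
        nlinarith) (fun u => k u u) hk (fun a u => by
          simp only [map_smul, smul_apply, smul_eq_mul]; ring)
      (fun j => j.elim) (fun u hu _ => by
        have := hcon u hu
        simp only [F] at this
        simp only [add_apply, smul_apply, smul_eq_mul]
        linarith)
    have hδ : 0 < c / (‖e‖ + 1) := by positivity
    have hmem : max 0 (m - c / (‖e‖ + 1)) ∈ A := by
      refine ⟨le_max_left _ _, fun u => ?_⟩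
      have h1 := hcc u
      simp only [add_apply, smul_apply, smul_eq_mul,
        Finset.univ_eq_empty, Finset.sum_empty, mul_zero, add_zero] at h1
      have h2 := hbound e u
      have h3 : c / (‖e‖ + 1) * e u u ≤ c * ‖u‖ ^ 2 := by
        rw [div_mul_eq_mul_div, div_le_iff₀ (by positivity)]
        nlinarith [sq_nonneg ‖u‖, mul_nonneg hc.le (sq_nonneg ‖u‖), mul_le_mul_of_nonneg_left h2 hc.le]
      have h4 : (m - c / (‖e‖ + 1)) * e u u ≤ max 0 (m - c / (‖e‖ + 1)) * e u u :=
        mul_le_mul_of_nonneg_right (le_max_right _ _) (hen u)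
      simp only [F]
      linarith
    have h1 := csInf_le hAbdd hmem
    rw [← hm] at h1
    have h2 : max 0 (m - c / (‖e‖ + 1)) < m := max_lt hm0 (by linarith)
    linarith
  obtain ⟨u, hu, hFu⟩ := hnull
  -- A null vector of a nonnegative form lies in its kernel: this is the Euler–Lagrange equation.
  have hker : ∀ w, F m u w = 0 := fun w => by
    refine eq_zero_of_nonneg_of_null (F m) (fun u v t => ?_) hmA.2 (le_antisymm hFu (hmA.2 u)) w
    simp only [F, map_add, map_smul, add_apply, smul_apply,
      smul_eq_mul]
    rw [hds v u, hks v u, hes v u]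
    ring
  refine ⟨m, u, S u, hm0, hu, hS u, fun w => ?_⟩
  have := hker w
  simp only [F, he] at this
  linarith

end Hilbert

end DeltaNLS
end

open MeasureTheory Filter Topology ComplexConjugate
noncomputable section
namespace DeltaNLS
open Set

/-! ### The Hilbert space of real `H¹` functions -/

/-- Real `H¹` functions as a space of functions. -/
def h1Submodule : Submodule ℝ (ℝ → ℝ) where
  carrier := {f | RH1 f}
  add_mem' := RH1.add
  zero_mem' := RH1.zero
  smul_mem' c _ hf := hf.const_smul c

/-- The type of real `H¹` functions. -/
def H1R : Type := h1Submodule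

instance : AddCommGroup H1R := inferInstanceAs (AddCommGroup h1Submodule)

instance : Module ℝ H1R := inferInstanceAs (Module ℝ h1Submodule)

namespace H1R

/-- The function underlying an element of `H1R`. -/
def val (f : H1R) : ℝ → ℝ := Subtype.val (p := fun f => f ∈ h1Submodule) f

/-- An `H¹` function as an element of `H1R`. -/
def mk (f : ℝ → ℝ) (hf : RH1 f) : H1R := Subtype.mk (p := fun f => f ∈ h1Submodule) f hf

@[simp] theorem val_mk (f : ℝ → ℝ) (hf : RH1 f) : (mk f hf).val = f := rfl

@[simp] theorem val_add (f g : H1R) : (f + g).val = f.val + g.val := rfl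

@[simp] theorem val_smul (c : ℝ) (f : H1R) : (c • f).val = c • f.val := rfl

@[simp] theorem val_zero : (0 : H1R).val = 0 := rfl

@[simp] theorem val_neg (f : H1R) : (-f).val = -f.val := rfl

@[simp] theorem val_sub (f g : H1R) : (f - g).val = f.val - g.val := rfl

theorem rh1 (f : H1R) : RH1 f.val := Subtype.property (p := fun f => f ∈ h1Submodule) f

theorem ext {f g : H1R} (h : f.val = g.val) : f = g := Subtype.ext h

/-- The inner product `∫ f g + ∫ f' g'`. -/
@[reducible] def core : InnerProductSpace.Core ℝ H1R where
  inner f g := (∫ x, f.val x * g.val x) + ∫ x, deriv f.val x * deriv g.val x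
  conj_inner_symm f g := by simp [mul_comm]
  re_inner_nonneg f := by
    simp only [← pow_two, RCLike.re_to_real]
    exact add_nonneg (integral_nonneg fun _ => sq_nonneg _) (integral_nonneg fun _ => sq_nonneg _)
  add_left f g h := by
    have h1 : ∫ x, deriv (f + g).val x * deriv h.val x =
        ∫ x, (deriv f.val x * deriv h.val x + deriv g.val x * deriv h.val x) := by
      refine integral_congr_ae ?_
      filter_upwards [f.rh1.deriv_add_ae g.rh1] with x hx
      rw [val_add, hx]; ring
    have h2 : ∫ x, (f + g).val x * h.val x = ∫ x, (f.val x * h.val x + g.val x * h.val x) := by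
      congr 1; funext x; simp [add_mul]
    rw [h1, h2, integral_add, integral_add]
    · ring
    · exact f.rh1.memLp_deriv.integrable_mul h.rh1.memLp_deriv
    · exact g.rh1.memLp_deriv.integrable_mul h.rh1.memLp_deriv
    · exact f.rh1.memLp.integrable_mul h.rh1.memLp
    · exact g.rh1.memLp.integrable_mul h.rh1.memLp
  smul_left f g c := by
    simp only [val_smul, RH1.deriv_smul, Pi.smul_apply, smul_eq_mul, mul_assoc,
      integral_const_mul, conj_trivial]
    ring
  definite f hf := by
    have h1 : 0 ≤ ∫ x, f.val x * f.val x := integral_nonneg fun _ => mul_self_nonneg _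
    have h2 : 0 ≤ ∫ x, deriv f.val x * deriv f.val x := integral_nonneg fun _ => mul_self_nonneg _
    apply ext
    funext x
    have h3 := f.rh1.sq_le x
    simp only [pow_two] at h3
    have h4 : f.val x * f.val x ≤ 0 := h3.trans_eq hf
    simpa using le_antisymm h4 (mul_self_nonneg _)

instance : NormedAddCommGroup H1R := core.toNormedAddCommGroup

instance : InnerProductSpace ℝ H1R := InnerProductSpace.ofCore core.toCore

theorem inner_def (f g : H1R) : inner ℝ f g =
    (∫ x, f.val x * g.val x) + ∫ x, deriv f.val x * deriv g.val x := rfl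

theorem norm_sq (f : H1R) : ‖f‖ ^ 2 = (∫ x, f.val x ^ 2) + ∫ x, deriv f.val x ^ 2 := by
  rw [← real_inner_self_eq_norm_sq, inner_def]
  simp only [pow_two]

theorem inner_toLp {f g : ℝ → ℝ} (hf : MemLp f 2 volume) (hg : MemLp g 2 volume) :
    inner ℝ (hf.toLp f) (hg.toLp g) = ∫ x, f x * g x := by
  rw [L2.inner_def]
  refine integral_congr_ae ?_
  filter_upwards [hf.coeFn_toLp, hg.coeFn_toLp] with x h1 h2
  rw [h1, h2]
  simp [mul_comm]

theorem norm_toLp_sq {f : ℝ → ℝ} (hf : MemLp f 2 volume) :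
    ‖hf.toLp f‖ ^ 2 = ∫ x, f x ^ 2 := by
  rw [← real_inner_self_eq_norm_sq, inner_toLp]
  simp only [pow_two]

/-- The embedding `f ↦ (f, f')` into `L² × L²`. -/
def toProd : H1R →ₗᵢ[ℝ] WithLp 2 (Lp ℝ 2 (volume : Measure ℝ) × Lp ℝ 2 (volume : Measure ℝ)) where
  toFun f := WithLp.toLp 2 (f.rh1.memLp.toLp f.val, f.rh1.memLp_deriv.toLp (deriv f.val))
  map_add' f g := by
    apply WithLp.ofLp_injective
    refine Prod.ext ?_ ?_
    · exact MemLp.toLp_add f.rh1.memLp g.rh1.memLp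
    · change _ = f.rh1.memLp_deriv.toLp _ + g.rh1.memLp_deriv.toLp _
      rw [← MemLp.toLp_add]
      exact (MemLp.toLp_eq_toLp_iff (f + g).rh1.memLp_deriv _).2 (f.rh1.deriv_add_ae g.rh1)
  map_smul' c f := by
    apply WithLp.ofLp_injective
    refine Prod.ext ?_ ?_
    · exact MemLp.toLp_const_smul c f.rh1.memLp
    · change _ = c • f.rh1.memLp_deriv.toLp _
      rw [← MemLp.toLp_const_smul]
      exact (MemLp.toLp_eq_toLp_iff (c • f).rh1.memLp_deriv _).2 (Eventually.of_forall fun x => by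
        simp [RH1.deriv_smul])
  norm_map' f := by
    rw [← sq_eq_sq₀ (norm_nonneg _) (norm_nonneg _), WithLp.prod_norm_sq_eq_of_L2, norm_sq]
    exact congrArg₂ (· + ·) (norm_toLp_sq f.rh1.memLp) (norm_toLp_sq f.rh1.memLp_deriv)

theorem toProd_snd (f : H1R) : (toProd f).snd = f.rh1.memLp_deriv.toLp (deriv f.val) := rfl

/-- The inclusion `H¹ → L²`. -/
def incl : H1R →L[ℝ] Lp ℝ 2 (volume : Measure ℝ) :=
  (WithLp.fstL 2 ℝ _ _).comp toProd.toContinuousLinearMap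

/-- The derivative `H¹ → L²`. -/
def derivL : H1R →L[ℝ] Lp ℝ 2 (volume : Measure ℝ) :=
  (WithLp.sndL 2 ℝ _ _).comp toProd.toContinuousLinearMap

theorem incl_apply (f : H1R) : incl f = f.rh1.memLp.toLp f.val := rfl

theorem derivL_apply (f : H1R) : derivL f = f.rh1.memLp_deriv.toLp (deriv f.val) := rfl

theorem abs_le_norm (f : H1R) (x : ℝ) : |f.val x| ≤ ‖f‖ := by
  have := f.rh1.sq_le x
  rw [← norm_sq] at this
  exact abs_le_of_sq_le_sq this (norm_nonneg _)

/-- Evaluation at a point. -/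
def ev (x : ℝ) : H1R →L[ℝ] ℝ :=
  LinearMap.mkContinuous
    { toFun := fun f => f.val x
      map_add' := fun _ _ => rfl
      map_smul' := fun _ _ => rfl } 1 fun f => by
    rw [one_mul]; exact f.abs_le_norm x

@[simp] theorem ev_apply (x : ℝ) (f : H1R) : ev x f = f.val x := rfl

instance : TopologicalSpace.SeparableSpace H1R := by
  have : Fact ((2 : ENNReal) ≠ ⊤) := ⟨by norm_num⟩
  have := toProd.isometry.isEmbedding.secondCountableTopology
  infer_instance

theorem continuous_integral_interval (x : ℝ) :
    Continuous fun g : Lp ℝ 2 (volume : Measure ℝ) => ∫ t in (0 : ℝ)..x, g t := by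
  have h : ∀ a b : ℝ, Continuous fun g : Lp ℝ 2 (volume : Measure ℝ) => ∫ t in Ioc a b, g t := by
    intro a b
    have h1 := fun g : Lp ℝ 2 (volume : Measure ℝ) =>
      L2.inner_indicatorConstLp_one (𝕜 := ℝ) (measurableSet_Ioc (a := a) (b := b))
        measure_Ioc_lt_top.ne g
    simp_rw [← h1]
    fun_prop
  exact (h 0 x).sub (h x 0)

/-- The range of f ↦ (f, f') is closed, which gives completeness. The limit function is the limit of
the values at 0 plus the primitive of the limit derivative; it is the pointwise limit of the
sequence, hence agrees with the L² limit through an a.e. convergent subsequence. -/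
theorem exists_of_tendsto (u : ℕ → H1R) {z : WithLp 2 (Lp ℝ 2 (volume : Measure ℝ) ×
    Lp ℝ 2 (volume : Measure ℝ))} (hz : Tendsto (fun n => toProd (u n)) atTop (𝓝 z)) :
    ∃ f, toProd f = z := by
  have hcau : CauchySeq u := by
    have h1 := hz.cauchySeq
    refine (toProd.isometry.isUniformInducing.cauchy_map_iff).1 ?_
    rwa [Filter.map_map]
  obtain ⟨a, ha⟩ := cauchySeq_tendsto_of_complete ((ev 0).uniformContinuous.comp_cauchySeq hcau)
  set g := z.snd
  set F : ℝ → ℝ := fun x => a + ∫ t in (0 : ℝ)..x, g t with hF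
  have hfst : Tendsto (fun n => (toProd (u n)).fst) atTop (𝓝 z.fst) :=
    ((WithLp.fstL 2 ℝ _ _).continuous.tendsto z).comp hz
  have hsnd : Tendsto (fun n => (toProd (u n)).snd) atTop (𝓝 z.snd) :=
    ((WithLp.sndL 2 ℝ _ _).continuous.tendsto z).comp hz
  have hpt : ∀ x, Tendsto (fun n => (u n).val x) atTop (𝓝 (F x)) := by
    intro x
    refine (ha.add (((continuous_integral_interval x).tendsto z.snd).comp hsnd)).congr fun n => ?_
    simp only [Function.comp_apply, toProd_snd, ev_apply]
    have : ∫ t in (0 : ℝ)..x, ((u n).rh1.memLp_deriv.toLp (deriv (u n).val)) t =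
        ∫ t in (0 : ℝ)..x, deriv (u n).val t := by
      refine intervalIntegral.integral_congr_ae ?_
      filter_upwards [(u n).rh1.memLp_deriv.coeFn_toLp] with t ht _ using ht
    rw [this, (u n).rh1.integral_deriv]
    ring
  have hae : F =ᵐ[volume] z.fst := by
    obtain ⟨ns, hns, hlim⟩ := (tendstoInMeasure_of_tendsto_Lp hfst).exists_seq_tendsto_ae
    have hall : ∀ᵐ x, ∀ n, ((toProd (u n)).fst : ℝ → ℝ) x = (u n).val x :=
      ae_all_iff.2 fun n => (u n).rh1.memLp.coeFn_toLp
    filter_upwards [hlim, hall] with x hx hx'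
    simp only [hx'] at hx
    exact tendsto_nhds_unique ((hpt x).comp hns.tendsto_atTop) hx
  have hmem : MemLp F 2 volume := (memLp_congr_ae hae).2 (Lp.memLp z.fst)
  obtain ⟨hrh, hder⟩ := RH1.of_integral hmem (Lp.memLp g) fun x => by simp [hF]
  refine ⟨mk F hrh, ?_⟩
  apply WithLp.ofLp_injective
  refine Prod.ext ?_ ?_
  · change hmem.toLp F = z.fst
    rw [← Lp.toLp_coeFn z.fst (Lp.memLp _)]
    exact (MemLp.toLp_eq_toLp_iff _ _).2 hae
  · change hrh.memLp_deriv.toLp (deriv F) = z.snd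
    rw [← Lp.toLp_coeFn z.snd (Lp.memLp _)]
    exact (MemLp.toLp_eq_toLp_iff _ _).2 hder

instance : CompleteSpace H1R := by
  rw [completeSpace_iff_isComplete_range toProd.isometry.isUniformInducing]
  refine IsClosed.isComplete (IsSeqClosed.isClosed fun z y hz hy => ?_)
  choose u hu using hz
  exact exists_of_tendsto u (by simpa only [hu] using hy)

end H1R

/-! ### Bounded bilinear forms -/

/-- The bilinear form `⟨A u, B v⟩`. -/
def pullInner {X E : Type*} [NormedAddCommGroup X] [InnerProductSpace ℝ X] [NormedAddCommGroup E]
    [InnerProductSpace ℝ E] (A B : X →L[ℝ] E) : X →L[ℝ] X →L[ℝ] ℝ :=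
  LinearMap.mkContinuous₂ (LinearMap.mk₂ ℝ (fun u v => inner ℝ (A u) (B v))
    (fun u v w => by simp [inner_add_left]) (fun c u v => by simp [real_inner_smul_left])
    (fun u v w => by simp [inner_add_right]) (fun c u v => by simp [real_inner_smul_right]))
    (‖A‖ * ‖B‖) fun u v => by
      refine (norm_inner_le_norm _ _).trans ?_
      calc ‖A u‖ * ‖B v‖ ≤ (‖A‖ * ‖u‖) * (‖B‖ * ‖v‖) := by
            gcongr
            · exact A.le_opNorm u
            · exact B.le_opNorm v
        _ = _ := by ring

theorem pullInner_apply {X E : Type*} [NormedAddCommGroup X] [InnerProductSpace ℝ X]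
    [NormedAddCommGroup E] [InnerProductSpace ℝ E] (A B : X →L[ℝ] E) (u v : X) :
    pullInner A B u v = inner ℝ (A u) (B v) := rfl

open H1R

/-- The `L²` inner product on `H¹`. -/
def lform : H1R →L[ℝ] H1R →L[ℝ] ℝ := pullInner incl incl

theorem lform_apply (f g : H1R) : lform f g = ∫ x, f.val x * g.val x :=
  inner_toLp f.rh1.memLp g.rh1.memLp

theorem lform_symm (f g : H1R) : lform f g = lform g f := by
  simp only [lform_apply, mul_comm]

/-- The unperturbed form `∫ f' g' + ω ∫ f g - γ f(0) g(0)`. -/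
def dform (ω γ : ℝ) : H1R →L[ℝ] H1R →L[ℝ] ℝ :=
  pullInner derivL derivL + ω • lform - γ • pullInner (ev 0) (ev 0)

theorem dform_apply (ω γ : ℝ) (f g : H1R) : dform ω γ f g =
    (∫ x, deriv f.val x * deriv g.val x) + ω * (∫ x, f.val x * g.val x) -
      γ * f.val 0 * g.val 0 := by
  simp only [dform, sub_apply, add_apply, smul_apply, smul_eq_mul, lform_apply, pullInner_apply,
    derivL_apply, inner_toLp, ev_apply]
  simp only [RCLike.inner_apply, conj_trivial]
  ring

theorem dform_symm (ω γ : ℝ) (f g : H1R) : dform ω γ f g = dform ω γ g f := by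
  simp only [dform_apply, mul_comm (deriv f.val _), mul_comm (f.val _)]
  ring

/-! ### The potential as a weakly continuous perturbation of a coercive form -/

namespace Params

variable {p ω γ : ℝ} (h : Params p ω γ)
include h

theorem memLp_pot_mul {f : ℝ → ℝ} (hf : MemLp f 2 volume) :
    MemLp (fun x => pot p ω γ |x| * f x) 2 volume := by
  refine hf.of_le_mul (c := (p + 1) * ω / 2)
    ((continuous_pot.comp continuous_abs).aestronglyMeasurable.mul hf.1) ?_
  exact Eventually.of_forall fun x => by
    rw [norm_mul, Real.norm_eq_abs, abs_of_pos (h.pot_pos _)]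
    exact mul_le_mul_of_nonneg_right (h.pot_le _) (norm_nonneg _)

/-- Multiplication by the potential. -/
def potMul : H1R →L[ℝ] Lp ℝ 2 (volume : Measure ℝ) :=
  LinearMap.mkContinuous
    { toFun := fun f => (h.memLp_pot_mul f.rh1.memLp).toLp _
      map_add' := fun f g => by
        rw [← MemLp.toLp_add]
        exact (MemLp.toLp_eq_toLp_iff _ _).2 (Eventually.of_forall fun x => by simp [mul_add])
      map_smul' := fun c f => by
        rw [RingHom.id_apply, ← MemLp.toLp_const_smul]
        exact (MemLp.toLp_eq_toLp_iff _ _).2 (Eventually.of_forall fun x => by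
          simp [mul_left_comm]) } ((p + 1) * ω / 2) fun f => by
    have h1 : ‖(h.memLp_pot_mul f.rh1.memLp).toLp _‖ ≤ (p + 1) * ω / 2 * ‖incl f‖ := by
      refine Lp.norm_le_mul_norm_of_ae_le_mul ?_
      rw [incl_apply]
      filter_upwards [(h.memLp_pot_mul f.rh1.memLp).coeFn_toLp, f.rh1.memLp.coeFn_toLp]
        with x h1 h2
      rw [h1, h2, norm_mul, Real.norm_eq_abs, abs_of_pos (h.pot_pos _)]
      exact mul_le_mul_of_nonneg_right (h.pot_le _) (norm_nonneg _)
    refine h1.trans ?_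
    have h2 : 0 ≤ (p + 1) * ω / 2 := (h.pot_pos 0).le.trans (h.pot_le 0)
    have h3 : ‖incl f‖ ≤ ‖f‖ := by
      rw [← sq_le_sq₀ (norm_nonneg _) (norm_nonneg _), incl_apply, norm_toLp_sq, norm_sq]
      exact le_add_of_nonneg_right (integral_nonneg fun _ => sq_nonneg _)
    gcongr

/-- The potential form `∫ Q^{p-1} f g`. -/
def kform : H1R →L[ℝ] H1R →L[ℝ] ℝ := pullInner h.potMul incl

theorem kform_apply (f g : H1R) :
    h.kform f g = ∫ x, pot p ω γ |x| * (f.val x * g.val x) := by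
  change inner ℝ ((h.memLp_pot_mul f.rh1.memLp).toLp _) (g.rh1.memLp.toLp _) = _
  rw [inner_toLp]
  simp only [mul_assoc]

theorem kform_symm (f g : H1R) : h.kform f g = h.kform g f := by
  simp only [kform_apply, mul_comm (f.val _)]

theorem kform_le (f : H1R) : h.kform f f ≤ (p + 1) * ω / 2 * lform f f := by
  rw [kform_apply, lform_apply, ← integral_const_mul]
  have hi : Integrable fun x => f.val x * f.val x := f.rh1.memLp.integrable_mul f.rh1.memLp
  refine integral_mono (h.integrable_pot_mul hi) (hi.const_mul _) fun x => ?_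
  exact mul_le_mul_of_nonneg_right (h.pot_le _) (mul_self_nonneg _)

theorem kform_nonneg (f : H1R) : 0 ≤ h.kform f f := by
  rw [kform_apply]
  exact integral_nonneg fun x => mul_nonneg (h.pot_pos _).le (mul_self_nonneg _)

theorem dform_sub_kform (c : ℝ) (f g : H1R) :
    dform ω γ f g - c * h.kform f g = bform p ω γ c f.val g.val := by
  rw [dform_apply, kform_apply, bform, ← integral_const_mul c]
  have : (fun x => c * (pot p ω γ |x| * (f.val x * g.val x))) =
      fun x => c * Q p ω γ x ^ (p - 1) * f.val x * g.val x := by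
    funext x
    rw [h.Q_rpow]
    ring
  rw [this]

theorem dform_coercive : ∃ c₀ : ℝ, 0 < c₀ ∧ ∀ f : H1R, c₀ * ‖f‖ ^ 2 ≤ dform ω γ f f := by
  refine ⟨min 1 ω, lt_min one_pos h.ω_pos, fun f => ?_⟩
  rw [norm_sq, dform_apply]
  simp only [← pow_two]
  have h1 : 0 ≤ ∫ x, f.val x ^ 2 := integral_nonneg fun _ => sq_nonneg _
  have h2 : 0 ≤ ∫ x, deriv f.val x ^ 2 := integral_nonneg fun _ => sq_nonneg _
  have h3 := min_le_left 1 ω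
  have h4 := min_le_right 1 ω
  have h5 : γ * f.val 0 * f.val 0 ≤ 0 := by
    rw [mul_assoc]; exact mul_nonpos_of_nonpos_of_nonneg h.hγ.le (mul_self_nonneg _)
  nlinarith

theorem integrable_pot : Integrable fun x : ℝ => pot p ω γ |x| := by
  have hp := h.hp
  set K := ((p + 1) * ω / 2) ^ ((p - 3) / (p - 1)) with hK
  -- Here V = V^((p-3)/(p-1)) Q², and the first factor is bounded because p ≥ 3.
  have hle : ∀ x, pot p ω γ x ≤ K * sol p ω γ x ^ 2 := fun x => by
    have hV := h.pot_pos x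
    have hp1 : p - 1 ≠ 0 := by linarith
    have h1 : sol p ω γ x ^ 2 = pot p ω γ x ^ (2 / (p - 1)) := by
      rw [sol, ← Real.rpow_natCast, ← Real.rpow_mul hV.le]
      congr 1; push_cast; ring
    have h2 : pot p ω γ x = pot p ω γ x ^ ((p - 3) / (p - 1)) * pot p ω γ x ^ (2 / (p - 1)) := by
      rw [← Real.rpow_add hV, ← add_div]
      have : (p - 3 + 2) / (p - 1) = 1 := by rw [div_eq_one_iff_eq hp1]; ring
      rw [this, Real.rpow_one]
    rw [h1]
    conv_lhs => rw [h2]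
    refine mul_le_mul_of_nonneg_right ?_ (Real.rpow_nonneg hV.le _)
    exact Real.rpow_le_rpow hV.le (h.pot_le x) (div_nonneg (by linarith) (by linarith))
  have hS : MemLp (fun x => sol p ω γ |x|) 2 volume := memLp_ite_abs (h.memLp_sol le_rfl)
  refine Integrable.mono' (hS.integrable_sq.const_mul K)
    (continuous_pot.comp continuous_abs).aestronglyMeasurable (Eventually.of_forall fun x => ?_)
  rw [Real.norm_eq_abs, abs_of_pos (h.pot_pos _)]
  exact hle _

/-- Point evaluations are continuous on H¹, so weak convergence is pointwise, and the sup norm is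
bounded by the H¹ norm. Dominated convergence applies since V is integrable. -/
theorem weakSeqCont_kform_comp {X : Type*} [NormedAddCommGroup X] [InnerProductSpace ℝ X]
    (ι : X →L[ℝ] H1R) (c : ℝ) : WeakSeqCont fun u => c * h.kform (ι u) (ι u) := by
  intro u x R hR hlim
  refine Tendsto.const_mul c ?_
  simp only [kform_apply]
  refine tendsto_integral_of_dominated_convergence
    (fun y => pot p ω γ |y| * (‖ι‖ * R) ^ 2) (fun n => ?_) (h.integrable_pot.mul_const _)
    (fun n => ?_) ?_
  · exact ((continuous_pot.comp continuous_abs).mul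
      ((ι (u n)).rh1.continuous.mul (ι (u n)).rh1.continuous)).aestronglyMeasurable
  · refine Eventually.of_forall fun y => ?_
    rw [norm_mul, Real.norm_eq_abs, abs_of_pos (h.pot_pos _), ← pow_two, norm_pow]
    have h1 : ‖(ι (u n)).val y‖ ≤ ‖ι‖ * R :=
      ((ι (u n)).abs_le_norm y).trans ((ι.le_opNorm _).trans (by gcongr; exact hR n))
    have := (h.pot_pos |y|).le
    gcongr
  · refine Eventually.of_forall fun y => ?_
    have := hlim ((ev y).comp ι)
    simp only [ContinuousLinearMap.comp_apply, ev_apply] at this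
    exact (this.mul this).const_mul _

end Params
end DeltaNLS
end

open MeasureTheory Filter Topology ComplexConjugate
noncomputable section
namespace DeltaNLS
open Set H1R

/-! ### Parity -/

namespace H1R

/-- The reflection of a function. -/
def refl (f : H1R) : H1R := mk (fun x => f.val (-x)) f.rh1.comp_neg

@[simp] theorem refl_val (f : H1R) (x : ℝ) : f.refl.val x = f.val (-x) := rfl

@[simp] theorem refl_refl (f : H1R) : f.refl.refl = f := ext (funext fun x => by simp)

/-- `f` is even (`σ = 1`) or odd (`σ = -1`). -/
def HasParity (σ : ℝ) (f : H1R) : Prop := ∀ x, f.val (-x) = σ * f.val x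

theorem HasParity.refl_eq {σ : ℝ} {f : H1R} (hf : HasParity σ f) : f.refl = σ • f :=
  ext (funext fun x => hf x)

theorem HasParity.add {σ : ℝ} {f g : H1R} (hf : HasParity σ f) (hg : HasParity σ g) :
    HasParity σ (f + g) := fun x => by
  simp only [val_add, Pi.add_apply, hf x, hg x]; ring

theorem HasParity.smul {σ : ℝ} {f : H1R} (c : ℝ) (hf : HasParity σ f) :
    HasParity σ (c • f) := fun x => by
  simp only [val_smul, Pi.smul_apply, smul_eq_mul, hf x]; ring

theorem HasParity.sub {σ : ℝ} {f g : H1R} (hf : HasParity σ f) (hg : HasParity σ g) :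
    HasParity σ (f - g) := fun x => by
  simp only [val_sub, Pi.sub_apply, hf x, hg x]; ring

/-- The component of parity `σ`. -/
def part (σ : ℝ) (f : H1R) : H1R := (1 / 2 : ℝ) • (f + σ • f.refl)

theorem hasParity_part {σ : ℝ} (hσ : σ ^ 2 = 1) (f : H1R) : HasParity σ (part σ f) := fun x => by
  simp only [part, val_smul, val_add, Pi.smul_apply, Pi.add_apply, smul_eq_mul, refl_val, neg_neg]
  linear_combination (-(1 / 2) * f.val (-x)) * hσ

theorem part_add_part (f : H1R) : part 1 f + part (-1) f = f := by
  simp only [part]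
  module

theorem lform_refl_refl (f g : H1R) : lform f.refl g.refl = lform f g := by
  simp only [lform_apply, refl_val]
  exact integral_neg_eq_self (fun x => f.val x * g.val x) volume

theorem lform_refl (f g : H1R) : lform f g.refl = lform f.refl g := by
  rw [← lform_refl_refl f.refl g, refl_refl]

/-- A form invariant under reflection only sees the component of the same parity. -/
theorem HasParity.form_part {b : H1R →L[ℝ] H1R →L[ℝ] ℝ} (hb : ∀ f g, b f g.refl = b f.refl g)
    {σ : ℝ} (hσ : σ ^ 2 = 1) {f : H1R} (hf : HasParity σ f) (g : H1R) : b f (part σ g) = b f g := by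
  simp only [part, map_smul, map_add, smul_eq_mul, hb, hf.refl_eq, smul_apply]
  linear_combination (1 / 2 * b f g) * hσ

theorem HasParity.form_eq_zero {b : H1R →L[ℝ] H1R →L[ℝ] ℝ} (hb : ∀ f g, b f g.refl = b f.refl g)
    {f g : H1R} (hf : HasParity 1 f) (hg : HasParity (-1) g) : b f g = 0 := by
  have := hb f g
  rw [hf.refl_eq, hg.refl_eq] at this
  simp only [map_smul, smul_apply, smul_eq_mul] at this
  linarith

end H1R

namespace Params

variable {p ω γ : ℝ} (h : Params p ω γ)

/-- The form `bform` as a bounded bilinear form. -/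
def bil (c : ℝ) : H1R →L[ℝ] H1R →L[ℝ] ℝ := dform ω γ - c • h.kform

include h

theorem bil_apply (c : ℝ) (f g : H1R) : h.bil c f g = bform p ω γ c f.val g.val := by
  rw [← h.dform_sub_kform]; rfl

theorem bil_eq (c : ℝ) (f g : H1R) : h.bil c f g = dform ω γ f g - c * h.kform f g := rfl

theorem bil_symm (c : ℝ) (f g : H1R) : h.bil c f g = h.bil c g f := by
  rw [bil_eq, bil_eq, dform_symm, h.kform_symm]

theorem bil_eq_half (c : ℝ) (f g : H1R) : h.bil c f g =
    halfForm p ω γ c f.val g.val + halfForm p ω γ c f.refl.val g.refl.val := by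
  rw [bil_apply, h.bform_eq_half c f.rh1 g.rh1]; rfl

theorem bil_refl (c : ℝ) (f g : H1R) : h.bil c f g.refl = h.bil c f.refl g := by
  rw [bil_eq_half, bil_eq_half, refl_refl, refl_refl, add_comm]

omit h in
theorem halfForm_smul (c a : ℝ) (f g : ℝ → ℝ) :
    halfForm p ω γ c (a • f) (a • g) = a ^ 2 * halfForm p ω γ c f g := by
  have : ∀ x, deriv (a • f) x * deriv (a • g) x + (ω - c * pot p ω γ x) * ((a • f) x * (a • g) x) =
      a ^ 2 * (deriv f x * deriv g x + (ω - c * pot p ω γ x) * (f x * g x)) := fun x => by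
    simp only [RH1.deriv_smul, Pi.smul_apply, smul_eq_mul]; ring
  simp only [halfForm, this, integral_const_mul]
  simp only [Pi.smul_apply, smul_eq_mul]
  ring

theorem bil_of_parity (c : ℝ) {σ : ℝ} (hσ : σ ^ 2 = 1) {f g : H1R} (hf : HasParity σ f)
    (hg : HasParity σ g) : h.bil c f g = 2 * halfForm p ω γ c f.val g.val := by
  rw [bil_eq_half, hf.refl_eq, hg.refl_eq, val_smul, val_smul, halfForm_smul, hσ]
  ring

/-- On functions of a given parity the form `B⁺` has at most one negative direction and no
kernel. -/
theorem bil_p_pos {σ : ℝ} (hσ : σ ^ 2 = 1) {f Y : H1R} (hf : HasParity σ f) (hY : HasParity σ Y)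
    (hneg : h.bil p Y Y < 0) (horth : h.bil p f Y = 0) (hf0 : f ≠ 0) : 0 < h.bil p f f := by
  by_contra hcon
  push Not at hcon
  set x0 := peak p ω γ
  have hN : ∀ g : H1R, HasParity σ g → g.val x0 = 0 → 0 ≤ h.bil p g g := fun g hg hg0 => by
    rw [h.bil_of_parity p hσ hg hg]
    have := (h.halfForm_p_nonneg g.rh1 hg0).1
    linarith
  have hY0 : Y.val x0 ≠ 0 := fun h0 => by
    have := hN Y hY h0
    linarith
  -- This combination vanishes at `x0`, so its energy is nonnegative. By orthogonality the energy is
  -- Y(x0)²B⁺(f,f) + f(x0)²B⁺(Y,Y), a sum of two nonpositive terms, so both vanish.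
  have h1 := hN (Y.val x0 • f - f.val x0 • Y) ((hf.smul _).sub (hY.smul _)) (by simp [mul_comm])
  simp only [map_sub, map_smul, sub_apply, smul_apply, smul_eq_mul, h.bil_symm p Y f, horth] at h1
  have h2 : 0 ≤ f.val x0 ^ 2 * -h.bil p Y Y := mul_nonneg (sq_nonneg _) (by linarith)
  have h3 : 0 ≤ Y.val x0 ^ 2 * -h.bil p f f := mul_nonneg (sq_nonneg _) (by linarith)
  have h4 : f.val x0 ^ 2 * -h.bil p Y Y = 0 := by linarith
  have h5 : Y.val x0 ^ 2 * -h.bil p f f = 0 := by linarith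
  have hfx : f.val x0 = 0 := by
    rcases mul_eq_zero.1 h4 with h6 | h6
    · exact pow_eq_zero_iff two_ne_zero |>.1 h6
    · linarith
  have hff : halfForm p ω γ p f.val f.val = 0 := by
    have h6 : h.bil p f f = 0 := by
      rcases mul_eq_zero.1 h5 with h6 | h6
      · exact absurd (pow_eq_zero_iff two_ne_zero |>.1 h6) hY0
      · linarith
    rw [h.bil_of_parity p hσ hf hf] at h6
    linarith
  obtain ⟨c, hc⟩ := (h.halfForm_p_nonneg f.rh1 hfx).2 hff
  -- The pairing with `Y` sees only the kink of `f` at the peak; since Y(x0) ≠ 0, its size is zero.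
  rw [h.bil_of_parity p hσ hf hY, h.halfForm_truncated hc f.rh1 Y.rh1] at horth
  have hc0 : c = 0 := by
    have := h.sol''_peak_neg.ne
    simpa [this, hY0, x0] using horth
  apply hf0
  have hpos : ∀ x, 0 ≤ x → f.val x = 0 := fun x hx => by rw [hc x hx, hc0, zero_mul]
  refine H1R.ext (funext fun x => ?_)
  rcases le_total 0 x with hx | hx
  · exact hpos x hx
  · have := hf (-x)
    rw [neg_neg, hpos (-x) (by linarith), mul_zero] at this
    exact this

/-! ### Distinguished elements -/

/-- The ground state as an element of `H¹`. -/
def groundState : H1R := H1R.mk (fun x => sol p ω γ |x|)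
  (rh1_comp_abs h.hasDerivAt_sol h.continuous_sol' (h.memLp_sol le_rfl) (h.memLp_sol' le_rfl))

theorem groundState_val (x : ℝ) : h.groundState.val x = Q p ω γ x := rfl

theorem groundState_parity : HasParity 1 h.groundState := fun x => by
  simp [groundState]

theorem lform_groundState_pos : 0 < lform h.groundState h.groundState := by
  rw [lform_apply]
  have hi : Integrable fun x => h.groundState.val x * h.groundState.val x :=
    h.groundState.rh1.memLp.integrable_mul h.groundState.rh1.memLp
  rw [integral_pos_iff_support_of_nonneg (fun x => mul_self_nonneg _) hi]
  have : Function.support (fun x => h.groundState.val x * h.groundState.val x) = univ := by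
    ext x
    have := (h.sol_pos |x|).ne'
    simp [groundState, this]
  rw [this]
  simp

/-- The Robin condition removes the boundary term on each half-line, so the form acts as the
differential expression applied to the even extension of the profile. -/
theorem bil_even {w w1 w2 : ℝ → ℝ} (c : ℝ)
    (hd : ∀ x, HasDerivAt w (w1 x) x) (hd1 : ∀ x, HasDerivAt w1 (w2 x) x) (hc1 : Continuous w1)
    (hc2 : Continuous w2) (hw : MemLp w 2 (volume.restrict (Ioi 0)))
    (hw1 : MemLp w1 2 (volume.restrict (Ioi 0))) (hw2 : MemLp w2 2 (volume.restrict (Ioi 0)))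
    (hrobin : w1 0 + γ / 2 * w 0 = 0) {r : ℝ → ℝ}
    (hr : ∀ x, -w2 x + (ω - c * pot p ω γ x) * w x = r x)
    (hrm : MemLp (fun x => r |x|) 2 volume) (g : H1R) :
    h.bil c (H1R.mk (fun x => w |x|) (rh1_comp_abs hd hc1 hw hw1)) g = ∫ x, r |x| * g.val x := by
  have hrefl : (H1R.mk (fun x => w |x|) (rh1_comp_abs hd hc1 hw hw1)).refl =
      H1R.mk (fun x => w |x|) (rh1_comp_abs hd hc1 hw hw1) := H1R.ext (funext fun x => by simp)
  have hi : Integrable fun x => r |x| * g.val x := hrm.integrable_mul g.rh1.memLp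
  rw [bil_eq_half, hrefl, val_mk, h.halfForm_even c hd hd1 hc2 hw hw1 hw2 g.rh1,
    h.halfForm_even c hd hd1 hc2 hw hw1 hw2 g.refl.rh1, hrobin, integral_eq_half_add_half hi]
  simp only [hr, zero_mul, sub_zero, refl_val, abs_neg]
  congr 1 <;> refine setIntegral_congr_fun measurableSet_Ioi fun x hx => ?_ <;>
    simp only [abs_of_pos (show (0 : ℝ) < x from hx)]

theorem robin_sol : sol' p ω γ 0 + γ / 2 * sol p ω γ 0 = 0 := by rw [h.sol'_zero]; ring

theorem bil_one_groundState (g : H1R) : h.bil 1 h.groundState g = 0 := by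
  refine (h.bil_even (r := fun _ => 0) 1 h.hasDerivAt_sol h.hasDerivAt_sol' h.continuous_sol'
    h.continuous_sol'' (h.memLp_sol le_rfl) (h.memLp_sol' le_rfl) (h.memLp_sol'' le_rfl)
    h.robin_sol (fun x => by rw [sol'']; ring) MemLp.zero g).trans (by simp)

theorem bil_p_groundState (g : H1R) :
    h.bil p h.groundState g = -(p - 1) * h.kform h.groundState g := by
  have h1 : h.bil p h.groundState g = h.bil 1 h.groundState g - (p - 1) * h.kform h.groundState g := by
    rw [bil_eq, bil_eq]; ring
  rw [h1, bil_one_groundState]; ring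

/-! ### Positivity and kernel of the form of L⁻ -/

theorem bil_one_nonneg (f : H1R) : 0 ≤ h.bil 1 f f := by
  rw [bil_eq_half]
  exact add_nonneg (h.halfForm_one_nonneg f.rh1).1 (h.halfForm_one_nonneg f.refl.rh1).1

theorem eq_smul_of_bil_one_eq_zero {f : H1R} (hf : h.bil 1 f f = 0) :
    ∃ c : ℝ, f = c • h.groundState := by
  have h1 := h.halfForm_one_nonneg f.rh1
  have h2 := h.halfForm_one_nonneg f.refl.rh1
  rw [bil_eq_half] at hf
  have h3 := h1.2 (by linarith [h1.1, h2.1])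
  have h4 := h2.2 (by linarith [h1.1, h2.1])
  refine ⟨f.val 0 / sol p ω γ 0, H1R.ext (funext fun x => ?_)⟩
  simp only [val_smul, Pi.smul_apply, smul_eq_mul, groundState, val_mk]
  rcases le_total 0 x with hx | hx
  · rw [abs_of_nonneg hx, h3 x hx]
  · have := h4 (-x) (by linarith)
    simp only [refl_val, neg_neg, neg_zero] at this
    rw [abs_of_nonpos hx, this]

theorem bil_one_pos {f : H1R} (hf : f ≠ 0) (horth : lform f h.groundState = 0) :
    0 < h.bil 1 f f := by
  refine lt_of_le_of_ne (h.bil_one_nonneg f) fun h0 => hf ?_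
  obtain ⟨c, rfl⟩ := h.eq_smul_of_bil_one_eq_zero h0.symm
  simp only [map_smul, smul_apply, smul_eq_mul] at horth
  have := h.lform_groundState_pos.ne'
  rw [(mul_eq_zero.1 horth).resolve_right this, zero_smul]

end Params

/-! ### The derivative of the ground state with respect to the frequency -/

section Scaling

variable (p ω γ : ℝ)

/-- The translation parameter in `∂_ω Q`. -/
def shift : ℝ := -γ / ((p - 1) * (ω - γ ^ 2 / 4))

/-- `∂_ω Q` on the right half-line. -/
def scal (x : ℝ) : ℝ := 1 / (2 * ω) * (2 / (p - 1) * sol p ω γ x + (x + shift p ω γ) * sol' p ω γ x)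

/-- The first derivative of `scal`. -/
def scal' (x : ℝ) : ℝ := 1 / (2 * ω) * (2 / (p - 1) * sol' p ω γ x +
  (1 * sol' p ω γ x + (x + shift p ω γ) * sol'' p ω γ x))

/-- The second derivative of `scal`. -/
def scal'' (x : ℝ) : ℝ := 1 / (2 * ω) * (2 / (p - 1) * sol'' p ω γ x +
  (1 * sol'' p ω γ x + (1 * sol'' p ω γ x + (x + shift p ω γ) *
    ((ω - p * pot p ω γ x) * sol' p ω γ x))))

end Scaling

namespace Params

variable {p ω γ : ℝ} (h : Params p ω γ)
include h

theorem hasDerivAt_scal (x : ℝ) : HasDerivAt (scal p ω γ) (scal' p ω γ x) x :=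
  (((h.hasDerivAt_sol x).const_mul _).add
    (((hasDerivAt_id x).add_const _).mul (h.hasDerivAt_sol' x))).const_mul _

theorem hasDerivAt_scal' (x : ℝ) : HasDerivAt (scal' p ω γ) (scal'' p ω γ x) x :=
  (((h.hasDerivAt_sol' x).const_mul _).add (((h.hasDerivAt_sol' x).const_mul _).add
    (((hasDerivAt_id x).add_const _).mul (h.hasDerivAt_sol'' x)))).const_mul _

theorem continuous_sol''' : Continuous fun x => (ω - p * pot p ω γ x) * sol' p ω γ x :=
  (continuous_const.sub (continuous_const.mul continuous_pot)).mul h.continuous_sol'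

theorem continuous_scal' : Continuous (scal' p ω γ) := by
  have := h.continuous_sol'; have := h.continuous_sol''
  unfold scal'; fun_prop

theorem continuous_scal'' : Continuous (scal'' p ω γ) := by
  have := h.continuous_sol''; have := h.continuous_sol'''
  unfold scal''; fun_prop

theorem memLp_affine_mul {g : ℝ → ℝ} (hg : Continuous g) {C a : ℝ}
    (hb : ∀ x, |g x| ≤ C * sol p ω γ x) :
    MemLp (fun x => (x + a) * g x) 2 (volume.restrict (Ioi 0)) := by
  refine h.memLp_of_abs_le_sol (C := (1 + |a|) * C) (by fun_prop) le_rfl fun x hx => ?_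
  have h1 : |x + a| ≤ (1 + |a|) * (1 + x) := by
    refine (abs_add_le _ _).trans ?_
    rw [abs_of_nonneg hx]
    nlinarith [abs_nonneg a]
  have h2 := hb x
  rw [abs_mul]
  calc |x + a| * |g x| ≤ ((1 + |a|) * (1 + x)) * (C * sol p ω γ x) := by gcongr
    _ = _ := by ring

theorem abs_sol'''_le (x : ℝ) : |(ω - p * pot p ω γ x) * sol' p ω γ x| ≤
    ((ω + |p| * ((p + 1) * ω / 2)) * Real.sqrt ω) * sol p ω γ x := by
  rw [abs_mul, mul_assoc]
  exact mul_le_mul (h.abs_q_le p x) (h.abs_sol'_le x) (abs_nonneg _)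
    ((abs_nonneg _).trans (h.abs_q_le p x))

theorem memLp_affine_sol (a : ℝ) : MemLp (fun x => (x + a) * sol p ω γ x) 2
    (volume.restrict (Ioi 0)) :=
  h.memLp_affine_mul h.continuous_sol (C := 1) fun x => by
    rw [abs_of_pos (h.sol_pos x), one_mul]

theorem memLp_affine_sol' (a : ℝ) : MemLp (fun x => (x + a) * sol' p ω γ x) 2
    (volume.restrict (Ioi 0)) :=
  h.memLp_affine_mul h.continuous_sol' h.abs_sol'_le

theorem memLp_scal : MemLp (scal p ω γ) 2 (volume.restrict (Ioi 0)) :=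
  (((h.memLp_sol le_rfl).const_mul _).add (h.memLp_affine_sol' _)).const_mul _

theorem memLp_scal' : MemLp (scal' p ω γ) 2 (volume.restrict (Ioi 0)) :=
  (((h.memLp_sol' le_rfl).const_mul _).add (((h.memLp_sol' le_rfl).const_mul _).add
    (h.memLp_affine_mul h.continuous_sol'' h.abs_sol''_le))).const_mul _

theorem memLp_scal'' : MemLp (scal'' p ω γ) 2 (volume.restrict (Ioi 0)) :=
  (((h.memLp_sol'' le_rfl).const_mul _).add (((h.memLp_sol'' le_rfl).const_mul _).add
    (((h.memLp_sol'' le_rfl).const_mul _).add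
      (h.memLp_affine_mul h.continuous_sol''' h.abs_sol'''_le)))).const_mul _

theorem shift_pos : 0 < shift p ω γ := by
  have := h.hp; have := h.hω; have := h.hγ
  exact div_pos (by linarith) (mul_pos (by linarith) (by linarith))

/-- The scaling part 2Q/(p-1) + xQ' alone violates the boundary condition; `shift` is the multiple
of Q' that repairs it. -/
theorem robin_scal : scal' p ω γ 0 + γ / 2 * scal p ω γ 0 = 0 := by
  have hp : p - 1 ≠ 0 := by have := h.hp; linarith
  have hω := h.ω_pos.ne'
  have hd : ω - γ ^ 2 / 4 ≠ 0 := by have := h.hω; linarith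
  have hτ : shift p ω γ * ((p - 1) * (ω - γ ^ 2 / 4)) = -γ :=
    div_mul_cancel₀ _ (mul_ne_zero hp hd)
  rw [scal, scal', sol'', h.sol'_zero, h.pot_zero]
  field_simp
  linear_combination (-8 * (p - 1) * sol p ω γ 0) * hτ

/-- On the half-line, 2Q/(p-1) contributes -2VQ and xQ' contributes -2Q'' = -2(ω-V)Q, while L⁺Q' =
0. The sum -2ωQ is normalised by the factor 1/(2ω). -/
theorem scal_eq (x : ℝ) :
    -scal'' p ω γ x + (ω - p * pot p ω γ x) * scal p ω γ x = -sol p ω γ x := by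
  have hp : p - 1 ≠ 0 := by have := h.hp; linarith
  have hω := h.ω_pos.ne'
  rw [scal, scal'', sol'']
  field_simp
  ring

/-- `∂_ω Q` as an element of `H¹`. -/
def freqDeriv : H1R := H1R.mk (fun x => scal p ω γ |x|)
  (rh1_comp_abs h.hasDerivAt_scal h.continuous_scal' h.memLp_scal h.memLp_scal')

theorem freqDeriv_parity : HasParity 1 h.freqDeriv := fun x => by simp [freqDeriv]

theorem bil_p_freqDeriv (g : H1R) : h.bil p h.freqDeriv g = -lform h.groundState g := by
  refine (h.bil_even (r := fun x => -sol p ω γ x) p h.hasDerivAt_scal h.hasDerivAt_scal'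
    h.continuous_scal' h.continuous_scal'' h.memLp_scal h.memLp_scal' h.memLp_scal''
    h.robin_scal h.scal_eq h.groundState.rh1.memLp.neg g).trans ?_
  simp only [neg_mul, integral_neg, lform_apply]
  rfl

/-- Integration by parts gives ∫(x+τ)Q'Q = -½∫Q² - ½τQ(0)² on the half-line. The sign is thus
decided by 2/(p-1) < 1/2, that is p > 5, and the boundary term helps because γ < 0 makes τ positive.
-/
theorem lform_freqDeriv_neg : lform h.freqDeriv h.groundState < 0 := by
  have hp := h.hp
  have hω := h.ω_pos
  set τ := shift p ω γ with hτ
  have hd : deriv (fun x => (x + τ) * sol p ω γ x) =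
      fun x => 1 * sol p ω γ x + (x + τ) * sol' p ω γ x :=
    funext fun x => (((hasDerivAt_id x).add_const τ).mul (h.hasDerivAt_sol x)).deriv
  have hd' : deriv (sol p ω γ) = sol' p ω γ := funext fun x => (h.hasDerivAt_sol x).deriv
  have hm1 : MemLp (fun x => 1 * sol p ω γ x + (x + τ) * sol' p ω γ x) 2
      (volume.restrict (Ioi 0)) := ((h.memLp_sol le_rfl).const_mul 1).add (h.memLp_affine_sol' τ)
  have hc1 : Continuous fun x => 1 * sol p ω γ x + (x + τ) * sol' p ω γ x := by
    have := h.continuous_sol; have := h.continuous_sol'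
    fun_prop
  have H1 : HL 0 fun x => (x + τ) * sol p ω γ x := ⟨h.memLp_affine_sol τ, by rwa [hd],
    fun b _ => ac_of_hasDerivAt
      (fun x _ => ((hasDerivAt_id x).add_const τ).mul (h.hasDerivAt_sol x)) hc1.continuousOn⟩
  have H2 : HL 0 (sol p ω γ) := ⟨h.memLp_sol le_rfl, by rw [hd']; exact h.memLp_sol' le_rfl,
    fun b _ => ac_of_hasDerivAt (fun x _ => h.hasDerivAt_sol x) h.continuous_sol'.continuousOn⟩
  have hi1 : IntegrableOn (fun x => sol p ω γ x * sol p ω γ x) (Ioi 0) :=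
    (h.memLp_sol le_rfl).integrable_mul (h.memLp_sol le_rfl)
  have hi2 : IntegrableOn (fun x => (x + τ) * sol' p ω γ x * sol p ω γ x) (Ioi 0) :=
    (h.memLp_affine_sol' τ).integrable_mul (h.memLp_sol le_rfl)
  have hibp := H1.integral_by_parts H2
  rw [hd, hd'] at hibp
  have e1 : ∫ x in Ioi 0, (1 * sol p ω γ x + (x + τ) * sol' p ω γ x) * sol p ω γ x =
      (∫ x in Ioi 0, sol p ω γ x * sol p ω γ x) +
        ∫ x in Ioi 0, (x + τ) * sol' p ω γ x * sol p ω γ x := by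
    rw [← integral_add hi1 hi2]; congr 1; funext x; ring
  have e2 : ∫ x in Ioi 0, (x + τ) * sol p ω γ x * sol' p ω γ x =
      ∫ x in Ioi 0, (x + τ) * sol' p ω γ x * sol p ω γ x := by
    congr 1; funext x; ring
  rw [e1, e2, zero_add] at hibp
  have hI : 0 < ∫ x in Ioi 0, sol p ω γ x * sol p ω γ x := by
    rw [setIntegral_pos_iff_support_of_nonneg_ae (Eventually.of_forall fun x => mul_self_nonneg _) hi1]
    have : Function.support (fun x => sol p ω γ x * sol p ω γ x) = univ := by
      ext x
      have := (h.sol_pos x).ne'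
      simp [this]
    rw [this]
    simp
  have hfull : lform h.freqDeriv h.groundState = 2 * ∫ x in Ioi 0, scal p ω γ x * sol p ω γ x := by
    have hi : Integrable fun x => h.freqDeriv.val x * h.groundState.val x :=
      h.freqDeriv.rh1.memLp.integrable_mul h.groundState.rh1.memLp
    rw [lform_apply, integral_eq_half_add_half hi, two_mul]
    congr 1 <;> refine setIntegral_congr_fun measurableSet_Ioi fun x hx => ?_ <;>
      simp only [freqDeriv, groundState, val_mk, abs_neg, abs_of_pos (show (0 : ℝ) < x from hx)]
  have e3 : ∫ x in Ioi 0, scal p ω γ x * sol p ω γ x =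
      1 / (2 * ω) * (2 / (p - 1) * (∫ x in Ioi 0, sol p ω γ x * sol p ω γ x) +
        ∫ x in Ioi 0, (x + τ) * sol' p ω γ x * sol p ω γ x) := by
    rw [← integral_const_mul, ← integral_add (hi1.const_mul _) hi2, ← integral_const_mul]
    congr 1; funext x; rw [scal]; ring
  rw [hfull, e3]
  have h1 : 0 ≤ τ * sol p ω γ 0 * sol p ω γ 0 := by
    have := h.shift_pos; have := h.sol_pos 0
    positivity
  have h2 : 2 / (p - 1) < 1 / 2 := by
    rw [div_lt_div_iff₀ (by linarith) (by norm_num)]; linarith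
  have h3 := mul_lt_mul_of_pos_right h2 hI
  have h4 : 0 < 1 / (2 * ω) := by positivity
  have h5 : 2 / (p - 1) * (∫ x in Ioi 0, sol p ω γ x * sol p ω γ x) +
        ∫ x in Ioi 0, (x + τ) * sol' p ω γ x * sol p ω γ x < 0 := by linarith
  have := mul_neg_of_pos_of_neg h4 h5
  linarith

/-! ### Negative directions of L⁺ orthogonal to the ground state -/

theorem exists_even_negative : ∃ u : H1R, HasParity 1 u ∧ lform u h.groundState = 0 ∧
    h.bil p u u < 0 := by
  have hR := h.lform_freqDeriv_neg
  have hQ := h.lform_groundState_pos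
  set lR := lform h.freqDeriv h.groundState with hlR
  set lQ := lform h.groundState h.groundState with hlQ
  -- With R = ∂_ωQ, this `α` makes Q + αR orthogonal to Q. Since L⁺R = -Q, the energy of Q + αR is
  -- B⁺(Q,Q) - α⟨Q,Q⟩, and both terms pull downwards.
  set α := -lQ / lR with hα
  have hαpos : 0 < α := div_pos_of_neg_of_neg (by linarith) hR
  have hαR : α * lR = -lQ := div_mul_cancel₀ _ hR.ne
  refine ⟨h.groundState + α • h.freqDeriv, h.groundState_parity.add (h.freqDeriv_parity.smul α),
    ?_, ?_⟩
  · simp only [map_add, map_smul, add_apply, smul_apply, smul_eq_mul, ← hlR, ← hlQ]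
    linarith
  · have hk := h.kform_nonneg h.groundState
    have hp := h.hp
    simp only [map_add, map_smul, add_apply, smul_apply, smul_eq_mul, h.bil_p_groundState]
    rw [← h.bil_p_groundState h.freqDeriv, h.bil_symm p h.groundState, h.bil_p_freqDeriv,
      h.bil_p_freqDeriv, lform_symm h.groundState h.freqDeriv, ← hlR, ← hlQ]
    have : α * (α * -lR) = α * lQ := by rw [mul_neg, hαR, neg_neg]
    have h1 : 0 ≤ (p - 1) * h.kform h.groundState h.groundState := mul_nonneg (by linarith) hk
    have h2 : 0 < α * lQ := mul_pos hαpos hQ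
    linarith

/-- The odd extension φ of Q' restricted to the region beyond the peak has zero energy but is not in
the kernel, as pairing with an odd χ nonzero at the peak shows. A small step along χ therefore makes
the energy negative; orthogonality to Q is automatic by parity. -/
theorem exists_odd_negative : ∃ u : H1R, HasParity (-1) u ∧ lform u h.groundState = 0 ∧
    h.bil p u u < 0 := by
  have hpk := h.peak_pos
  set x0 := peak p ω γ with hx0
  let φ₀ : H1R := H1R.mk (fun x => sol' p ω γ (max x x0)) (rh1_comp_max h.hasDerivAt_sol'
    h.continuous_sol'' h.sol'_peak (h.memLp_sol' hpk.le) (h.memLp_sol'' hpk.le))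
  have hdχ : ∀ x, HasDerivAt (fun x => (x + 0) * sol p ω γ x)
      (1 * sol p ω γ x + (x + 0) * sol' p ω γ x) x :=
    fun x => ((hasDerivAt_id x).add_const 0).mul (h.hasDerivAt_sol x)
  let χ₀ : H1R := H1R.mk (fun x => (max x 0 + 0) * sol p ω γ (max x 0)) (rh1_comp_max hdχ
    (by have := h.continuous_sol; have := h.continuous_sol'; fun_prop) (by simp)
    (h.memLp_affine_sol 0) (((h.memLp_sol le_rfl).const_mul 1).add (h.memLp_affine_sol' 0)))
  have hodd : ∀ f : H1R, HasParity (-1) (f - f.refl) := fun f x => by simp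
  set φ := φ₀ - φ₀.refl
  set χ := χ₀ - χ₀.refl
  have hφ : ∀ x, 0 ≤ x → φ.val x = 1 * sol' p ω γ (max x x0) := fun x hx => by
    have : max (-x) x0 = x0 := max_eq_right (by linarith)
    simp [φ, φ₀, this, x0, h.sol'_peak]
  have hχ : χ.val x0 = x0 * sol p ω γ x0 := by
    simp [χ, χ₀, hpk.le]
  have hσ : (-1 : ℝ) ^ 2 = 1 := by norm_num
  have h1 : h.bil p φ φ = 0 := by
    rw [h.bil_of_parity p hσ (hodd _) (hodd _), h.halfForm_truncated hφ φ.rh1 φ.rh1,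
      hφ _ hpk.le, max_self, h.sol'_peak]
    ring
  have h2 : h.bil p φ χ ≠ 0 := by
    rw [h.bil_of_parity p hσ (hodd _) (hodd _), h.halfForm_truncated hφ φ.rh1 χ.rh1, hχ]
    have := h.sol''_peak_neg.ne
    have := (h.sol_pos x0).ne'
    have := hpk.ne'
    simp only [← hx0]
    positivity
  have h3 : ∀ t : ℝ, h.bil p (φ + t • χ) (φ + t • χ) =
      2 * t * h.bil p φ χ + t ^ 2 * h.bil p χ χ := fun t => by
    simp only [map_add, map_smul, add_apply, smul_apply, smul_eq_mul, h1, h.bil_symm p χ φ]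
    ring
  set b := h.bil p φ χ
  set k := h.bil p χ χ
  have hk1 : 0 < |k| + 1 := by positivity
  -- The energy along χ is 2tb + t²k; dividing by |k| + 1 keeps the quadratic term below the linear
  -- one.
  refine ⟨φ + (-b / (|k| + 1)) • χ, (hodd _).add ((hodd _).smul _), ?_, ?_⟩
  · rw [lform_symm]
    exact h.groundState_parity.form_eq_zero lform_refl ((hodd _).add ((hodd _).smul _))
  · rw [h3]
    have h4 : 2 * (-b / (|k| + 1)) * b + (-b / (|k| + 1)) ^ 2 * k =
        -(b ^ 2 * (2 * (|k| + 1) - k)) / (|k| + 1) ^ 2 := by field_simp; ring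
    rw [h4]
    have h5 : 0 < 2 * (|k| + 1) - k := by linarith [le_abs_self k, abs_nonneg k]
    exact div_neg_of_neg_of_pos (by have : 0 < b ^ 2 := by positivity
                                    nlinarith) (by positivity)

/-! ### Existence of eigenfunctions in the weak sense -/

omit h in
/-- The weak form of `L⁻ v = y u`, `L⁺ u = -y v`. -/
structure WeakPair (h : Params p ω γ) (y : ℝ) (u v : H1R) : Prop where
  minus : ∀ g, h.bil 1 v g = y * lform u g
  plus : ∀ g, h.bil p u g = -y * lform v g

/-- Functions of parity `σ` orthogonal to the ground state. -/
def sector (σ : ℝ) : Submodule ℝ H1R where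
  carrier := {f | HasParity σ f ∧ lform f h.groundState = 0}
  add_mem' hf hg := ⟨hf.1.add hg.1, by simp [hf.2, hg.2]⟩
  zero_mem' := ⟨fun x => by simp, by simp⟩
  smul_mem' c f hf := ⟨hf.1.smul c, by simp [hf.2]⟩

theorem isClosed_sector (σ : ℝ) : IsClosed (h.sector σ : Set H1R) := by
  have : (h.sector σ : Set H1R) =
      (⋂ x : ℝ, {f : H1R | ev (-x) f = σ * ev x f}) ∩ {f | lform f h.groundState = 0} := by
    ext f
    simp [sector, HasParity]
  rw [this]
  refine (isClosed_iInter fun x => isClosed_eq (by fun_prop) (by fun_prop)).inter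
    (isClosed_eq (by fun_prop) continuous_const)

/-- On the sector orthogonal to Q the form B⁻ is coercive, so `exists_eigenpair` applies there.
Testing against all of H¹ then restores the other parity, which contributes nothing, and the
direction Q, which produces a Lagrange multiplier. -/
theorem exists_weakPair {σ : ℝ} (hσ : σ = 1 ∨ σ = -1) {u₀ : H1R} (hu₀ : HasParity σ u₀)
    (hu₀Q : lform u₀ h.groundState = 0) (hneg : h.bil p u₀ u₀ < 0) :
    ∃ (y : ℝ) (u v : H1R), 0 < y ∧ u ≠ 0 ∧ HasParity σ u ∧ HasParity σ v ∧ h.WeakPair y u v := by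
  have hp := h.hp
  have hω := h.ω_pos
  have hσ2 : σ ^ 2 = 1 := by rcases hσ with rfl | rfl <;> norm_num
  have hQ := h.lform_groundState_pos
  set X := h.sector σ with hX
  have : CompleteSpace X := (h.isClosed_sector σ).completeSpace_coe
  have : SecondCountableTopology H1R := UniformSpace.secondCountable_of_separable H1R
  let res : (H1R →L[ℝ] H1R →L[ℝ] ℝ) → (X →L[ℝ] X →L[ℝ] ℝ) :=
    fun b => b.bilinearComp X.subtypeL X.subtypeL
  have hres : ∀ b (u w : X), res b u w = b (u : H1R) (w : H1R) := fun b u w => rfl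
  obtain ⟨c₀, hc₀, hdc⟩ := h.dform_coercive
  have hd : ∀ u : X, c₀ * ‖u‖ ^ 2 ≤ res (dform ω γ) u u := fun u => hdc u
  have hds : ∀ u v, res (dform ω γ) u v = res (dform ω γ) v u := fun u v => dform_symm _ _ _ _
  obtain ⟨c₁, hc₁, hbm⟩ := coercive_of_pos (ι := Empty) (res (dform ω γ)) hds hc₀ hd
    (fun u : X => 1 * h.kform (X.subtypeL u) (X.subtypeL u)) (h.weakSeqCont_kform_comp X.subtypeL 1)
    (fun a u => by simp only [map_smul, smul_apply, smul_eq_mul]; ring) (fun j => j.elim)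
    (fun u hu _ => by
      have h1 : (u : H1R) ≠ 0 := fun h0 => hu (Subtype.ext h0)
      have h2 := h.bil_one_pos h1 u.2.2
      rw [bil_eq] at h2
      exact sub_pos.1 h2)
  have hbm' : ∀ u : X, c₁ * ‖u‖ ^ 2 ≤ res (h.bil 1) u u := fun u => by
    have := hbm u
    simpa [hres, h.bil_eq] using this
  have hk := h.weakSeqCont_kform_comp X.subtypeL p
  obtain ⟨m, u, s, hm, hu, hs, hus⟩ := exists_eigenpair (res (h.bil 1)) (res lform)
    (res (dform ω γ)) (res (p • h.kform)) (fun u v => h.bil_symm _ _ _)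
    (fun u v => lform_symm _ _) hds
    (fun u v => by simp only [hres, smul_apply, h.kform_symm u.1 v.1]) hc₁ hbm' hc₀ hd hk
    (C := p * ((p + 1) * ω / 2)) (by positivity)
    (fun u => by
      have := h.kform_le u.1
      simp only [hres, smul_apply, smul_eq_mul, mul_assoc] at this ⊢
      gcongr)
    (u₀ := ⟨u₀, hu₀, hu₀Q⟩) (by
      rw [bil_eq] at hneg
      exact sub_neg.1 hneg)
  have hupar := u.2.1
  have hspar := s.2.1
  have huQ := u.2.2
  have hsQ := s.2.2
  -- projection of an arbitrary test function
  have hproj : ∀ g : H1R, ∃ (a : ℝ) (g' : X), part σ g = g'.1 + a • h.groundState ∧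
      a * lform h.groundState h.groundState = lform (part σ g) h.groundState ∧ (a = 0 ∨ σ = 1) := by
    intro g
    set a := lform (part σ g) h.groundState / lform h.groundState h.groundState with ha
    have ha' : a * lform h.groundState h.groundState = lform (part σ g) h.groundState :=
      div_mul_cancel₀ _ hQ.ne'
    have hor : a = 0 ∨ σ = 1 := by
      rcases hσ with h1 | h1
      · exact Or.inr h1
      · left
        rw [ha, lform_symm, h.groundState_parity.form_eq_zero lform_refl, zero_div]
        rw [← h1]; exact hasParity_part hσ2 g
    have hpar : HasParity σ (a • h.groundState) := by
      rcases hor with h1 | h1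
      · rw [h1, zero_smul]; intro x; simp
      · rw [h1]; exact h.groundState_parity.smul a
    refine ⟨a, ⟨part σ g - a • h.groundState, (hasParity_part hσ2 g).sub hpar, ?_⟩, by simp, ha', hor⟩
    simp only [map_sub, map_smul, sub_apply, smul_apply, smul_eq_mul]
    linarith
  set b := h.bil p u.1 h.groundState with hb
  have hb0 : b = 0 ∨ σ = 1 := by
    rcases hσ with h1 | h1
    · exact Or.inr h1
    · left
      rw [hb, h.bil_symm]
      exact h.groundState_parity.form_eq_zero (h.bil_refl p) (h1 ▸ hupar)
  have hminus : ∀ g, h.bil 1 s.1 g = lform u.1 g := fun g => by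
    obtain ⟨a, g', hg, -, -⟩ := hproj g
    rw [← hspar.form_part (h.bil_refl 1) hσ2 g, ← hupar.form_part lform_refl hσ2 g, hg]
    simp only [map_add, map_smul, smul_eq_mul, huQ, h.bil_symm 1 s.1 h.groundState,
      h.bil_one_groundState, mul_zero, add_zero]
    exact hs g'
  -- The Lagrange multiplier of the constraint of orthogonality to Q; it vanishes for odd functions.
  set c := b / lform h.groundState h.groundState with hc
  have hplus : ∀ g, h.bil p u.1 g = -m * lform s.1 g + c * lform h.groundState g := fun g => by
    obtain ⟨a, g', hg, ha, -⟩ := hproj g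
    have h1 : c * lform h.groundState g = c * lform h.groundState (part σ g) := by
      rcases hb0 with h0 | h0
      · rw [hc, h0, zero_div, zero_mul, zero_mul]
      · rw [(h0 ▸ h.groundState_parity : HasParity σ h.groundState).form_part lform_refl hσ2 g]
    have h2 : c * lform h.groundState (part σ g) = a * b := by
      rw [lform_symm, ← ha, hc]; field_simp
    rw [h1, h2, ← hupar.form_part (h.bil_refl p) hσ2 g, ← hspar.form_part lform_refl hσ2 g, hg]
    simp only [map_add, map_smul, smul_eq_mul, hsQ, mul_zero, add_zero, ← hb]
    have h3 : h.bil p u.1 g'.1 = -m * lform s.1 g'.1 := hus g'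
    rw [h3]
  have hy : 0 < Real.sqrt m := Real.sqrt_pos.2 hm
  have hyy : Real.sqrt m * Real.sqrt m = m := Real.mul_self_sqrt hm.le
  -- From L⁻s = u and L⁺u = -ms + cQ: scaling by √m makes the two eigenvalue factors equal, and the
  -- multiple of Q absorbs the multiplier without affecting the first equation, because L⁻Q = 0.
  refine ⟨Real.sqrt m, u.1, Real.sqrt m • s.1 - (c / Real.sqrt m) • h.groundState, hy,
    fun h0 => hu (Subtype.ext h0), hupar, ?_, ⟨fun g => ?_, fun g => ?_⟩⟩
  · refine (hspar.smul _).sub ?_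
    rcases hb0 with h1 | h1
    · rw [hc, h1]; intro x; simp
    · rw [h1]; exact h.groundState_parity.smul _
  · simp only [map_sub, map_smul, sub_apply, smul_apply, smul_eq_mul, hminus,
      h.bil_one_groundState, mul_zero, sub_zero]
  · rw [hplus]
    simp only [map_sub, map_smul, sub_apply, smul_apply, smul_eq_mul]
    field_simp
    linear_combination (lform s.1 g) * (by rw [pow_two]; exact hyy : Real.sqrt m ^ 2 = m)

end Params
end DeltaNLS
end

open MeasureTheory Filter Topology ComplexConjugate
noncomputable section
namespace DeltaNLS
open Set

/-! ### Weak solutions of equations with a point interaction -/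

/-- The real version of `MemDomain`. -/
structure RealDomain (γ : ℝ) (f : ℝ → ℝ) : Prop where
  rh1 : RH1 f
  differentiableAt : ∀ x : ℝ, x ≠ 0 → DifferentiableAt ℝ f x
  deriv_sub_deriv : ∀ a b : ℝ, 0 < a * b →
    deriv f b - deriv f a = ∫ t in a..b, deriv (deriv f) t
  memLp_deriv_deriv : MemLp (deriv (deriv f)) 2 volume
  jump : ∃ dr dl : ℝ, Tendsto (deriv f) (𝓝[>] 0) (𝓝 dr) ∧ Tendsto (deriv f) (𝓝[<] 0) (𝓝 dl) ∧
    dr - dl = -γ * f 0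

theorem intervalIntegrable_of_memLp_two {F : ℝ → ℝ} (hF : MemLp F 2 volume) (a b : ℝ) :
    IntervalIntegrable F volume a b :=
  intervalIntegrable_iff.mpr (((hF.locallyIntegrable (by norm_num)).integrableOn_isCompact
    isCompact_uIcc).mono_set uIoc_subset_uIcc)

theorem continuous_primitive_of_memLp_two {F : ℝ → ℝ} (hF : MemLp F 2 volume) :
    Continuous fun x => ∫ t in (0 : ℝ)..x, F t :=
  intervalIntegral.continuous_primitive (intervalIntegrable_of_memLp_two hF) 0

section DuBoisReymond

variable {f F : ℝ → ℝ} {κ : ℝ}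

/-- Du Bois-Reymond's argument: the test function is the primitive of k₀, the deviation of f' + H +
J from its mean, and the weak equation turns into ∫k₀² = 0. The jump J encodes the point mass at the
origin. -/
theorem deriv_eq_on_of_weak (hf : RH1 f) (hF : MemLp F 2 volume)
    (hw : ∀ g, RH1 g → ∫ x, deriv f x * deriv g x = κ * g 0 + ∫ x, F x * g x)
    {M : ℝ} (hM : 0 < M) :
    ∃ m, ∀ᵐ x, x ∈ Ioc (-M) M →
      deriv f x = m - ((∫ t in (0 : ℝ)..x, F t) + (Ioi 0).indicator (fun _ => κ) x) := by
  set H : ℝ → ℝ := fun x => ∫ t in (0 : ℝ)..x, F t with hH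
  set J : ℝ → ℝ := (Ioi 0).indicator (fun _ => κ) with hJ
  have hHc : Continuous H := continuous_primitive_of_memLp_two hF
  set I := Ioc (-M) M with hI
  have hIm : MeasurableSet I := measurableSet_Ioc
  have hIfin : IsFiniteMeasure (volume.restrict I) := ⟨by simp [hI]⟩
  have hJI : MemLp J 2 (volume.restrict I) := (memLp_const κ).indicator measurableSet_Ioi
  have hHI : MemLp H 2 (volume.restrict I) := by
    obtain ⟨C, hC⟩ := (isCompact_Icc (a := -M) (b := M)).exists_bound_of_continuousOn
      hHc.continuousOn
    refine MemLp.of_bound hHc.aestronglyMeasurable C ?_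
    rw [ae_restrict_iff' hIm]
    exact Eventually.of_forall fun x hx => hC x (Ioc_subset_Icc_self hx)
  have hDI : MemLp (fun x => deriv f x + (H x + J x)) 2 (volume.restrict I) :=
    (hf.memLp_deriv.restrict I).add (hHI.add hJI)
  -- Subtracting the mean makes the primitive vanish at both ends of `I`, so that it is a compactly
  -- supported H¹ test function.
  set m := (∫ x in I, (deriv f x + (H x + J x))) / (2 * M) with hm
  set k₀ : ℝ → ℝ := fun x => deriv f x + (H x + J x) - m with hk₀
  have hkI : MemLp k₀ 2 (volume.restrict I) := hDI.sub (memLp_const m)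
  set k := I.indicator k₀ with hk
  have hkL : MemLp k 2 volume := (memLp_indicator_iff_restrict hIm).2 hkI
  have hkint : ∫ x in I, k₀ x = 0 := by
    rw [hk₀, integral_sub (hDI.integrable (by norm_num)) (integrable_const m)]
    simp only [integral_const, measureReal_restrict_apply_univ, hI, Real.volume_real_Ioc,
      smul_eq_mul, hm]
    rw [max_eq_left (by linarith)]
    field_simp
    ring
  have hki := intervalIntegrable_of_memLp_two hkL
  set g : ℝ → ℝ := fun x => ∫ t in (-M)..x, k t with hg
  have hgl : ∀ x, x ≤ -M → g x = 0 := fun x hx => by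
    rw [hg]
    refine intervalIntegral.integral_zero_ae (Eventually.of_forall fun t ht => ?_)
    rw [uIoc_of_ge hx] at ht
    exact indicator_of_notMem (fun h => not_lt.2 ht.2 h.1) _
  have hgM : g M = 0 := by
    rw [hg]
    simp only
    rw [intervalIntegral.integral_of_le (by linarith), ← hI, hk, setIntegral_indicator hIm,
      inter_self, hkint]
  have hgr : ∀ x, M ≤ x → g x = 0 := fun x hx => by
    have h1 : ∫ t in M..x, k t = 0 := by
      refine intervalIntegral.integral_zero_ae (Eventually.of_forall fun t ht => ?_)
      rw [uIoc_of_le hx] at ht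
      exact indicator_of_notMem (fun h => not_lt.2 h.2 ht.1) _
    have h2 := intervalIntegral.integral_add_adjacent_intervals (hki (-M) M) (hki M x)
    rw [h1, add_zero] at h2
    exact h2.symm.trans hgM
  have hgc : Continuous g := intervalIntegral.continuous_primitive hki (-M)
  have hgs : HasCompactSupport g := by
    refine HasCompactSupport.intro (isCompact_Icc (a := -M) (b := M)) fun x hx => ?_
    rw [mem_Icc, not_and_or, not_le, not_le] at hx
    rcases hx with hx | hx
    · exact hgl x hx.le
    · exact hgr x hx.le
  obtain ⟨hg1, hgd⟩ := RH1.of_integral (hgc.memLp_of_hasCompactSupport hgs) hkL (fun x => by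
    rw [hg]
    exact (intervalIntegral.integral_add_adjacent_intervals (hki _ _) (hki _ _)).symm)
  have e1 : ∫ x, deriv f x * deriv g x = ∫ x in I, deriv f x * k₀ x := by
    rw [← integral_indicator hIm]
    refine integral_congr_ae ?_
    filter_upwards [hgd] with x hx
    rw [hx, hk, indicator_mul_right]
  have e2 : κ * g 0 = -∫ x in I, J x * k₀ x := by
    have h1 : ∫ x in I, J x * k₀ x = ∫ x in (0 : ℝ)..M, κ * k x := by
      rw [intervalIntegral.integral_of_le hM.le, ← integral_indicator hIm,
        ← integral_indicator measurableSet_Ioc]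
      congr 1
      funext x
      by_cases hx : x ∈ I
      · by_cases hx0 : 0 < x
        · have : x ∈ Ioc 0 M := ⟨hx0, hx.2⟩
          simp [hx, this, hk, hJ, hx0]
        · have : x ∉ Ioc 0 M := fun h => hx0 h.1
          rw [indicator_of_mem hx, indicator_of_notMem this]
          simp [hJ, hx0]
      · have : x ∉ Ioc 0 M := fun h => hx ⟨by linarith [h.1], h.2⟩
        rw [indicator_of_notMem hx, indicator_of_notMem this]
    have h2 := intervalIntegral.integral_add_adjacent_intervals (hki (-M) 0) (hki 0 M)
    have h3 : g 0 + ∫ t in (0 : ℝ)..M, k t = 0 := h2.trans hgM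
    rw [h1, intervalIntegral.integral_const_mul]
    linear_combination κ * h3
  have e3 : ∫ x, F x * g x = -∫ x in I, H x * k₀ x := by
    have hFg : ∫ x, F x * g x = ∫ x in I, F x * g x := by
      rw [setIntegral_eq_integral_of_forall_compl_eq_zero]
      intro x hx
      rw [hI, mem_Ioc, not_and_or, not_lt, not_le] at hx
      rcases hx with hx | hx
      · rw [hgl x hx, mul_zero]
      · rw [hgr x hx.le, mul_zero]
    have hHac : AbsolutelyContinuousOnInterval H (-M) M := by
      have h1 : AbsolutelyContinuousOnInterval (fun x => ∫ t in (-M)..x, F t) (-M) M :=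
        (intervalIntegrable_of_memLp_two hF _ _).absolutelyContinuousOnInterval_intervalIntegral
          (by simp)
      have h2 : H = fun x => H (-M) + ∫ t in (-M)..x, F t := by
        funext x
        exact (intervalIntegral.integral_add_adjacent_intervals
          (intervalIntegrable_of_memLp_two hF _ _) (intervalIntegrable_of_memLp_two hF _ _)).symm
      have h3 : AbsolutelyContinuousOnInterval (fun _ : ℝ => H (-M)) (-M) M :=
        (contDiff_const (n := 1)).contDiffOn.absolutelyContinuousOnInterval
      rw [h2]
      exact h3.fun_add h1
    have h4 := (hHac.fun_mul (hg1.ac (-M) M)).integral_deriv_eq_sub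
    rw [hgM, hgl _ le_rfl, mul_zero, mul_zero, sub_zero,
      intervalIntegral.integral_of_le (by linarith)] at h4
    have h5 : ∫ x in I, deriv (fun x => H x * g x) x = ∫ x in I, (F x * g x + H x * k₀ x) := by
      refine setIntegral_congr_ae hIm ?_
      filter_upwards [_root_.LocallyIntegrable.ae_hasDerivAt_integral
        (hF.locallyIntegrable (by norm_num)), hg1.ae_differentiableAt, hgd] with x h1 h2 h3 hx
      rw [((h1 0).fun_mul h2.hasDerivAt).deriv, h3, hk, indicator_of_mem hx]
    rw [h5, integral_add] at h4
    · rw [hFg]; linarith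
    · exact (hF.restrict I).integrable_mul (hg1.memLp.restrict I)
    · exact hHI.integrable_mul hkI
  have e4 := hw g hg1
  rw [e1, e2, e3] at e4
  have e5 : ∫ x in I, k₀ x * k₀ x = 0 := by
    have i1 : IntegrableOn (fun x => deriv f x * k₀ x) I :=
      (hf.memLp_deriv.restrict I).integrable_mul hkI
    have i2 : IntegrableOn (fun x => H x * k₀ x) I := hHI.integrable_mul hkI
    have i3 : IntegrableOn (fun x => J x * k₀ x) I := hJI.integrable_mul hkI
    have i4 : IntegrableOn (fun x => m * k₀ x) I := (hkI.integrable (by norm_num)).const_mul m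
    have : ∀ x, k₀ x * k₀ x = deriv f x * k₀ x + (H x * k₀ x + J x * k₀ x) - m * k₀ x :=
      fun x => by simp only [hk₀]; ring
    simp only [this]
    rw [integral_sub (f := fun x => deriv f x * k₀ x + (H x * k₀ x + J x * k₀ x)) (i1.add (i2.add i3)) i4, integral_add (g := fun x => H x * k₀ x + J x * k₀ x) i1
      (i2.add i3), integral_add i2 i3,
      integral_const_mul, hkint, e4]
    ring
  refine ⟨m, ?_⟩
  have hki2 : IntegrableOn (fun x => k₀ x * k₀ x) I := hkI.integrable_mul hkI
  have h0 := (integral_eq_zero_iff_of_nonneg (fun x => mul_self_nonneg (k₀ x)) hki2).1 e5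
  rw [Filter.EventuallyEq, ae_restrict_iff' hIm] at h0
  filter_upwards [h0] with x hx hxI
  have := mul_self_eq_zero.1 (hx hxI)
  simp only [hk₀] at this
  linarith

theorem deriv_eq_of_weak (hf : RH1 f) (hF : MemLp F 2 volume)
    (hw : ∀ g, RH1 g → ∫ x, deriv f x * deriv g x = κ * g 0 + ∫ x, F x * g x) :
    ∃ m, ∀ᵐ x,
      deriv f x = m - ((∫ t in (0 : ℝ)..x, F t) + (Ioi 0).indicator (fun _ => κ) x) := by
  choose m hm using fun n : ℕ => deriv_eq_on_of_weak hf hF hw (M := n + 1) (by positivity)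
  have hconst : ∀ n, m n = m 0 := fun n => by
    have h1 : ∀ᵐ x, x ∈ Ioc (0 : ℝ) 1 → m n = m 0 := by
      filter_upwards [hm n, hm 0] with x h1 h2 hx
      have h3 := h1 ⟨by linarith [hx.1, (Nat.cast_nonneg n : (0 : ℝ) ≤ n)],
        by linarith [hx.2, (Nat.cast_nonneg n : (0 : ℝ) ≤ n)]⟩
      have h4 := h2 ⟨by push_cast; linarith [hx.1], by push_cast; linarith [hx.2]⟩
      linarith
    by_contra hne
    simp only [hne, imp_false] at h1
    have h2 : volume (Ioc (0 : ℝ) 1) = 0 := by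
      rw [ae_iff] at h1
      simpa only [not_not, ofPred_mem_eq] using h1
    simp at h2
  refine ⟨m 0, ?_⟩
  filter_upwards [ae_all_iff.2 hm] with x hx
  obtain ⟨n, hn⟩ := exists_nat_ge |x|
  have h1 := abs_le.1 hn
  rw [← hconst n]
  exact hx n ⟨by linarith, by linarith⟩

/-- A weak solution of `-f'' = F` with a point interaction at the origin lies in the domain and
solves the equation almost everywhere. -/
theorem realDomain_of_weak {γ : ℝ} (hf : RH1 f) (hF : MemLp F 2 volume)
    (hw : ∀ g, RH1 g → ∫ x, deriv f x * deriv g x = γ * f 0 * g 0 + ∫ x, F x * g x) :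
    RealDomain γ f ∧ deriv (deriv f) =ᵐ[volume] fun x => -F x := by
  obtain ⟨m, hm⟩ := deriv_eq_of_weak hf hF hw
  set H : ℝ → ℝ := fun x => ∫ t in (0 : ℝ)..x, F t with hH
  set J : ℝ → ℝ := (Ioi 0).indicator (fun _ => γ * f 0) with hJ
  set D : ℝ → ℝ := fun x => m - (H x + J x) with hD
  have hHc : Continuous H := continuous_primitive_of_memLp_two hF
  have hJpos : ∀ x : ℝ, 0 < x → J x = γ * f 0 := fun x hx => indicator_of_mem hx _
  have hJneg : ∀ x : ℝ, x ≤ 0 → J x = 0 := fun x hx => indicator_of_notMem (not_lt.2 hx) _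
  have hJx : ∀ x : ℝ, x ≠ 0 → J =ᶠ[𝓝 x] fun _ => J x := fun x hx => by
    rcases lt_or_gt_of_ne hx with h | h
    · filter_upwards [Iio_mem_nhds h] with y hy
      rw [hJneg y (le_of_lt hy), hJneg x h.le]
    · filter_upwards [Ioi_mem_nhds h] with y hy
      rw [hJpos y hy, hJpos x h]
  have hDm : StronglyMeasurable D := (stronglyMeasurable_const.sub (hHc.stronglyMeasurable.add
    (stronglyMeasurable_const.indicator measurableSet_Ioi)))
  have hDc : ∀ x : ℝ, x ≠ 0 → ContinuousAt D x := fun x hx =>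
    continuousAt_const.sub (hHc.continuousAt.add
      (continuousAt_const.congr (hJx x hx).symm))
  have hDi : ∀ a b, IntervalIntegrable D volume a b := fun a b =>
    (intervalIntegrable_of_memLp_two hf.memLp_deriv a b).congr_ae (ae_restrict_of_ae hm)
  have hfD : f = fun x => f 0 + ∫ t in (0 : ℝ)..x, D t := by
    funext x
    have : ∫ t in (0 : ℝ)..x, D t = ∫ t in (0 : ℝ)..x, deriv f t :=
      intervalIntegral.integral_congr_ae (hm.mono fun t ht _ => ht.symm)
    rw [this, hf.integral_deriv]; ring
  have hder : ∀ x : ℝ, x ≠ 0 → HasDerivAt f (D x) x := fun x hx => by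
    rw [hfD]
    exact (intervalIntegral.integral_hasDerivAt_right (hDi 0 x)
      hDm.stronglyMeasurableAtFilter (hDc x hx)).const_add _
  have hdd : deriv (deriv f) =ᵐ[volume] fun x => -F x := by
    filter_upwards [_root_.LocallyIntegrable.ae_hasDerivAt_integral
      (hF.locallyIntegrable (by norm_num)), (by simp [ae_iff, measure_singleton] :
        ∀ᵐ x : ℝ, x ≠ 0)] with x h1 hx
    have h2 : deriv f =ᶠ[𝓝 x] fun y => m - (H y + J x) := by
      filter_upwards [hJx x hx, isOpen_ne.mem_nhds hx] with y hy hy0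
      rw [(hder y hy0).deriv, hD]
      simp only [hy]
    rw [h2.deriv_eq]
    exact (((h1 0).add_const (J x)).const_sub m).deriv
  refine ⟨⟨hf, fun x hx => (hder x hx).differentiableAt, fun a b hab => ?_,
    (memLp_congr_ae hdd).2 hF.neg, m - γ * f 0, m, ?_, ?_, by ring⟩, hdd⟩
  · have ha : a ≠ 0 := fun h => by simp [h] at hab
    have hb : b ≠ 0 := fun h => by simp [h] at hab
    have hJab : J a = J b := by
      rcases pos_and_pos_or_neg_and_neg_of_mul_pos hab with ⟨h1, h2⟩ | ⟨h1, h2⟩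
      · rw [hJpos a h1, hJpos b h2]
      · rw [hJneg a h1.le, hJneg b h2.le]
    rw [intervalIntegral.integral_congr_ae (hdd.mono fun t ht _ => ht),
      intervalIntegral.integral_neg, (hder a ha).deriv, (hder b hb).deriv]
    have := intervalIntegral.integral_add_adjacent_intervals
      (intervalIntegrable_of_memLp_two hF 0 a) (intervalIntegrable_of_memLp_two hF a b)
    simp only [hD, hH, hJab]
    linarith
  · have h1 : Tendsto (fun x => m - (H x + γ * f 0)) (𝓝[>] 0) (𝓝 (m - (H 0 + γ * f 0))) :=
      ((continuous_const.sub (hHc.add continuous_const)).tendsto 0).mono_left nhdsWithin_le_nhds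
    rw [show H 0 = 0 by simp [hH], zero_add] at h1
    refine h1.congr' ?_
    filter_upwards [self_mem_nhdsWithin] with x hx
    rw [(hder x (ne_of_gt hx)).deriv, hD, ← hJpos x hx]
  · have h1 : Tendsto (fun x => m - (H x + 0)) (𝓝[<] 0) (𝓝 (m - (H 0 + 0))) :=
      ((continuous_const.sub (hHc.add continuous_const)).tendsto 0).mono_left nhdsWithin_le_nhds
    rw [show m - (H 0 + 0) = m by simp [hH]] at h1
    refine h1.congr' ?_
    filter_upwards [self_mem_nhdsWithin] with x hx
    rw [(hder x (ne_of_lt hx)).deriv, hD, ← hJneg x (le_of_lt hx)]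

end DuBoisReymond

/-! ### Integration by parts in the domain -/

namespace RealDomain

variable {γ : ℝ} {f g : ℝ → ℝ}

/-- The derivative at 0 itself may not exist, so f' is replaced by its continuous extension u from
the right, for which u(0) = `dr`. -/
theorem half_integral_by_parts {dr : ℝ}
    (hdr : Tendsto (deriv f) (𝓝[>] 0) (𝓝 dr))
    (hac : ∀ a b : ℝ, 0 < a * b → deriv f b - deriv f a = ∫ t in a..b, deriv (deriv f) t)
    (h1 : MemLp (deriv f) 2 volume) (h2 : MemLp (deriv (deriv f)) 2 volume) (hg : RH1 g) :
    ∫ x in Ioi 0, deriv f x * deriv g x =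
      -(dr * g 0) - ∫ x in Ioi 0, deriv (deriv f) x * g x := by
  set u : ℝ → ℝ := fun x => dr + ∫ t in (0 : ℝ)..x, deriv (deriv f) t with hu
  have huc : Continuous u := continuous_const.add (continuous_primitive_of_memLp_two h2)
  have hii := intervalIntegrable_of_memLp_two h2
  have hfu : ∀ x, 0 < x → deriv f x = u x := fun x hx => by
    have h3 : ∀ y, 0 < y → deriv f y = u y + (deriv f x - u x) := fun y hy => by
      have h4 := hac x y (mul_pos hx hy)
      have h5 := intervalIntegral.integral_add_adjacent_intervals (hii 0 x) (hii x y)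
      simp only [hu]
      linarith
    have h4 : Tendsto (fun y => u y + (deriv f x - u x)) (𝓝[>] 0)
        (𝓝 (u 0 + (deriv f x - u x))) :=
      ((huc.add continuous_const).tendsto 0).mono_left nhdsWithin_le_nhds
    have h5 := tendsto_nhds_unique hdr (h4.congr' (by
      filter_upwards [self_mem_nhdsWithin] with y hy
      exact (h3 y hy).symm))
    simp only [hu, intervalIntegral.integral_same, add_zero] at h5 ⊢
    linarith
  have hdu : deriv u =ᵐ[volume] deriv (deriv f) := by
    filter_upwards [_root_.LocallyIntegrable.ae_hasDerivAt_integral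
      (h2.locallyIntegrable (by norm_num))] with x hx
    exact ((hx 0).const_add dr).deriv
  have hul : HL 0 u := by
    refine ⟨?_, (memLp_congr_ae (ae_restrict_of_ae hdu)).2 (h2.restrict _), fun b hb => ?_⟩
    · refine (memLp_congr_ae ?_).1 (h1.restrict (Ioi 0))
      rw [Filter.EventuallyEq, ae_restrict_iff' measurableSet_Ioi]
      exact Eventually.of_forall hfu
    · have h3 : AbsolutelyContinuousOnInterval (fun _ : ℝ => dr) 0 b :=
        (contDiff_const (n := 1)).contDiffOn.absolutelyContinuousOnInterval
      exact h3.fun_add ((hii 0 b).absolutelyContinuousOnInterval_intervalIntegral (by simp))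
  have h3 := hul.integral_by_parts (hg.hl 0)
  rw [integral_congr_ae (g := fun x => deriv (deriv f) x * g x)
    (by filter_upwards [ae_restrict_of_ae hdu] with x hx; rw [hx])] at h3
  rw [setIntegral_congr_fun (g := fun x => u x * deriv g x) measurableSet_Ioi
    (fun x hx => by simp only [hfu x hx])]
  simp only [hu, intervalIntegral.integral_same, add_zero] at h3 ⊢
  linarith

/-- The half-line formula is applied to `f` and to its reflection; the two boundary terms combine
into the jump, which the domain condition evaluates. -/
theorem integral_by_parts (hf : RealDomain γ f) (hg : RH1 g) :
    ∫ x, deriv f x * deriv g x = γ * f 0 * g 0 - ∫ x, deriv (deriv f) x * g x := by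
  obtain ⟨dr, dl, hr, hl, hj⟩ := hf.jump
  have h1 := half_integral_by_parts hr hf.deriv_sub_deriv hf.rh1.memLp_deriv
    hf.memLp_deriv_deriv hg
  have d1 : deriv (fun x => f (-x)) = fun x => -deriv f (-x) := RH1.deriv_neg_arg f
  have d2 : deriv (deriv fun x => f (-x)) = fun x => deriv (deriv f) (-x) := by
    funext x
    rw [d1, deriv.fun_neg, deriv_comp_neg, neg_neg]
  have h2 := half_integral_by_parts (f := fun x => f (-x)) (dr := -dl)
    (by
      rw [d1]
      refine (hl.comp ?_).neg
      have := tendsto_neg_nhdsGT (a := (0 : ℝ))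
      simpa using this)
    (fun a b hab => by
      have := hf.deriv_sub_deriv (-b) (-a) (by linarith)
      rw [d2, d1, intervalIntegral.integral_comp_neg (deriv (deriv f)), ← this]
      ring)
    hf.rh1.comp_neg.memLp_deriv
    (by
      rw [d2]
      exact hf.memLp_deriv_deriv.comp_measurePreserving (Measure.measurePreserving_neg volume))
    hg.comp_neg
  have hi1 : Integrable fun x => deriv f x * deriv g x :=
    hf.rh1.memLp_deriv.integrable_mul hg.memLp_deriv
  have hi2 : Integrable fun x => deriv (deriv f) x * g x :=
    hf.memLp_deriv_deriv.integrable_mul hg.memLp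
  rw [integral_eq_half_add_half hi1, integral_eq_half_add_half hi2]
  rw [d2, d1, RH1.deriv_neg_arg g] at h2
  simp only [neg_mul_neg, neg_zero] at h2
  rw [h1, h2]
  linear_combination (-g 0) * hj

end RealDomain

end DeltaNLS
end

open MeasureTheory Filter Topology ComplexConjugate
noncomputable section
namespace DeltaNLS
open Set H1R

/-! ### Real and imaginary parts -/

theorem ae_hasDerivAt_of_integral {E : Type*} [NormedAddCommGroup E] [NormedSpace ℝ E]
    [CompleteSpace E] {φ ψ : ℝ → E} (hψ : LocallyIntegrable ψ volume)
    (h : ∀ a b : ℝ, 0 < a * b → φ b - φ a = ∫ t in a..b, ψ t) :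
    ∀ᵐ x, HasDerivAt φ (ψ x) x := by
  filter_upwards [_root_.LocallyIntegrable.ae_hasDerivAt_integral hψ,
    (by simp [ae_iff, measure_singleton] : ∀ᵐ x : ℝ, x ≠ 0)] with x hx hx0
  refine ((hx x).const_add (φ x)).congr_of_eventuallyEq ?_
  have : ∀ᶠ y in 𝓝 x, 0 < x * y :=
    (continuous_const.mul continuous_id).continuousAt.eventually (lt_mem_nhds
      (mul_self_pos.2 hx0 : 0 < x * id x))
  filter_upwards [this] with y hy
  rw [← h x y hy]
  abel

theorem intervalIntegrable_of_memLp_two_complex {F : ℝ → ℂ} (hF : MemLp F 2 volume) (a b : ℝ) :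
    IntervalIntegrable F volume a b :=
  intervalIntegrable_iff.mpr (((hF.locallyIntegrable (by norm_num)).integrableOn_isCompact
    isCompact_uIcc).mono_set uIoc_subset_uIcc)

theorem memLp_clm_comp (L : ℂ →L[ℝ] ℝ) {F : ℝ → ℂ} (hF : MemLp F 2 volume) :
    MemLp (fun x => L (F x)) 2 volume := L.comp_memLp' hF

theorem MemH1.clm_comp {f : ℝ → ℂ} (hf : MemH1 f) (L : ℂ →L[ℝ] ℝ) :
    RH1 (fun x => L (f x)) ∧ deriv (fun x => L (f x)) =ᵐ[volume] fun x => L (deriv f x) :=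
  RH1.of_integral (memLp_clm_comp L hf.memLp) (memLp_clm_comp L hf.memLp_deriv) fun x => by
    conv_lhs => rw [hf.eq_integral x]
    rw [map_add, L.intervalIntegral_comp_comm
      (intervalIntegrable_of_memLp_two_complex hf.memLp_deriv 0 x)]

theorem MemDomain.clm_comp {γ : ℝ} {f : ℝ → ℂ} (hf : MemDomain γ f) (L : ℂ →L[ℝ] ℝ) :
    RealDomain γ fun x => L (f x) := by
  have hd : ∀ x : ℝ, x ≠ 0 → HasDerivAt (fun x => L (f x)) (L (deriv f x)) x := fun x hx =>
    L.hasFDerivAt.comp_hasDerivAt x (hf.differentiableAt x hx).hasDerivAt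
  have hd' : ∀ x : ℝ, x ≠ 0 → deriv (fun x => L (f x)) x = L (deriv f x) := fun x hx =>
    (hd x hx).deriv
  have hdd : deriv (deriv fun x => L (f x)) =ᵐ[volume] fun x => L (deriv (deriv f) x) := by
    filter_upwards [ae_hasDerivAt_of_integral (hf.memLp_deriv_deriv.locallyIntegrable (by norm_num))
      hf.deriv_sub_deriv, (by simp [ae_iff, measure_singleton] : ∀ᵐ x : ℝ, x ≠ 0)] with x hx hx0
    have h1 : deriv (fun x => L (f x)) =ᶠ[𝓝 x] fun y => L (deriv f y) := by
      filter_upwards [isOpen_ne.mem_nhds hx0] with y hy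
      exact hd' y hy
    rw [h1.deriv_eq]
    exact (L.hasFDerivAt.comp_hasDerivAt x hx).deriv
  obtain ⟨dr, dl, hr, hl, hj⟩ := hf.jump
  refine ⟨(hf.memH1.clm_comp L).1, fun x hx => (hd x hx).differentiableAt, fun a b hab => ?_,
    (memLp_congr_ae hdd).2 (memLp_clm_comp L hf.memLp_deriv_deriv), L dr, L dl, ?_, ?_, ?_⟩
  · have ha : a ≠ 0 := fun h => by simp [h] at hab
    have hb : b ≠ 0 := fun h => by simp [h] at hab
    rw [hd' a ha, hd' b hb, ← map_sub, hf.deriv_sub_deriv a b hab,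
      intervalIntegral.integral_congr_ae (hdd.mono fun t ht _ => ht)]
    exact (L.intervalIntegral_comp_comm
      (intervalIntegrable_of_memLp_two_complex hf.memLp_deriv_deriv a b)).symm
  · refine ((L.continuous.tendsto dr).comp hr).congr' ?_
    filter_upwards [self_mem_nhdsWithin] with x hx
    exact (hd' x (ne_of_gt hx)).symm
  · refine ((L.continuous.tendsto dl).comp hl).congr' ?_
    filter_upwards [self_mem_nhdsWithin] with x hx
    exact (hd' x (ne_of_lt hx)).symm
  · rw [← map_sub, hj, show -(γ : ℂ) * f 0 = (-γ : ℝ) • f 0 by simp, map_smul, smul_eq_mul]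

/-- The complex function with given real and imaginary parts. -/
def toComplex (u v : ℝ → ℝ) (x : ℝ) : ℂ := ⟨u x, v x⟩

theorem toComplex_eq (u v : ℝ → ℝ) : toComplex u v = fun x => (u x : ℂ) + v x * Complex.I :=
  funext fun _ => Complex.mk_eq_add_mul_I _ _

theorem memLp_toComplex {u v : ℝ → ℝ} (hu : MemLp u 2 volume) (hv : MemLp v 2 volume) :
    MemLp (toComplex u v) 2 volume := by
  rw [toComplex_eq]
  exact (Complex.ofRealCLM.comp_memLp' hu).add
    ((Complex.ofRealCLM.comp_memLp' hv).mul_const Complex.I)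

theorem hasDerivAt_toComplex {u v : ℝ → ℝ} {u' v' x : ℝ} (hu : HasDerivAt u u' x)
    (hv : HasDerivAt v v' x) : HasDerivAt (toComplex u v) ⟨u', v'⟩ x := by
  rw [toComplex_eq, Complex.mk_eq_add_mul_I]
  exact hu.ofReal_comp.add (hv.ofReal_comp.mul_const Complex.I)

theorem integral_toComplex {u v : ℝ → ℝ} {a b : ℝ} (hu : IntervalIntegrable u volume a b)
    (hv : IntervalIntegrable v volume a b) :
    ∫ x in a..b, toComplex u v x = ⟨∫ x in a..b, u x, ∫ x in a..b, v x⟩ := by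
  have hu' : IntervalIntegrable (fun x => (u x : ℂ)) volume a b := ⟨hu.1.ofReal, hu.2.ofReal⟩
  have hv' : IntervalIntegrable (fun x => (v x : ℂ)) volume a b := ⟨hv.1.ofReal, hv.2.ofReal⟩
  simp only [toComplex_eq]
  rw [intervalIntegral.integral_add hu' (hv'.mul_const _), intervalIntegral.integral_mul_const, intervalIntegral.integral_ofReal,
    intervalIntegral.integral_ofReal, Complex.mk_eq_add_mul_I]

theorem deriv_toComplex_ae {u v : ℝ → ℝ} (hu : RH1 u) (hv : RH1 v) :
    deriv (toComplex u v) =ᵐ[volume] toComplex (deriv u) (deriv v) := by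
  filter_upwards [hu.ae_differentiableAt, hv.ae_differentiableAt] with x h1 h2
  exact (hasDerivAt_toComplex h1.hasDerivAt h2.hasDerivAt).deriv

theorem memH1_toComplex {u v : ℝ → ℝ} (hu : RH1 u) (hv : RH1 v) : MemH1 (toComplex u v) where
  memLp := memLp_toComplex hu.memLp hv.memLp
  memLp_deriv := (memLp_congr_ae (deriv_toComplex_ae hu hv)).2
    (memLp_toComplex hu.memLp_deriv hv.memLp_deriv)
  eq_integral x := by
    rw [intervalIntegral.integral_congr_ae ((deriv_toComplex_ae hu hv).mono fun t ht _ => ht),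
      integral_toComplex (intervalIntegrable_of_memLp_two hu.memLp_deriv 0 x)
        (intervalIntegrable_of_memLp_two hv.memLp_deriv 0 x), hu.integral_deriv, hv.integral_deriv]
    apply Complex.ext <;> simp [toComplex]

theorem memDomain_toComplex {γ : ℝ} {u v : ℝ → ℝ} (hu : RealDomain γ u) (hv : RealDomain γ v) :
    MemDomain γ (toComplex u v) := by
  have hd : ∀ x : ℝ, x ≠ 0 →
      HasDerivAt (toComplex u v) (toComplex (deriv u) (deriv v) x) x := fun x hx =>
    hasDerivAt_toComplex (hu.differentiableAt x hx).hasDerivAt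
      (hv.differentiableAt x hx).hasDerivAt
  have hdd : deriv (deriv (toComplex u v)) =ᵐ[volume]
      toComplex (deriv (deriv u)) (deriv (deriv v)) := by
    filter_upwards [
      ae_hasDerivAt_of_integral (hu.memLp_deriv_deriv.locallyIntegrable (by norm_num))
        hu.deriv_sub_deriv,
      ae_hasDerivAt_of_integral (hv.memLp_deriv_deriv.locallyIntegrable (by norm_num))
        hv.deriv_sub_deriv,
      (by simp [ae_iff, measure_singleton] : ∀ᵐ x : ℝ, x ≠ 0)] with x h1 h2 hx0
    have h3 : deriv (toComplex u v) =ᶠ[𝓝 x] toComplex (deriv u) (deriv v) := by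
      filter_upwards [isOpen_ne.mem_nhds hx0] with y hy
      exact (hd y hy).deriv
    rw [h3.deriv_eq]
    exact (hasDerivAt_toComplex h1 h2).deriv
  have ht : ∀ {l : Filter ℝ} {a b : ℝ}, Tendsto (deriv u) l (𝓝 a) → Tendsto (deriv v) l (𝓝 b) →
      Tendsto (toComplex (deriv u) (deriv v)) l (𝓝 ⟨a, b⟩) := fun {l a b} h1 h2 => by
    rw [toComplex_eq, Complex.mk_eq_add_mul_I]
    exact ((Complex.continuous_ofReal.tendsto a).comp h1).add
      (((Complex.continuous_ofReal.tendsto b).comp h2).mul_const Complex.I)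
  obtain ⟨ar, al, har, hal, haj⟩ := hu.jump
  obtain ⟨br, bl, hbr, hbl, hbj⟩ := hv.jump
  refine ⟨memH1_toComplex hu.rh1 hv.rh1, fun x hx => (hd x hx).differentiableAt,
    fun a b hab => ?_, (memLp_congr_ae hdd).2
      (memLp_toComplex hu.memLp_deriv_deriv hv.memLp_deriv_deriv),
    ⟨ar, br⟩, ⟨al, bl⟩, ?_, ?_, ?_⟩
  · have ha : a ≠ 0 := fun h => by simp [h] at hab
    have hb : b ≠ 0 := fun h => by simp [h] at hab
    rw [(hd a ha).deriv, (hd b hb).deriv,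
      intervalIntegral.integral_congr_ae (hdd.mono fun t ht _ => ht),
      integral_toComplex (intervalIntegrable_of_memLp_two hu.memLp_deriv_deriv a b)
        (intervalIntegrable_of_memLp_two hv.memLp_deriv_deriv a b),
      ← hu.deriv_sub_deriv a b hab, ← hv.deriv_sub_deriv a b hab]
    rfl
  · refine (ht har hbr).congr' ?_
    filter_upwards [self_mem_nhdsWithin] with x hx
    exact (hd x (ne_of_gt hx)).deriv.symm
  · refine (ht hal hbl).congr' ?_
    filter_upwards [self_mem_nhdsWithin] with x hx
    exact (hd x (ne_of_lt hx)).deriv.symm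
  · apply Complex.ext <;> simp [toComplex, haj, hbj]

theorem MemH1.exists_eq_toComplex {f : ℝ → ℂ} (hf : MemH1 f) :
    ∃ u v : H1R, f = toComplex u.val v.val :=
  ⟨H1R.mk _ (hf.clm_comp Complex.reCLM).1, H1R.mk _ (hf.clm_comp Complex.imCLM).1, rfl⟩

theorem h1Norm_toComplex_sq (u v : H1R) :
    h1Norm (toComplex u.val v.val) ^ 2 = ‖u‖ ^ 2 + ‖v‖ ^ 2 := by
  have hn : ∀ a b : ℝ → ℝ, ∀ x, ‖toComplex a b x‖ ^ 2 = a x ^ 2 + b x ^ 2 := fun a b x => by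
    rw [← Complex.normSq_eq_norm_sq, Complex.normSq_apply, toComplex, pow_two, pow_two]
  have h1 : ∫ x, ‖toComplex u.val v.val x‖ ^ 2 = (∫ x, u.val x ^ 2) + ∫ x, v.val x ^ 2 := by
    simp only [hn]
    exact integral_add u.rh1.sq_integrable v.rh1.sq_integrable
  have h2 : ∫ x, ‖deriv (toComplex u.val v.val) x‖ ^ 2 =
      (∫ x, deriv u.val x ^ 2) + ∫ x, deriv v.val x ^ 2 := by
    rw [← integral_add u.rh1.deriv_sq_integrable v.rh1.deriv_sq_integrable]
    refine integral_congr_ae ?_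
    filter_upwards [deriv_toComplex_ae u.rh1 v.rh1] with x hx
    rw [hx, hn]
  rw [h1Norm, Real.sq_sqrt (add_nonneg (integral_nonneg fun _ => sq_nonneg _)
    (integral_nonneg fun _ => sq_nonneg _)), h1, h2, norm_sq, norm_sq]
  ring

theorem pairing_toComplex (u v u' v' : H1R) :
    pairing (toComplex u.val v.val) (toComplex u'.val v'.val) = lform u u' + lform v v' := by
  have hm : ∀ a b : H1R, MemLp (toComplex a.val b.val) 2 volume := fun a b =>
    memLp_toComplex a.rh1.memLp b.rh1.memLp
  have hi : Integrable fun x => toComplex u.val v.val x * conj (toComplex u'.val v'.val x) := by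
    have := (hm u v).integrable_mul (hm u' (-v'))
    refine this.congr (Eventually.of_forall fun x => ?_)
    simp only [Pi.mul_apply]
    congr 1
  have i1 : Integrable fun x => u.val x * u'.val x := u.rh1.memLp.integrable_mul u'.rh1.memLp
  have i2 : Integrable fun x => v.val x * v'.val x := v.rh1.memLp.integrable_mul v'.rh1.memLp
  rw [pairing, ← Complex.reCLM_apply, ← Complex.reCLM.integral_comp_comm hi, lform_apply,
    lform_apply, ← integral_add i1 i2]
  congr 1
  funext x
  simp [toComplex]

namespace Params

variable {p ω γ : ℝ} (h : Params p ω γ)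
include h

theorem B_toComplex (u v : H1R) : B p ω γ (toComplex u.val v.val) (toComplex u.val v.val) =
    h.bil p u u + h.bil 1 v v := by
  rw [bil_apply, bil_apply, ← Bplus_eq, ← Bminus_eq]
  rfl

theorem iQ_eq_toComplex : iQ p ω γ = toComplex (0 : H1R).val h.groundState.val := by
  funext x
  apply Complex.ext <;> simp [iQ, toComplex, groundState_val]

/-! ### Weak and strong eigenfunctions -/

theorem bil_eq_integral (c : ℝ) {f : H1R} (hf : RealDomain γ f.val) (g : H1R) :
    h.bil c f g =
      ∫ x, (-deriv (deriv f.val) x + ω * f.val x - c * Q p ω γ x ^ (p - 1) * f.val x) * g.val x := by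
  have i1 : Integrable fun x => deriv f.val x * deriv g.val x :=
    f.rh1.memLp_deriv.integrable_mul g.rh1.memLp_deriv
  have i2 : Integrable fun x => deriv (deriv f.val) x * g.val x :=
    hf.memLp_deriv_deriv.integrable_mul g.rh1.memLp
  have i0 : Integrable fun x => f.val x * g.val x := f.rh1.memLp.integrable_mul g.rh1.memLp
  have i3 : Integrable fun x => (ω - c * pot p ω γ |x|) * (f.val x * g.val x) :=
    ((i0.const_mul ω).sub ((h.integrable_pot_mul i0).const_mul c)).congr
      (Eventually.of_forall fun x => by simp only [Pi.sub_apply]; ring)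
  rw [bil_apply, h.bform_eq_integral c f.rh1 g.rh1, integral_add i1 i3,
    hf.integral_by_parts g.rh1]
  have : ∀ x, (-deriv (deriv f.val) x + ω * f.val x - c * Q p ω γ x ^ (p - 1) * f.val x) * g.val x
      = (ω - c * pot p ω γ |x|) * (f.val x * g.val x) - deriv (deriv f.val) x * g.val x :=
    fun x => by rw [h.Q_rpow]; ring
  simp only [this]
  rw [integral_sub i3 i2]
  ring

theorem realDomain_of_bil (c : ℝ) {f : H1R} {F : ℝ → ℝ} (hF : MemLp F 2 volume)
    (hw : ∀ g : H1R, h.bil c f g = ∫ x, F x * g.val x) :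
    RealDomain γ f.val ∧ ∀ᵐ x,
      -deriv (deriv f.val) x + ω * f.val x - c * Q p ω γ x ^ (p - 1) * f.val x = F x := by
  have hm : MemLp (fun x => F x - (ω * f.val x - c * (pot p ω γ |x| * f.val x))) 2 volume :=
    hF.sub ((f.rh1.memLp.const_mul ω).sub ((h.memLp_pot_mul f.rh1.memLp).const_mul c))
  obtain ⟨h1, h2⟩ := realDomain_of_weak (γ := γ) f.rh1 hm fun g hg => by
    have h3 := hw (H1R.mk g hg)
    have i1 : Integrable fun x => deriv f.val x * deriv g x :=
      f.rh1.memLp_deriv.integrable_mul hg.memLp_deriv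
    have i0 : Integrable fun x => f.val x * g x := f.rh1.memLp.integrable_mul hg.memLp
    have i3 : Integrable fun x => (ω - c * pot p ω γ |x|) * (f.val x * g x) :=
      ((i0.const_mul ω).sub ((h.integrable_pot_mul i0).const_mul c)).congr
        (Eventually.of_forall fun x => by simp only [Pi.sub_apply]; ring)
    have i4 : Integrable fun x => F x * g x := hF.integrable_mul hg.memLp
    rw [bil_apply, val_mk, h.bform_eq_integral c f.rh1 hg, integral_add i1 i3] at h3
    have : ∀ x, (F x - (ω * f.val x - c * (pot p ω γ |x| * f.val x))) * g x =
        F x * g x - (ω - c * pot p ω γ |x|) * (f.val x * g x) := fun x => by ring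
    simp only [this]
    rw [integral_sub i4 i3]
    linarith
  refine ⟨h1, ?_⟩
  filter_upwards [h2] with x hx
  rw [hx, h.Q_rpow]
  ring

omit h in
theorem linOp_toComplex (u v : ℝ → ℝ) (x : ℝ) :
    linOp p ω γ (toComplex u v) x = ⟨Lminus p ω γ v x, -Lplus p ω γ u x⟩ := by
  apply Complex.ext <;> simp [linOp, toComplex]

theorem weakPair_of_isEigenfunction {y : ℝ} {u v : H1R}
    (hf : IsEigenfunction p ω γ y (toComplex u.val v.val)) : h.WeakPair y u v := by
  have hu : RealDomain γ u.val := hf.memDomain.clm_comp Complex.reCLM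
  have hv : RealDomain γ v.val := hf.memDomain.clm_comp Complex.imCLM
  refine ⟨fun g => ?_, fun g => ?_⟩
  · rw [h.bil_eq_integral 1 hv, lform_apply, ← integral_const_mul]
    refine integral_congr_ae ?_
    filter_upwards [hf.eigen] with x hx
    have h1 : Lminus p ω γ v.val x = y * u.val x := by
      simpa [toComplex] using congrArg Complex.re ((linOp_toComplex _ _ x).symm.trans hx)
    rw [one_mul, ← mul_assoc, ← h1, Lminus]
  · rw [h.bil_eq_integral p hu, lform_apply, ← integral_const_mul]
    refine integral_congr_ae ?_
    filter_upwards [hf.eigen] with x hx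
    have h1 : -Lplus p ω γ u.val x = y * v.val x := by
      simpa [toComplex] using congrArg Complex.im ((linOp_toComplex _ _ x).symm.trans hx)
    rw [← mul_assoc, neg_mul, ← h1, Lplus, neg_neg]

theorem WeakPair.isEigenfunction {y : ℝ} {u v : H1R} (hw : h.WeakPair y u v) (hu : u ≠ 0) :
    IsEigenfunction p ω γ y (toComplex u.val v.val) := by
  obtain ⟨dv, ev⟩ := h.realDomain_of_bil 1 (f := v) (u.rh1.memLp.const_mul y) fun g => by
    rw [hw.minus, lform_apply, ← integral_const_mul]
    simp only [mul_assoc]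
  obtain ⟨du, eu⟩ := h.realDomain_of_bil p (f := u) (v.rh1.memLp.const_mul (-y)) fun g => by
    rw [hw.plus, lform_apply, ← integral_const_mul]
    simp only [mul_assoc]
  refine ⟨memDomain_toComplex du dv, fun h0 => hu (H1R.ext (funext fun x => ?_)), ?_⟩
  · exact congrArg Complex.re (congrFun h0 x)
  · filter_upwards [ev, eu] with x h1 h2
    rw [linOp_toComplex]
    rw [one_mul] at h1
    apply Complex.ext
    · simpa [toComplex, Lminus] using h1
    · simp only [Lplus, h2]
      simp [toComplex]

omit h in
theorem WeakPair.neg {h : Params p ω γ} {y : ℝ} {u v : H1R} (hw : h.WeakPair y u v) :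
    h.WeakPair (-y) u (-v) := by
  refine ⟨fun g => ?_, fun g => ?_⟩
  · rw [map_neg, _root_.neg_apply, hw.minus]; ring
  · rw [map_neg, _root_.neg_apply, hw.plus]; ring

end Params
end DeltaNLS
end

open MeasureTheory Filter Topology ComplexConjugate
noncomputable section
namespace DeltaNLS
open Set H1R

theorem H1R.eq_zero_of_lform_self {f : H1R} (hf : lform f f = 0) : f = 0 := by
  rw [lform_apply, integral_eq_zero_iff_of_nonneg (fun x => mul_self_nonneg _)
    (f.rh1.memLp.integrable_mul f.rh1.memLp)] at hf
  have h1 := (Continuous.ae_eq_iff_eq volume (f.rh1.continuous.mul f.rh1.continuous)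
    continuous_const).1 hf
  exact H1R.ext (funext fun x => mul_self_eq_zero.1 (congrFun h1 x))

namespace Params

variable {p ω γ : ℝ} {h : Params p ω γ}

/-! ### Simplicity of the real eigenvalues -/

namespace WeakPair

variable {y : ℝ} {u v u' v' : H1R}

theorem bil_p_self (hw : h.WeakPair y u v) : h.bil p u u = -h.bil 1 v v := by
  rw [hw.plus, hw.minus, lform_symm]; ring

theorem snd_eq_zero (hy : y ≠ 0) (hw : h.WeakPair y u v) (hu : u = 0) : v = 0 := by
  have h1 := hw.plus v
  rw [hu, map_zero, _root_.zero_apply] at h1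
  exact eq_zero_of_lform_self ((mul_eq_zero.1 h1.symm).resolve_left (neg_ne_zero.2 hy))

/-- The value is -B⁻(v,v) ≤ 0. If it were zero, `v` would be a multiple of Q, and then yu = L⁻v = 0.
-/
theorem bil_p_neg (hy : y ≠ 0) (hw : h.WeakPair y u v) (hu : u ≠ 0) : h.bil p u u < 0 := by
  have h1 := h.bil_one_nonneg v
  refine lt_of_le_of_ne (by rw [hw.bil_p_self]; linarith) fun h0 => hu ?_
  obtain ⟨c, rfl⟩ := h.eq_smul_of_bil_one_eq_zero (f := v) (by rw [hw.bil_p_self] at h0; linarith)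
  have h2 := hw.minus u
  rw [map_smul, smul_apply, h.bil_one_groundState, smul_zero] at h2
  exact eq_zero_of_lform_self ((mul_eq_zero.1 h2.symm).resolve_left hy)

theorem sub_smul (hw' : h.WeakPair y u' v') (hw : h.WeakPair y u v) (a : ℝ) :
    h.WeakPair y (u' - a • u) (v' - a • v) where
  minus g := by
    simp only [map_sub, map_smul, sub_apply, smul_apply, smul_eq_mul, hw.minus, hw'.minus]; ring
  plus g := by
    simp only [map_sub, map_smul, sub_apply, smul_apply, smul_eq_mul, hw.plus, hw'.plus]; ring

/-- Subtracting the B⁺-projection onto `u` leaves another pair, whose first component has energy -B⁻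
≤ 0; being B⁺-orthogonal to the negative direction `u`, it would have positive energy if it were
nonzero. -/
theorem exists_eq_smul {σ : ℝ} (hσ : σ ^ 2 = 1) (hy : y ≠ 0) (hw : h.WeakPair y u v)
    (hw' : h.WeakPair y u' v') (hu : u ≠ 0) (hu' : u' ≠ 0) (hp : HasParity σ u)
    (hp' : HasParity σ u') : ∃ a : ℝ, a ≠ 0 ∧ u' = a • u ∧ v' = a • v := by
  have hneg := hw.bil_p_neg hy hu
  set a := h.bil p u' u / h.bil p u u with ha
  have hs := hw'.sub_smul hw a
  have horth : h.bil p (u' - a • u) u = 0 := by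
    simp only [map_sub, map_smul, sub_apply, smul_apply, smul_eq_mul, ha]
    field_simp [hneg.ne]
    ring
  have h0 : u' - a • u = 0 := by
    by_contra hne
    have h1 := h.bil_p_pos hσ (hp'.sub (hp.smul a)) hp hneg horth hne
    rw [hs.bil_p_self] at h1
    linarith [h.bil_one_nonneg (v' - a • v)]
  have h1 := hs.snd_eq_zero hy h0
  refine ⟨a, fun ha0 => hu' ?_, sub_eq_zero.1 h0, sub_eq_zero.1 h1⟩
  rw [sub_eq_zero.1 h0, ha0, zero_smul]

end WeakPair

/-! ### Coercivity -/

/-- Since L⁺u = -yv, orthogonality to `v` is B⁺-orthogonality to the even negative direction `u`,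
and similarly for the odd one. The even and odd parts of `f` decouple in B⁺, so `bil_p_pos` applies
to each. -/
theorem bil_p_pos_of_orthogonal {y z : ℝ} {u v u' v' : H1R} (hy : y ≠ 0) (hz : z ≠ 0)
    (hw : h.WeakPair y u v) (hw' : h.WeakPair z u' v') (hu : u ≠ 0) (hu' : u' ≠ 0)
    (hp : HasParity 1 u) (hp' : HasParity (-1) u') {f : H1R} (hf : f ≠ 0)
    (hv : lform f v = 0) (hv' : lform f v' = 0) : 0 < h.bil p f f := by
  have hs1 : (1 : ℝ) ^ 2 = 1 := by norm_num
  have hs2 : (-1 : ℝ) ^ 2 = 1 := by norm_num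
  have he := hasParity_part hs1 f
  have ho := hasParity_part hs2 f
  have h1 : h.bil p (part 1 f) u = 0 := by
    rw [h.bil_symm, hp.form_part (h.bil_refl p) hs1, hw.plus, lform_symm, hv, mul_zero]
  have h2 : h.bil p (part (-1) f) u' = 0 := by
    rw [h.bil_symm, hp'.form_part (h.bil_refl p) hs2, hw'.plus, lform_symm, hv', mul_zero]
  have hpos1 := fun h0 => h.bil_p_pos hs1 he hp (hw.bil_p_neg hy hu) h1 h0
  have hpos2 := fun h0 => h.bil_p_pos hs2 ho hp' (hw'.bil_p_neg hz hu') h2 h0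
  have hsum : h.bil p f f =
      h.bil p (part 1 f) (part 1 f) + h.bil p (part (-1) f) (part (-1) f) := by
    have hc := he.form_eq_zero (h.bil_refl p) ho
    conv_lhs => rw [← part_add_part f]
    simp only [map_add, add_apply, h.bil_symm p (part (-1) f) (part 1 f), hc]
    ring
  rw [hsum]
  by_cases h3 : part 1 f = 0
  · have h4 : part (-1) f ≠ 0 := fun h4 => hf (by rw [← part_add_part f, h3, h4, add_zero])
    have := hpos2 h4
    simpa [h3] using this
  · by_cases h4 : part (-1) f = 0
    · have := hpos1 h3
      simpa [h4] using this
    · exact add_pos (hpos1 h3) (hpos2 h4)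

theorem exists_coercive (c : ℝ) {ι : Type*} [Fintype ι] (w : ι → H1R)
    (hpos : ∀ f : H1R, f ≠ 0 → (∀ j, lform f (w j) = 0) → 0 < h.bil c f f) :
    ∃ C : ℝ, 0 < C ∧ ∀ f : H1R,
      C * ‖f‖ ^ 2 ≤ h.bil c f f + C⁻¹ * ∑ j, lform f (w j) ^ 2 := by
  obtain ⟨c₀, hc₀, hdc⟩ := h.dform_coercive
  obtain ⟨C, hC, hb⟩ := coercive_of_pos (dform ω γ) (dform_symm _ _) hc₀ hdc
    (fun f => c * h.kform f f) (h.weakSeqCont_kform_comp (ContinuousLinearMap.id ℝ H1R) c)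
    (fun a f => by simp only [map_smul, smul_apply, smul_eq_mul]; ring) (fun j => lform (w j))
    (fun f hf hj => by
      have := hpos f hf fun j => by rw [lform_symm]; exact hj j
      rw [bil_eq] at this
      linarith)
  refine ⟨C, hC, fun f => ?_⟩
  have := hb f
  rw [bil_eq]
  simpa only [lform_symm f] using this

end Params

/-! ### The modes -/

theorem smul_I_toComplex (u v : H1R) :
    (fun x => Complex.I * toComplex u.val v.val x) = toComplex (-v).val u.val := by
  funext x
  apply Complex.ext <;> simp [toComplex]

theorem pairing_I_mul_toComplex (f g u v : H1R) :
    pairing (toComplex f.val g.val) (fun x => Complex.I * toComplex u.val v.val x) =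
      lform g u - lform f v := by
  rw [smul_I_toComplex, pairing_toComplex, map_neg]; ring

theorem pairing_I_mul_re (f g u v : H1R) :
    pairing (toComplex f.val g.val)
      (fun x => Complex.I * ((toComplex u.val v.val x).re : ℂ)) = lform g u := by
  have : (fun x => Complex.I * ((toComplex u.val v.val x).re : ℂ)) =
      toComplex (0 : H1R).val u.val := by
    funext x
    apply Complex.ext <;> simp [toComplex]
  rw [this, pairing_toComplex, map_zero, zero_add]

theorem pairing_im (f g u v : H1R) :
    pairing (toComplex f.val g.val) (fun x => ((toComplex u.val v.val x).im : ℂ)) = lform f v := by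
  have : (fun x => ((toComplex u.val v.val x).im : ℂ)) = toComplex v.val (0 : H1R).val := by
    funext x
    apply Complex.ext <;> simp [toComplex]
  rw [this, pairing_toComplex, map_zero, add_zero]

theorem Params.pairing_iQ {p ω γ : ℝ} (h : Params p ω γ) (f g : H1R) :
    pairing (toComplex f.val g.val) (iQ p ω γ) = lform g h.groundState := by
  rw [h.iQ_eq_toComplex, pairing_toComplex, map_zero, zero_add]

/-- Eigenfunctions of a given parity for opposite eigenvalues are conjugate up to a factor. -/
theorem Params.exists_modes {p ω γ : ℝ} (h : Params p ω γ) {σ y : ℝ} (hσ : σ ^ 2 = 1) (hy : 0 < y)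
    {Yp Ym : ℝ → ℂ} (hYp : IsEigenfunction p ω γ y Yp) (hYm : IsEigenfunction p ω γ (-y) Ym)
    (hp : ∀ x, Yp (-x) = σ * Yp x) (hm : ∀ x, Ym (-x) = σ * Ym x) :
    ∃ (u v : H1R) (a : ℝ), a ≠ 0 ∧ Yp = toComplex u.val v.val ∧
      Ym = toComplex (a • u).val (-(a • v)).val ∧ h.WeakPair y u v ∧ u ≠ 0 ∧ HasParity σ u := by
  obtain ⟨u, v, rfl⟩ := hYp.memDomain.memH1.exists_eq_toComplex
  obtain ⟨u', v', rfl⟩ := hYm.memDomain.memH1.exists_eq_toComplex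
  have hw := h.weakPair_of_isEigenfunction hYp
  -- Conjugating a mode for -y gives a mode for y, which simplicity compares with `Yp`.
  have hw' := (h.weakPair_of_isEigenfunction hYm).neg
  rw [neg_neg] at hw'
  have hpu : HasParity σ u := fun x => by
    simpa [toComplex] using congrArg Complex.re (hp x)
  have hpu' : HasParity σ u' := fun x => by
    simpa [toComplex] using congrArg Complex.re (hm x)
  have hu : u ≠ 0 := fun h0 => hYp.ne_zero (by
    rw [h0, hw.snd_eq_zero hy.ne' h0]; rfl)
  have hu' : u' ≠ 0 := fun h0 => hYm.ne_zero (by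
    rw [h0, neg_eq_zero.1 (hw'.snd_eq_zero hy.ne' h0)]; rfl)
  obtain ⟨a, ha, h1, h2⟩ := hw.exists_eq_smul hσ hy.ne' hw' hu hu' hpu hpu'
  exact ⟨u, v, a, ha, rfl, by rw [h1, ← h2, neg_neg], hw, hu, hpu⟩

/-! ### Existence of the modes and the coercivity bounds -/

theorem Params.exists_eigenfunctions {p ω γ : ℝ} (h : Params p ω γ) {σ : ℝ} (hσ : σ = 1 ∨ σ = -1)
    {u₀ : H1R} (hu₀ : HasParity σ u₀) (hu₀Q : lform u₀ h.groundState = 0)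
    (hneg : h.bil p u₀ u₀ < 0) :
    ∃ (y : ℝ) (Yp Ym : ℝ → ℂ), 0 < y ∧ IsEigenfunction p ω γ y Yp ∧
      IsEigenfunction p ω γ (-y) Ym ∧ (∀ x, Yp (-x) = σ * Yp x) ∧ ∀ x, Ym (-x) = σ * Ym x := by
  obtain ⟨y, u, v, hy, hu, hpu, hpv, hw⟩ := h.exists_weakPair hσ hu₀ hu₀Q hneg
  have hpar : ∀ a b : H1R, HasParity σ a → HasParity σ b → ∀ x,
      toComplex a.val b.val (-x) = σ * toComplex a.val b.val x := fun a b ha hb x => by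
    apply Complex.ext <;> simp [toComplex, ha x, hb x]
  exact ⟨y, _, _, hy, Params.WeakPair.isEigenfunction h hw hu,
    Params.WeakPair.isEigenfunction h hw.neg hu, hpar u v hpu hpv,
    hpar u (-v) hpu fun x => by simp [hpv x]⟩

theorem Params.exists_isUnstableModes {p ω γ : ℝ} (h : Params p ω γ) :
    ∃ (y z : ℝ) (Yp Ym Zp Zm : ℝ → ℂ), IsUnstableModes p ω γ y z Yp Ym Zp Zm := by
  obtain ⟨u₀, h1, h2, h3⟩ := h.exists_even_negative
  obtain ⟨w₀, h4, h5, h6⟩ := h.exists_odd_negative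
  obtain ⟨y, Yp, Ym, hy, eYp, eYm, pYp, pYm⟩ := h.exists_eigenfunctions (Or.inl rfl) h1 h2 h3
  obtain ⟨z, Zp, Zm, hz, eZp, eZm, pZp, pZm⟩ := h.exists_eigenfunctions (Or.inr rfl) h4 h5 h6
  exact ⟨y, z, Yp, Ym, Zp, Zm, hy, hz, eYp, eYm, eZp, eZm, fun x => by simp [pYp x],
    fun x => by simp [pYm x], fun x => by simp [pZp x], fun x => by simp [pZm x]⟩

/-- Coercivity of B⁺ costs the pairings of f₁ with Im Y⁺ and Im Z⁺, and that of B⁻ costs the pairing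
of f₂ with Q. The first two are recovered from pairings with iY^± and iZ^±, which mix f₁ and f₂. -/
theorem Params.exists_bound {p ω γ : ℝ} (h : Params p ω γ) {y z : ℝ} {Yp Ym Zp Zm : ℝ → ℂ}
    (hm : IsUnstableModes p ω γ y z Yp Ym Zp Zm) :
    ∃ c : ℝ, 0 < c ∧ ∀ f : ℝ → ℂ, MemH1 f →
      c * h1Norm f ^ 2 ≤ B p ω γ f f +
        c⁻¹ * (pairing f (iQ p ω γ) ^ 2 + pairing f (fun x => Complex.I * Yp x) ^ 2 +
          pairing f (fun x => Complex.I * Ym x) ^ 2 + pairing f (fun x => Complex.I * Zp x) ^ 2 +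
          pairing f (fun x => Complex.I * Zm x) ^ 2) := by
  obtain ⟨u, v, a, ha, rfl, rfl, hw, hu, hpu⟩ := h.exists_modes (σ := 1) (by norm_num) hm.y_pos
    hm.eigen_Yp hm.eigen_Ym (fun x => by simp [hm.even_Yp x]) (fun x => by simp [hm.even_Ym x])
  obtain ⟨u', v', b, hb, rfl, rfl, hw', hu', hpu'⟩ := h.exists_modes (σ := -1) (by norm_num)
    hm.z_pos hm.eigen_Zp hm.eigen_Zm (fun x => by simp [hm.odd_Zp x])
    (fun x => by simp [hm.odd_Zm x])
  obtain ⟨c₁, hc₁, hb₁⟩ := Params.exists_coercive (h := h) p (ι := Bool)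
    (fun j => bif j then v else v') fun f hf hj =>
      Params.bil_p_pos_of_orthogonal hm.y_pos.ne' hm.z_pos.ne' hw hw' hu hu' hpu hpu' hf
        (hj true) (hj false)
  obtain ⟨c₂, hc₂, hb₂⟩ := Params.exists_coercive (h := h) 1 (ι := Unit)
    (fun _ => h.groundState) fun f hf hj => h.bil_one_pos hf (hj ())
  set C := c₁⁻¹ * (1 + (a ^ 2)⁻¹ + (b ^ 2)⁻¹) + c₂⁻¹ with hC
  have ha2 : 0 < (a ^ 2)⁻¹ := by positivity
  have hb2 : 0 < (b ^ 2)⁻¹ := by positivity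
  have hc1i : 0 < c₁⁻¹ := inv_pos.2 hc₁
  have hc2i : 0 < c₂⁻¹ := inv_pos.2 hc₂
  have hCpos : 0 < C := by positivity
  set c := min (min c₁ c₂) C⁻¹ with hc
  have hcpos : 0 < c := lt_min (lt_min hc₁ hc₂) (inv_pos.2 hCpos)
  have hcC : C ≤ c⁻¹ := (le_inv_comm₀ hCpos hcpos).2 (min_le_right _ _)
  refine ⟨c, hcpos, fun f hf => ?_⟩
  obtain ⟨f, g, rfl⟩ := hf.exists_eq_toComplex
  rw [h1Norm_toComplex_sq, h.B_toComplex, h.pairing_iQ]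
  simp only [pairing_I_mul_toComplex, map_neg, map_smul, smul_eq_mul, sub_neg_eq_add]
  have e1 := hb₁ f
  have e2 := hb₂ g
  simp only [Fintype.sum_bool, cond_true, cond_false, Finset.univ_unique, Finset.sum_const,
    Finset.card_singleton, one_smul] at e1 e2
  have n1 : c * ‖f‖ ^ 2 ≤ c₁ * ‖f‖ ^ 2 :=
    mul_le_mul_of_nonneg_right ((min_le_left _ _).trans (min_le_left _ _)) (sq_nonneg _)
  have n2 : c * ‖g‖ ^ 2 ≤ c₂ * ‖g‖ ^ 2 :=
    mul_le_mul_of_nonneg_right ((min_le_left _ _).trans (min_le_right _ _)) (sq_nonneg _)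
  -- The pairings with a mode and with t times its conjugate are s - r and t(s + r); since (s-r)² +
  -- (s+r)² ≥ 2r², they control r.
  have key : ∀ {t : ℝ}, t ≠ 0 → ∀ r s : ℝ,
      r ^ 2 ≤ (1 + (t ^ 2)⁻¹) * ((s - r) ^ 2 + (t * s + t * r) ^ 2) := fun {t} ht r s => by
    have h1 : (t ^ 2)⁻¹ * (t * s + t * r) ^ 2 = (s + r) ^ 2 := by field_simp
    have h2 : 0 < (t ^ 2)⁻¹ := by positivity
    have h3 : 0 ≤ (t ^ 2)⁻¹ * (s - r) ^ 2 := by positivity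
    nlinarith [sq_nonneg (t * s + t * r), sq_nonneg (s - r), sq_nonneg s]
  have k1 := key ha (lform f v) (lform g u)
  have k2 := key hb (lform f v') (lform g u')
  set S := (lform g u - lform f v) ^ 2 + (a * lform g u + a * lform f v) ^ 2
  set T := (lform g u' - lform f v') ^ 2 + (b * lform g u' + b * lform f v') ^ 2
  have hS : 0 ≤ S := by positivity
  have hT : 0 ≤ T := by positivity
  have m1 : lform f v ^ 2 + lform f v' ^ 2 ≤ (1 + (a ^ 2)⁻¹ + (b ^ 2)⁻¹) * (S + T) := by
    nlinarith [mul_nonneg hb2.le hS, mul_nonneg ha2.le hT]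
  have m2 : c₁⁻¹ * (lform f v ^ 2 + lform f v' ^ 2) + c₂⁻¹ * lform g h.groundState ^ 2 ≤
      C * (lform g h.groundState ^ 2 + (S + T)) := by
    have h1 := mul_le_mul_of_nonneg_left m1 hc1i.le
    have h2 : 0 ≤ c₁⁻¹ * (1 + (a ^ 2)⁻¹ + (b ^ 2)⁻¹) * lform g h.groundState ^ 2 := by positivity
    have h3 : 0 ≤ c₂⁻¹ * (S + T) := by positivity
    rw [hC]
    linarith
  have m3 : C * (lform g h.groundState ^ 2 + (S + T)) ≤
      c⁻¹ * (lform g h.groundState ^ 2 + (S + T)) :=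
    mul_le_mul_of_nonneg_right hcC (by positivity)
  have m4 : lform g h.groundState ^ 2 + (S + T) = lform g h.groundState ^ 2 +
      (lform g u - lform f v) ^ 2 + (a * lform g u + a * lform f v) ^ 2 +
      (lform g u' - lform f v') ^ 2 + (b * lform g u' + b * lform f v') ^ 2 := by ring
  rw [← m4]
  linarith

/-- All the pairings in the coercivity bound vanish on the orthogonal complement of `G`. -/
theorem Params.pairing_eq_zero_of_mem_orth {p ω γ : ℝ} (h : Params p ω γ) {y z : ℝ}
    {Yp Ym Zp Zm f : ℝ → ℂ} (hm : IsUnstableModes p ω γ y z Yp Ym Zp Zm)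
    (hf : f ∈ orth (G p ω γ Yp Zp)) :
    pairing f (iQ p ω γ) = 0 ∧ pairing f (fun x => Complex.I * Yp x) = 0 ∧
      pairing f (fun x => Complex.I * Ym x) = 0 ∧ pairing f (fun x => Complex.I * Zp x) = 0 ∧
      pairing f (fun x => Complex.I * Zm x) = 0 := by
  obtain ⟨u, v, a, -, rfl, rfl, -, -, -⟩ := h.exists_modes (σ := 1) (by norm_num) hm.y_pos
    hm.eigen_Yp hm.eigen_Ym (fun x => by simp [hm.even_Yp x]) (fun x => by simp [hm.even_Ym x])
  obtain ⟨u', v', b, -, rfl, rfl, -, -, -⟩ := h.exists_modes (σ := -1) (by norm_num)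
    hm.z_pos hm.eigen_Zp hm.eigen_Zm (fun x => by simp [hm.odd_Zp x])
    (fun x => by simp [hm.odd_Zm x])
  obtain ⟨hf1, hfG⟩ := hf
  obtain ⟨f, g, rfl⟩ := hf1.exists_eq_toComplex
  have h0 := hfG _ (Submodule.subset_span (Or.inl rfl))
  have h1 := hfG _ (Submodule.subset_span (Or.inr (Or.inl rfl)))
  have h2 := hfG _ (Submodule.subset_span (Or.inr (Or.inr (Or.inl rfl))))
  have h3 := hfG _ (Submodule.subset_span (Or.inr (Or.inr (Or.inr (Or.inl rfl)))))
  have h4 := hfG _ (Submodule.subset_span (Or.inr (Or.inr (Or.inr (Or.inr rfl)))))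
  rw [pairing_I_mul_re] at h1 h3
  rw [pairing_im] at h2 h4
  refine ⟨h0, ?_⟩
  simp only [pairing_I_mul_toComplex]
  simp [h1, h2, h3, h4]

end DeltaNLS
end

theorem proposition2p4 (p ω γ : ℝ) (hp : 5 < p) (hγ : γ < 0) (hω : γ ^ 2 / 4 < ω) :
    (∃ (y z : ℝ) (Yp Ym Zp Zm : ℝ → ℂ), DeltaNLS.IsUnstableModes p ω γ y z Yp Ym Zp Zm) ∧
    ∀ (y z : ℝ) (Yp Ym Zp Zm : ℝ → ℂ), DeltaNLS.IsUnstableModes p ω γ y z Yp Ym Zp Zm →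
      (∃ c : ℝ, 0 < c ∧ ∀ f ∈ DeltaNLS.orth (DeltaNLS.G p ω γ Yp Zp),
        c * DeltaNLS.h1Norm f ^ 2 ≤ DeltaNLS.B p ω γ f f) ∧
      (∃ c : ℝ, 0 < c ∧ ∀ f : ℝ → ℂ, DeltaNLS.MemH1 f →
        c * DeltaNLS.h1Norm f ^ 2 ≤ DeltaNLS.B p ω γ f f +
          c⁻¹ * (DeltaNLS.pairing f (DeltaNLS.iQ p ω γ) ^ 2 +
            DeltaNLS.pairing f (fun x => Complex.I * Yp x) ^ 2 +
            DeltaNLS.pairing f (fun x => Complex.I * Ym x) ^ 2 +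
            DeltaNLS.pairing f (fun x => Complex.I * Zp x) ^ 2 +
            DeltaNLS.pairing f (fun x => Complex.I * Zm x) ^ 2)) := by
  have h : DeltaNLS.Params p ω γ := ⟨hp, hγ, hω⟩
  refine ⟨h.exists_isUnstableModes, fun y z Yp Ym Zp Zm hm => ?_⟩
  obtain ⟨c, hc, hb⟩ := h.exists_bound hm
  -- The constrained bound is the penalised one with all penalties zero, so the same constant serves
  -- both.
  refine ⟨⟨c, hc, fun f hf => ?_⟩, c, hc, hb⟩
  obtain ⟨h1, h2, h3, h4, h5⟩ := h.pairing_eq_zero_of_mem_orth hm hf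
  simpa [h1, h2, h3, h4, h5] using hb f hf.1
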